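/- Let $k,\ell,m\ge 0$ and $n\ge 2$ be integers with $m$ even and $k+\ell+m=n$. **Notation.** $\operatorname{Gr}(r,n)$ is the set of $r$-dimensional subspaces of $\mathbb R^n$; a point of it is represented by a real $r\times n$ matrix with that row span, and its Plücker coordinates $\Delta_J$ ($J\subset[n]=\{1,\dots,n\}$, $|J|=r$) are the maximal minors of such a matrix, defined up to a common nonzero factor. $\operatorname{Gr}_{\ge0}(r,n)$ (resp. $\operatorname{Gr}_{>0}(r,n)$) is the set of points having a representative all of whose maximal minors are $\ge0$ (resp. $>0$), and $(\operatorname{Gr}_{>0}(r,n))^\perp=\{Z^\perp: Z\in\operatorname{Gr}_{>0}(r,n)\}\subset\operatorname{Gr}(n-r,n)$, with $\perp$ for the standard inner product. For integers $a,b\ge 0$ let $\tilde S_n(-a,b)$ be the set of bijections $f:\mathbb Z\to\mathbb Z$ with $f(i+n)=f(i)+n$ and $i-a\le f(i)\le i+b$ for all $i\in\mathbb Z$, and $\sum_{i=1}^n(f(i)-i)=0$. For $0\le r\le n$, $f\in\tilde S_n(-r,n-r)$ and $i\in[n]$, put $I_i=\{f(j)+r: j<i,\ f(j)+r\ge i\}$,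 reduced modulo $n$ to an $r$-element subset of $[n]$. Let $\preceq_i$ be the total order $i\prec_i i+1\prec_i\dots\prec_i i+n-1$ on $[n]$ (indices modulo $n$), extended to $r$-element subsets by comparing their increasingly listed elements termwise. The positroid of $f$ is $\mathcal M_{f}=\{J\subset[n]: |J|=r,\ I_i\preceq_i J\text{ for all } i\in[n]\}$, and the positroid cell $\Pi^{(r)}_f\subset\operatorname{Gr}_{\ge0}(r,n)$ consists of the points having a representative with $\Delta_J>0$ for $J\in\mathcal M_f$ and $\Delta_J=0$ for all other $r$-element $J$. For $0\le m\le n-r$ put $\operatorname{Gr}_{\ge m}(r,n)=\bigcup_{f\in\tilde S_n(-r,n-r-m)}\Pi^{(r)}_f$. **Stacked twist map.** Let $V$ be a real $k\times n$ matrix and $W$ a real $\ell\times n$ matrix, and let $U=\binom{V}{W}$ have columns $U(1),\dots,U(n)$, extended to all $j\in\mathbb Z$ by $U(j+n)=(-1)^{k-1}U(j)$. Write $U\in\operatorname{Mat}^\circ(k+\ell,n)$ if for every $j\in\mathbb Z$ the vectors $U(j-\ell),U(j-\ell+1),\dots,U(j+k-1)$ form a basis of $\mathbb R^{k+\ell}$.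 In that case, for $1\le j\le n$ let $\tilde u(j)\in\mathbb R^{k+\ell}$ be the unique vector such that, for $0\le t<k+\ell$, $\langle\tilde u(j),U(j-\ell+t)\rangle$ equals $(-1)^j$ if $t=0$ and $0$ otherwise; let $\tilde U$ be the matrix with columns $\tilde u(1),\dots,\tilde u(n)$, let $\tilde W$ consist of its first $k$ rows and $\tilde V$ of its last $\ell$ rows, and put $\theta(V,W)=(\tilde W,\tilde V)$. **Theorem.** Let $V$ be a $k\times n$ matrix representing a point of $\operatorname{Gr}_{\ge m}(k,n)$ and $W$ an $\ell\times n$ matrix representing a point of $(\operatorname{Gr}_{>0}(k+m,n))^\perp$. Then: 1. $\binom{V}{W}\in\operatorname{Mat}^\circ(k+\ell,n)$, so $\theta(V,W)=(\tilde W,\tilde V)$ is defined. 2. The row span of $\tilde W$ lies in $(\operatorname{Gr}_{>0}(\ell+m,n))^\perp$, and the row span of $\tilde V$ lies in $\operatorname{Gr}_{\ge m}(\ell,n)$. 3. There is exactly one $f\in\tilde S_n(-k,n-k)$ such that the row span of $V$ lies in $\Pi^{(k)}_f$. This $f$ belongs to $\tilde S_n(-k,\ell)$, its inverse $f^{-1}$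 belongs to $\tilde S_n(-\ell,k)$, and the row span of $\tilde V$ lies in $\Pi^{(\ell)}_{f^{-1}}$. -/

import Mathlib

open Matrix

noncomputable section

namespace StackedTwist

/-! ### Affine permutations -/

/-- The affine Coxeter group `S̃ₙ`: bijections `f : ℤ → ℤ` such that `f (i + n) = f i + n` for all
`i` and `∑_{i = 1}^{n} (f i - i) = 0`. -/
def affinePerms (n : ℕ) : Set (Equiv.Perm ℤ) :=
  {f | (∀ i : ℤ, f (i + n) = f i + n) ∧ ∑ i ∈ Finset.Icc (1 : ℤ) n, (f i - i) = 0}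

/-- The set `S̃ₙ(-a, b)` of those `f ∈ S̃ₙ` with `i - a ≤ f i ≤ i + b` for all `i`. -/
def boundedAffinePerms (n a b : ℕ) : Set (Equiv.Perm ℤ) :=
  {f | f ∈ affinePerms n ∧ ∀ i : ℤ, i - a ≤ f i ∧ f i ≤ i + b}

/-! ### The Grassmannian and Plücker coordinates

The set `[n] = {1, …, n}` is modelled by `Fin n`, the element `c : Fin n` standing for the
number `c + 1`. -/

/-- The row span of a matrix, as a subspace of `ℝⁿ`. -/
def rowSpan {ι : Type*} {n : ℕ} (M : Matrix ι (Fin n) ℝ) : Submodule ℝ (Fin n → ℝ) :=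
  Submodule.span ℝ (Set.range M.row)

/-- The Grassmannian `Gr(k, n)` of `k`-dimensional subspaces of `ℝⁿ`. -/
def Gr (k n : ℕ) : Set (Submodule ℝ (Fin n → ℝ)) :=
  {X | Module.finrank ℝ X = k}

/-- The maximal minor `Δ_J(M)` of a `k × n` matrix with column set `J` (columns in increasing
order). The Plücker coordinates of `X ∈ Gr(k, n)` are the `Δ_J(M)` for any `k × n` matrix `M` with
row span `X`; they are defined up to a common nonzero factor. -/
def minor {k n : ℕ} (M : Matrix (Fin k) (Fin n) ℝ) (J : Finset (Fin n)) (hJ : J.card = k) : ℝ :=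
  (M.submatrix id (J.orderEmbOfFin hJ)).det

/-- The totally nonnegative Grassmannian `Gr_{≥0}(k, n)`. -/
def GrNonneg (k n : ℕ) : Set (Submodule ℝ (Fin n → ℝ)) :=
  {X | X ∈ Gr k n ∧ ∃ M : Matrix (Fin k) (Fin n) ℝ, rowSpan M = X ∧
    ∀ (J : Finset (Fin n)) (hJ : J.card = k), 0 ≤ minor M J hJ}

/-- The totally positive Grassmannian `Gr_{>0}(k, n)`. -/
def GrPos (k n : ℕ) : Set (Submodule ℝ (Fin n → ℝ)) :=
  {X | X ∈ Gr k n ∧ ∃ M : Matrix (Fin k) (Fin n) ℝ, rowSpan M = X ∧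
    ∀ (J : Finset (Fin n)) (hJ : J.card = k), 0 < minor M J hJ}

/-- The orthogonal complement in `ℝⁿ` for the standard inner product. -/
def perp {n : ℕ} (X : Submodule ℝ (Fin n → ℝ)) : Submodule ℝ (Fin n → ℝ) :=
  X.orthogonalBilin (dotProductBilin ℝ ℝ)

/-- `(Gr_{>0}(r, n))^⊥ = {Z^⊥ | Z ∈ Gr_{>0}(r, n)}`, a set of `(n - r)`-dimensional subspaces. -/
def GrPosPerp (r n : ℕ) : Set (Submodule ℝ (Fin n → ℝ)) :=
  {X | ∃ Z ∈ GrPos r n, X = perp Z}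

/-! ### Positroids and positroid cells -/

/-- The element of `[n]` congruent to `j` modulo `n`. -/
def residue (n : ℕ) [NeZero n] (j : ℤ) : Fin n :=
  ⟨(j - 1).natMod n, Int.natMod_lt (NeZero.ne n)⟩

/-- The position (counted from `0`) of an element of `[n]` in the total order
`i ≺ᵢ i + 1 ≺ᵢ ⋯ ≺ᵢ i + n - 1` (taken modulo `n`). -/
def cyclicPos (n : ℕ) (i : ℤ) (c : Fin n) : ℤ :=
  (((c : ℕ) : ℤ) + 1 - i) % (n : ℤ)

/-- The relation `S ≼ᵢ T` on `k`-element subsets of `[n]`: writing `S = {s₁ ≺ᵢ ⋯ ≺ᵢ sₖ}` and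
`T = {t₁ ≺ᵢ ⋯ ≺ᵢ tₖ}`, one has `s_p ≼ᵢ t_p` for all `p`. -/
def galeLE (k n : ℕ) (i : ℤ) (S T : Set (Fin n)) : Prop :=
  ∃ s t : Fin k → Fin n,
    StrictMono (fun p => cyclicPos n i (s p)) ∧ StrictMono (fun p => cyclicPos n i (t p)) ∧
    Set.range s = S ∧ Set.range t = T ∧
    ∀ p, cyclicPos n i (s p) ≤ cyclicPos n i (t p)

/-- The term `Iᵢ = {f j + k | j < i, f j + k ≥ i}` (modulo `n`) of the Grassmann necklace of
`f ∈ S̃ₙ(-k, n - k)`. -/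
def necklace (k n : ℕ) [NeZero n] (f : Equiv.Perm ℤ) (i : ℤ) : Set (Fin n) :=
  {c | ∃ j : ℤ, j < i ∧ i ≤ f j + k ∧ residue n (f j + k) = c}

/-- The positroid of `f ∈ S̃ₙ(-k, n - k)`: the `k`-element subsets `J` of `[n]` with `Iᵢ ≼ᵢ J`
for all `i ∈ [n]`. -/
def positroid (k n : ℕ) [NeZero n] (f : Equiv.Perm ℤ) : Set (Finset (Fin n)) :=
  {J | J.card = k ∧ ∀ i : ℤ, 1 ≤ i → i ≤ n → galeLE k n i (necklace k n f i) (J : Set (Fin n))}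

/-- The (open) positroid cell of `f ∈ S̃ₙ(-k, n - k)`: the points of `Gr_{≥0}(k, n)` whose Plücker
coordinates are positive on the positroid of `f` and zero outside of it. -/
def positroidCell (k n : ℕ) [NeZero n] (f : Equiv.Perm ℤ) : Set (Submodule ℝ (Fin n → ℝ)) :=
  {X | X ∈ GrNonneg k n ∧ ∃ M : Matrix (Fin k) (Fin n) ℝ, rowSpan M = X ∧
    ∀ (J : Finset (Fin n)) (hJ : J.card = k),
      (J ∈ positroid k n f → 0 < minor M J hJ) ∧ (J ∉ positroid k n f → minor M J hJ = 0)}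

/-- `Gr_{≥m}(k, n)`, for `m ≤ n - k`: the union of the positroid cells of all
`f ∈ S̃ₙ(-k, n - k - m)`. -/
def GrGE (m k n : ℕ) [NeZero n] : Set (Submodule ℝ (Fin n → ℝ)) :=
  {X | ∃ f ∈ boundedAffinePerms n k (n - k - m), X ∈ positroidCell k n f}

/-! ### The stacked twist map -/

/-- The `j`-th column `M(j)`, `j ∈ ℤ`, of a matrix with `n` columns: for `1 ≤ j ≤ n` it is the
usual one, and `M(j + n) = (-1)^(k - 1) M(j)` for all `j`. -/
def extCol {ι : Type*} {n : ℕ} [NeZero n] (k : ℕ) (M : Matrix ι (Fin n) ℝ) (j : ℤ) : ι → ℝ :=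
  (-1 : ℝ) ^ (((k : ℤ) - 1) * ((j - 1) / (n : ℤ))) • M.col (residue n j)

/-- `stack(V, W)`; the space `ℝ^(k + ℓ)` is written as `Fin k ⊕ Fin ℓ → ℝ`. -/
def stack {k ℓ n : ℕ} (V : Matrix (Fin k) (Fin n) ℝ) (W : Matrix (Fin ℓ) (Fin n) ℝ) :
    Matrix (Fin k ⊕ Fin ℓ) (Fin n) ℝ :=
  Matrix.fromRows V W

/-- The list of vectors `U(j - ℓ), U(j - ℓ + 1), …, U(j + k - 1)`. -/
def window {k ℓ n : ℕ} [NeZero n] (U : Matrix (Fin k ⊕ Fin ℓ) (Fin n) ℝ) (j : ℤ) :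
    Fin (k + ℓ) → (Fin k ⊕ Fin ℓ → ℝ) :=
  fun t => extCol k U (j - ℓ + ((t : ℕ) : ℤ))

/-- `U ∈ Mat°(k + ℓ, n)`: for all `j ∈ ℤ`, the vectors `U(j - ℓ), …, U(j + k - 1)` form a basis
of `ℝ^(k + ℓ)`. -/
def IsCircular {k ℓ n : ℕ} [NeZero n] (U : Matrix (Fin k ⊕ Fin ℓ) (Fin n) ℝ) : Prop :=
  ∀ j : ℤ, LinearIndependent ℝ (window U j) ∧ Submodule.span ℝ (Set.range (window U j)) = ⊤

/-- The equations defining the vector `ũ(j)`: its inner product with `U(j - ℓ)` is `(-1)^j`, and its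
inner products with `U(j - ℓ + 1), …, U(j + k - 1)` are `0`. -/
def IsTwistCol {k ℓ n : ℕ} [NeZero n] (U : Matrix (Fin k ⊕ Fin ℓ) (Fin n) ℝ) (j : ℤ)
    (u : Fin k ⊕ Fin ℓ → ℝ) : Prop :=
  ∀ t : Fin (k + ℓ), u ⬝ᵥ window U j t = if (t : ℕ) = 0 then (-1 : ℝ) ^ j else 0

theorem existsUnique_isTwistCol {k ℓ n : ℕ} [NeZero n] {U : Matrix (Fin k ⊕ Fin ℓ) (Fin n) ℝ}
    (hU : IsCircular U) (j : ℤ) : ∃! u, IsTwistCol U j u := by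
  obtain ⟨-, hs⟩ := hU j
  let L : (Fin k ⊕ Fin ℓ → ℝ) →ₗ[ℝ] (Fin (k + ℓ) → ℝ) :=
    Matrix.mulVecLin (Matrix.of (window U j))
  have hL : ∀ u t, L u t = u ⬝ᵥ window U j t := by
    intro u t
    rw [dotProduct_comm]
    rfl
  have hinj : Function.Injective L := by
    rw [injective_iff_map_eq_zero]
    intro u hu
    have h0 : ∀ v : Fin k ⊕ Fin ℓ → ℝ, u ⬝ᵥ v = 0 := by
      intro v
      have hv : v ∈ Submodule.span ℝ (Set.range (window U j)) := by rw [hs]; trivial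
      induction hv using Submodule.span_induction with
      | mem x hx =>
        obtain ⟨t, rfl⟩ := hx
        rw [← hL, hu]; rfl
      | zero => simp
      | add x y _ _ hx hy => rw [dotProduct_add, hx, hy, add_zero]
      | smul a x _ hx => rw [dotProduct_smul, hx, smul_zero]
    exact dotProduct_self_eq_zero.1 (h0 u)
  have hsurj : Function.Surjective L :=
    (LinearMap.injective_iff_surjective_of_finrank_eq_finrank (by simp)).1 hinj
  obtain ⟨u, hu⟩ := hsurj (fun t => if (t : ℕ) = 0 then (-1 : ℝ) ^ j else 0)
  refine ⟨u, fun t => by rw [← hL, hu], fun w hw => hinj ?_⟩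
  rw [hu]
  funext t
  rw [hL, hw t]

/-- The matrix `Ũ = τ(U)`, whose `j`-th column for `1 ≤ j ≤ n` is `ũ(j)`. -/
def twist {k ℓ n : ℕ} [NeZero n] (U : Matrix (Fin k ⊕ Fin ℓ) (Fin n) ℝ) (hU : IsCircular U) :
    Matrix (Fin k ⊕ Fin ℓ) (Fin n) ℝ :=
  Matrix.of fun r c => (existsUnique_isTwistCol hU (((c : ℕ) : ℤ) + 1)).choose r

/-- The stacked twist map `θ(V, W) = (W̃, Ṽ)`, where `stack(W̃, Ṽ) = τ(stack(V, W))`. -/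
def stackedTwist {k ℓ n : ℕ} [NeZero n] (V : Matrix (Fin k) (Fin n) ℝ)
    (W : Matrix (Fin ℓ) (Fin n) ℝ) (hU : IsCircular (stack V W)) :
    Matrix (Fin k) (Fin n) ℝ × Matrix (Fin ℓ) (Fin n) ℝ :=
  ((twist (stack V W) hU).toRows₁, (twist (stack V W) hU).toRows₂)

end StackedTwist

end

noncomputable section

namespace StackedTwist

/-! Columns are extended to all of `ℤ`. With quasi-period sign `(-1)^(k+1)`, moving an index of a
`k`-minor by a full period and re-sorting does not change the minor. Total positivity thus becomes a
cyclically symmetric condition on sequences. It is stated through products of two minors (`CycPos`,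
`CycNonneg`), so that it does not depend on the matrix chosen for a row span.

Part 1. Let `Z` be the totally positive matrix orthogonal to `W`. A relation among `k + ℓ`
consecutive stacked columns is a relation among columns of `W`, so its coefficients are `y · Z(j)`
for some `y`. The `V`-part of the relation then makes a `(k+m) × (k+m)` determinant vanish unless `y
= 0`. By Cauchy–Binet this determinant is a sum of products of minors of `V` and `Z`, all of one
sign and not all zero (`Admissible.windowsIndep_stackSeq`).

Part 2 is a deformation argument. By Oh's theorem (`exists_cyclicInterval_of_dependent`) the bases
of a totally nonnegative sequence are determined by the ranks of cyclic intervals. Hence a totally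
nonnegative sequence with nonvanishing consecutive minors is totally positive. The consecutive
minors of the upper half of the twist never vanish, and those of the lower half do not vanish when
`V` is totally positive. So positivity of the twist is both open and closed along paths of totally
positive data (`cycPos_of_preconnected`). Such paths come from the flow `x ↦ x + a • x(· ± 1)` on
`V` and `Z`, combined with the inverse of its adjoint on `W`. Iterating it drives every totally
positive pair, up to row operations, to the trigonometric moment curve (`twistPos_of_normalized`).
At that point the shift acts by orthogonal maps and the twist is explicit (`twistPos_hartley`). A
totally nonnegative `V` is a limit of totally positive ones with the same `W` (`Admissible.twist`).
The evenness of `m` makes the signs for `k` and `k + m` agree, and centres the `k` frequencies of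
`V` among the `k + m` of `Z`. Complementary minors turn the alternating positivity of `W̃` into
positivity of its orthogonal complement (`seqMinor_mul_pos_of_annihilator`).

Part 3. Vectors annihilating an interval of columns of `Ṽ` correspond to linear relations among
columns of `V` on a complementary part of a window, which gives the interval ranks of `Ṽ` from those
of `V` (`intervalRank_botSeq`). The same identity relates the necklace counts of `f` and `f⁻¹`
(`necklaceCount_inv`). By Oh's theorem these ranks determine the cell of `Ṽ`. -/

/-! ### Maximal minors of families of vectors -/

/-- The maximal minor of a family of vectors of `ℝᵏ` on an indexed list of labels. -/
def seqMinor {ι : Type*} {k : ℕ} (x : ι → Fin k → ℝ) (c : Fin k → ι) : ℝ :=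
  Matrix.det (Matrix.of fun p => x (c p))

theorem seqMinor_def {ι : Type*} {k : ℕ} (x : ι → Fin k → ℝ) (c : Fin k → ι) :
    seqMinor x c = (detRowAlternating : (Fin k → ℝ) [⋀^Fin k]→ₗ[ℝ] ℝ) (fun p => x (c p)) := rfl

theorem seqMinor_ne_zero_iff {ι : Type*} {k : ℕ} (x : ι → Fin k → ℝ) (c : Fin k → ι) :
    seqMinor x c ≠ 0 ↔ LinearIndependent ℝ (fun p => x (c p)) := by
  unfold seqMinor
  rw [← isUnit_iff_ne_zero, ← Matrix.isUnit_iff_isUnit_det, ← Matrix.linearIndependent_rows_iff_isUnit]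
  rfl

/-- Left multiplication by a matrix scales all maximal minors. -/
theorem seqMinor_mulVec {ι : Type*} {k : ℕ} (A : Matrix (Fin k) (Fin k) ℝ) (x : ι → Fin k → ℝ)
    (c : Fin k → ι) : seqMinor (fun j => A *ᵥ x j) c = A.det * seqMinor x c := by
  unfold seqMinor
  rw [mul_comm, ← Matrix.det_transpose A, ← Matrix.det_mul]
  congr 1
  ext p q
  simp [Matrix.mul_apply, Matrix.mulVec, dotProduct, mul_comm]

theorem seqMinor_smul {ι : Type*} {k : ℕ} (s : ι → ℝ) (x : ι → Fin k → ℝ) (c : Fin k → ι) :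
    seqMinor (fun j => s j • x j) c = (∏ p, s (c p)) * seqMinor x c := by
  rw [seqMinor_def, seqMinor_def]
  exact AlternatingMap.map_smul_univ _ (fun p => s (c p)) (fun p => x (c p))

/-- The Cauchy–Binet formula, for an alternating map in place of the determinant. -/
theorem AlternatingMap.cauchyBinet {ι E : Type*} [Fintype ι] [LinearOrder ι] [AddCommGroup E]
    [Module ℝ E] {k : ℕ} (F : E [⋀^Fin k]→ₗ[ℝ] ℝ) (A : Fin k → ι → ℝ) (y : ι → E) :
    F (fun p => ∑ i, A p i • y i) =
      ∑ c : {c : Fin k → ι // StrictMono c},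
        Matrix.det (Matrix.of fun p q => A p (c.1 q)) * F (fun p => y (c.1 p)) := by
  classical
  have h1 : F (fun p => ∑ i, A p i • y i) =
      ∑ c : Fin k → ι, (∏ p, A p (c p)) * F (fun p => y (c p)) := by
    have := F.toMultilinearMap.map_sum (fun p i => A p i • y i)
    refine this.trans (Finset.sum_congr rfl fun c _ => ?_)
    exact F.toMultilinearMap.map_smul_univ (fun p => A p (c p)) (fun p => y (c p))
  have h2 : ∑ c : Fin k → ι, (∏ p, A p (c p)) * F (fun p => y (c p)) =
      ∑ c : Fin k → ι with Function.Injective c, (∏ p, A p (c p)) * F (fun p => y (c p)) := by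
    symm
    refine Finset.sum_subset (Finset.subset_univ _) fun c _ hc => ?_
    have hc' : ¬ Function.Injective c := by simpa using hc
    have : ¬ Function.Injective (fun p => y (c p)) := fun h => hc' fun a b hab => h (by simp [hab])
    rw [F.map_eq_zero_of_not_injective _ this, mul_zero]
  have h3 : ∀ c : {c : Fin k → ι // StrictMono c},
      Matrix.det (Matrix.of fun p q => A p (c.1 q)) * F (fun p => y (c.1 p)) =
      ∑ σ : Equiv.Perm (Fin k), (∏ p, A p (c.1 (σ p))) * F (fun p => y (c.1 (σ p))) := by
    intro c
    rw [← Matrix.det_transpose, Matrix.det_apply', Finset.sum_mul]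
    refine Finset.sum_congr rfl fun σ _ => ?_
    have := F.map_perm (fun p => y (c.1 p)) σ
    rw [show (fun p => y (c.1 (σ p))) = (fun p => y (c.1 p)) ∘ σ from rfl, this]
    simp only [Matrix.transpose_apply, Matrix.of_apply]
    rw [Units.smul_def, zsmul_eq_mul]
    ring
  -- Each injective index function is uniquely an increasing one after a permutation; the signs of
  -- the permutations assemble the determinants.
  rw [h1, h2, Finset.sum_congr rfl fun c _ => h3 c, ← Finset.sum_product', Finset.univ_product_univ]
  symm
  refine Finset.sum_bij (fun (cs : {c : Fin k → ι // StrictMono c} × Equiv.Perm (Fin k)) _ =>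
    cs.1.1 ∘ cs.2) ?_ ?_ ?_ ?_
  · rintro ⟨c, σ⟩ _
    simpa using c.2.injective
  · rintro ⟨c, σ⟩ _ ⟨c', σ'⟩ _ h
    simp only at h
    have hr : Set.range c.1 = Set.range c'.1 := by
      rw [← σ.surjective.range_comp c.1, h, σ'.surjective.range_comp]
    have hcc : c = c' := Subtype.ext ((StrictMono.range_inj c.2 c'.2).1 hr)
    subst hcc
    refine Prod.ext rfl (Equiv.ext fun p => c.2.injective (congrFun h p))
  · intro c hc
    have hc' : Function.Injective c := by simpa using hc
    refine ⟨(⟨c ∘ Tuple.sort c, (Tuple.monotone_sort c).strictMono_of_injective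
      (hc'.comp (Tuple.sort c).injective)⟩, (Tuple.sort c)⁻¹), Finset.mem_univ _, ?_⟩
    funext p
    simp
  · intros
    rfl

/-- Cramer's rule: the alternating dependency among `k + 1` vectors of `ℝᵏ`. -/
theorem cramer_dependency {ι : Type*} {k : ℕ} (x : ι → Fin k → ℝ) (s : Fin (k + 1) → ι) :
    ∑ p : Fin (k + 1), ((-1 : ℝ) ^ (p : ℕ) * seqMinor x (s ∘ p.succAbove)) • x (s p) = 0 := by
  funext q
  -- A matrix whose top row repeats row `q + 1` is singular; its expansion along the top row is
  -- coordinate `q` of the relation.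
  have h0 : (Matrix.of fun i p : Fin (k + 1) =>
      (Fin.cons (x (s p) q) (x (s p)) : Fin (k + 1) → ℝ) i).det = 0 := by
    refine Matrix.det_zero_of_row_eq (i := 0) (j := q.succ) (Fin.succ_ne_zero q).symm ?_
    funext p
    simp
  rw [Matrix.det_succ_row_zero] at h0
  simp only [Finset.sum_apply, Pi.smul_apply, smul_eq_mul, Pi.zero_apply]
  rw [← h0]
  refine Finset.sum_congr rfl fun p _ => ?_
  simp only [Matrix.of_apply, Fin.cons_zero]
  rw [mul_right_comm]
  congr 1
  unfold seqMinor
  rw [← Matrix.det_transpose]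
  congr 1

/-! ### Quasi-periodic sequences and cyclically increasing indices -/

/-- Quasi-periodicity `x (j + n) = e • x j`. -/
def Quasi (n : ℕ) (e : ℝ) {E : Type*} [AddCommGroup E] [Module ℝ E] (x : ℤ → E) : Prop :=
  ∀ j, x (j + n) = e • x j

/-- Strictly increasing indices spanning less than a period. -/
def CycMono (n : ℕ) {k : ℕ} (c : Fin k → ℤ) : Prop :=
  StrictMono c ∧ ∀ p q, c p < c q + n

/-- All cyclic minors have weakly the same sign. -/
def CycNonneg (n : ℕ) {k : ℕ} (x : ℤ → Fin k → ℝ) : Prop :=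
  ∀ c c' : Fin k → ℤ, CycMono n c → CycMono n c' → 0 ≤ seqMinor x c * seqMinor x c'

/-- All cyclic minors are nonzero and have the same sign. -/
def CycPos (n : ℕ) {k : ℕ} (x : ℤ → Fin k → ℝ) : Prop :=
  ∀ c c' : Fin k → ℤ, CycMono n c → CycMono n c' → 0 < seqMinor x c * seqMinor x c'

theorem CycPos.cycNonneg {n k : ℕ} {x : ℤ → Fin k → ℝ} (h : CycPos n x) : CycNonneg n x :=
  fun c c' hc hc' => (h c c' hc hc').le

theorem CycPos.ne_zero {n k : ℕ} {x : ℤ → Fin k → ℝ} (h : CycPos n x) {c : Fin k → ℤ}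
    (hc : CycMono n c) : seqMinor x c ≠ 0 := fun h0 => by
  have := h c c hc hc
  simp [h0] at this

theorem cycMono_of_mem {n k : ℕ} {c : Fin k → ℤ} (h : StrictMono c) (a : ℤ)
    (h1 : ∀ p, a ≤ c p ∧ c p < a + n) : CycMono n c :=
  ⟨h, fun p q => by have := h1 p; have := h1 q; omega⟩

theorem cycMono_consec {n k : ℕ} (hk : k ≤ n) (a : ℤ) :
    CycMono n (fun p : Fin k => a + (p : ℕ)) :=
  cycMono_of_mem (fun p q h => by have : (p : ℕ) < q := h; simpa using this) a
    fun p => ⟨by omega, by omega⟩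

theorem quasi_mul {n : ℕ} {e : ℝ} {E : Type*} [AddCommGroup E] [Module ℝ E] {x : ℤ → E}
    (h : Quasi n e x) (he : e * e = 1) (t j : ℤ) : ∃ s : ℝ, s * s = 1 ∧ x (j + n * t) = s • x j := by
  induction t using Int.induction_on with
  | zero => exact ⟨1, by simp, by simp⟩
  | succ i ih =>
    obtain ⟨s, hs, hx⟩ := ih
    refine ⟨e * s, by linear_combination hs + s * s * he, ?_⟩
    rw [show j + (n : ℤ) * (i + 1) = j + n * i + n by ring, h, hx, smul_smul]
  | pred i ih =>
    obtain ⟨s, hs, hx⟩ := ih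
    refine ⟨e * s, by linear_combination hs + s * s * he, ?_⟩
    have h2 := h (j + n * (-i - 1))
    rw [show j + (n : ℤ) * (-i - 1) + n = j + n * -i by ring, hx] at h2
    rw [mul_smul, h2, smul_smul, he, one_smul]

theorem neg_one_pow_mul_self (k : ℕ) : ((-1 : ℝ) ^ k) * (-1) ^ k = 1 := by
  rw [← mul_pow]; simp

/-- The cyclic rotation of `K + 1` rows has sign `(-1)^K` and the quasi-period contributes
`(-1)^(K+2)`; the two cancel. This is why the sign `(-1)^(k+1)` is used for sequences in `ℝᵏ`. -/
theorem seqMinor_cons_sub {n K : ℕ} {x : ℤ → Fin (K + 1) → ℝ} (h : Quasi n ((-1) ^ (K + 1 + 1)) x)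
    (init : Fin K → ℤ) (b : ℤ) :
    seqMinor x (Fin.cons (b - n) init) = seqMinor x (Fin.snoc init b) := by
  have h1 : (Fin.snoc init b : Fin (K + 1) → ℤ) =
      fun i => (Fin.cons b init : Fin (K + 1) → ℤ) (finRotate _ i) := Fin.snoc_eq_cons_rotate _ _
  have h2 : seqMinor x (Fin.snoc init b) = (-1) ^ K * seqMinor x (Fin.cons b init) := by
    rw [h1]
    unfold seqMinor
    have := Matrix.det_permute (finRotate (K + 1))
      (Matrix.of fun p => x ((Fin.cons b init : Fin (K + 1) → ℤ) p))
    rw [sign_finRotate] at this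
    simp only [Nat.add_sub_cancel] at this
    push_cast at this
    rw [← this]
    rfl
  have h3 : seqMinor x (Fin.cons b init) = (-1) ^ (K + 1 + 1) * seqMinor x (Fin.cons (b - n) init) := by
    have hb : x b = (-1 : ℝ) ^ (K + 1 + 1) • x (b - n) := by rw [← h]; simp
    have e1 : (fun p => x ((Fin.cons b init : Fin (K + 1) → ℤ) p)) =
        Function.update (fun p => x ((Fin.cons (b - n) init : Fin (K + 1) → ℤ) p)) 0
          ((-1 : ℝ) ^ (K + 1 + 1) • x (b - n)) := by
      funext p
      refine Fin.cases ?_ (fun i => ?_) p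
      · simp [hb]
      · simp
    rw [seqMinor_def, seqMinor_def, e1, AlternatingMap.map_update_smul, smul_eq_mul]
    congr 2
    funext p
    refine Fin.cases ?_ (fun i => ?_) p <;> simp
  rw [h2, h3, ← mul_assoc, ← pow_add, show K + (K + 1 + 1) = 2 * (K + 1) by ring, pow_mul]
  simp

theorem CycMono.cons_sub {n K : ℕ} {c : Fin (K + 1) → ℤ} (hc : CycMono n c) (hn : 0 < n) :
    CycMono n (Fin.cons (c (Fin.last K) - n) (fun i : Fin K => c i.castSucc) :
      Fin (K + 1) → ℤ) := by
  obtain ⟨h1, h2⟩ := hc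
  refine ⟨?_, ?_⟩
  · rw [Fin.strictMono_iff_lt_succ]
    intro i
    rcases i with ⟨i, hi⟩
    cases i with
    | zero =>
      have := h2 (Fin.last K) (Fin.castSucc ⟨0, hi⟩)
      simp only [Fin.cons_succ]
      rw [show (Fin.castSucc ⟨0, hi⟩ : Fin (K + 1)) = 0 from rfl] at *
      rw [Fin.cons_zero]
      linarith
    | succ i =>
      rw [show (Fin.castSucc ⟨i + 1, hi⟩ : Fin (K + 1)) = Fin.succ ⟨i, by omega⟩ from rfl]
      rw [Fin.cons_succ, Fin.cons_succ]
      exact h1 (by simp [Fin.lt_def])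
  · intro p q
    refine Fin.cases ?_ (fun p' => ?_) p <;> refine Fin.cases ?_ (fun q' => ?_) q
    · simpa using hn
    · simp only [Fin.cons_zero, Fin.cons_succ]
      have := h2 (Fin.last K) q'.castSucc
      linarith
    · simp only [Fin.cons_zero, Fin.cons_succ]
      have := h1 (Fin.castSucc_lt_last p')
      linarith
    · simp only [Fin.cons_succ]
      exact h2 _ _

theorem CycMono.snoc_add {n K : ℕ} {c : Fin (K + 1) → ℤ} (hc : CycMono n c) (hn : 0 < n) :
    CycMono n (Fin.snoc (fun i : Fin K => c i.succ) (c 0 + n) : Fin (K + 1) → ℤ) := by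
  obtain ⟨h1, h2⟩ := hc
  refine ⟨?_, ?_⟩
  · intro p q hpq
    induction p using Fin.lastCases with
    | last => exact absurd hpq (not_lt.2 (Fin.le_last q))
    | cast p =>
      induction q using Fin.lastCases with
      | last =>
        simp only [Fin.snoc_castSucc, Fin.snoc_last]
        exact h2 _ _
      | cast q =>
        simp only [Fin.snoc_castSucc]
        exact h1 (by simpa using hpq)
  · intro p q
    induction p using Fin.lastCases with
    | last =>
      induction q using Fin.lastCases with
      | last => simpa using hn
      | cast q =>
        simp only [Fin.snoc_castSucc, Fin.snoc_last]
        have := h1 (Fin.succ_pos q)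
        linarith
    | cast p =>
      induction q using Fin.lastCases with
      | last =>
        simp only [Fin.snoc_castSucc, Fin.snoc_last]
        have := h2 p.succ 0
        omega
      | cast q =>
        simp only [Fin.snoc_castSucc]
        exact h2 _ _

/-- A cyclic minor equals the minor of the sorted representatives in any given period. -/
theorem exists_rotate {n k : ℕ} (hn : 0 < n) {x : ℤ → Fin k → ℝ}
    (h : Quasi n ((-1) ^ (k + 1)) x) {c : Fin k → ℤ} (hc : CycMono n c) (a : ℤ) :
    ∃ c' : Fin k → ℤ, StrictMono c' ∧ (∀ p, a ≤ c' p ∧ c' p < a + n) ∧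
      seqMinor x c' = seqMinor x c ∧ ∀ p, ∃ q t, c' p = c q + n * t := by
  cases k with
  | zero => exact ⟨c, hc.1, fun p => p.elim0, rfl, fun p => p.elim0⟩
  | succ K =>
  -- The smallest index is moved up by a period until all are at least `a`; `down` then moves the
  -- largest index down until all lie below `a + n`. The natural number `s` bounds the remaining
  -- distance.
  have up : ∀ s : ℕ, ∀ c : Fin (K + 1) → ℤ, CycMono n c → a ≤ c 0 + s →
      ∃ c' : Fin (K + 1) → ℤ, CycMono n c' ∧ a ≤ c' 0 ∧ seqMinor x c' = seqMinor x c ∧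
        ∀ p, ∃ q t, c' p = c q + n * t := by
    intro s
    induction s with
    | zero => intro c hc ha; exact ⟨c, hc, by simpa using ha, rfl, fun p => ⟨p, 0, by simp⟩⟩
    | succ s ih =>
      intro c hc ha
      obtain ⟨c', h1, h2, h3, h4⟩ := ih _ (hc.snoc_add hn) (by
        have : c 0 < (Fin.snoc (fun i : Fin K => c i.succ) (c 0 + n) : Fin (K + 1) → ℤ) 0 := by
          induction hz : (0 : Fin (K + 1)) using Fin.lastCases with
          | last => rw [Fin.snoc_last]; omega
          | cast z => rw [Fin.snoc_castSucc]; exact hc.1 Fin.castSucc_lt_succ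
        push_cast at ha
        omega)
      refine ⟨c', h1, h2, ?_, ?_⟩
      · rw [h3, ← seqMinor_cons_sub h]
        congr 1
        funext p
        refine Fin.cases ?_ (fun i => ?_) p <;> simp
      · intro p
        obtain ⟨q, t, hq⟩ := h4 p
        induction q using Fin.lastCases with
        | last => exact ⟨0, t + 1, by rw [hq, Fin.snoc_last]; ring⟩
        | cast q => exact ⟨q.succ, t, by rw [hq, Fin.snoc_castSucc]⟩
  have down : ∀ s : ℕ, ∀ c : Fin (K + 1) → ℤ, CycMono n c → a ≤ c 0 →
      c (Fin.last K) < a + n + s →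
      ∃ c' : Fin (K + 1) → ℤ, CycMono n c' ∧ a ≤ c' 0 ∧ c' (Fin.last K) < a + n ∧
        seqMinor x c' = seqMinor x c ∧ ∀ p, ∃ q t, c' p = c q + n * t := by
    intro s
    induction s with
    | zero => intro c hc h0 ha; exact ⟨c, hc, h0, by simpa using ha, rfl, fun p => ⟨p, 0, by simp⟩⟩
    | succ s ih =>
      intro c hc h0 ha
      by_cases hlt : c (Fin.last K) < a + n
      · exact ⟨c, hc, h0, hlt, rfl, fun p => ⟨p, 0, by simp⟩⟩
      obtain ⟨c', h1, h2, h3, h4, h5⟩ := ih _ (hc.cons_sub hn) (by rw [Fin.cons_zero]; omega) (by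
        have : (Fin.cons (c (Fin.last K) - n) (fun i : Fin K => c i.castSucc) :
            Fin (K + 1) → ℤ) (Fin.last K) < c (Fin.last K) := by
          induction hz : Fin.last K using Fin.cases with
          | zero => rw [Fin.cons_zero]; omega
          | succ z => rw [Fin.cons_succ]; exact hc.1 (Fin.castSucc_lt_succ)
        push_cast at ha
        omega)
      refine ⟨c', h1, h2, h3, ?_, ?_⟩
      · rw [h4, seqMinor_cons_sub h]
        congr 1
        funext p
        induction p using Fin.lastCases <;> simp
      · intro p
        obtain ⟨q, t, hq⟩ := h5 p
        refine Fin.cases (motive := fun q => c' p = (Fin.cons (c (Fin.last K) - n)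
          (fun i : Fin K => c i.castSucc) : Fin (K + 1) → ℤ) q + n * t → _) ?_ (fun i => ?_) q hq
        · intro hq; exact ⟨Fin.last K, t - 1, by rw [hq, Fin.cons_zero]; ring⟩
        · intro hq; exact ⟨i.castSucc, t, by rw [hq, Fin.cons_succ]⟩
  obtain ⟨c1, h1, h2, h3, h4⟩ := up (a - c 0).toNat c hc (by omega)
  obtain ⟨c2, g1, g2, g3, g4, g5⟩ := down (c1 (Fin.last K) - a).toNat c1 h1 h2 (by omega)
  refine ⟨c2, g1.1, fun p => ⟨g2.trans (g1.1.monotone (Fin.zero_le p)),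
    (g1.1.monotone (Fin.le_last p)).trans_lt g3⟩, g4.trans h3, fun p => ?_⟩
  obtain ⟨q, t, hq⟩ := g5 p
  obtain ⟨q', t', hq'⟩ := h4 q
  exact ⟨q', t' + t, by rw [hq, hq']; ring⟩

theorem exists_linear {n k : ℕ} (hn : 0 < n) {x : ℤ → Fin k → ℝ}
    (h : Quasi n ((-1) ^ (k + 1)) x) {c : Fin k → ℤ} (hc : CycMono n c) :
    ∃ d : Fin k → Fin n, StrictMono d ∧
      seqMinor x c = seqMinor (fun i : Fin n => x ((i : ℕ) + 1)) d := by
  obtain ⟨d, h1, h2, h3, -⟩ := exists_rotate hn h hc 1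
  refine ⟨fun p => ⟨(d p - 1).toNat, by have := h2 p; omega⟩, fun p q hpq => ?_, ?_⟩
  · have := h1 hpq; have := h2 p; have := h2 q
    simp only [Fin.mk_lt_mk]; omega
  · rw [← h3]
    unfold seqMinor
    congr 1
    ext p q
    have := h2 p
    simp only [Matrix.of_apply]
    rw [show (((d p - 1).toNat : ℕ) : ℤ) + 1 = d p by omega]

theorem cycPos_of_linear {n k : ℕ} (hn : 0 < n) {x : ℤ → Fin k → ℝ}
    (h : Quasi n ((-1) ^ (k + 1)) x)
    (hpos : ∀ c c' : Fin k → Fin n, StrictMono c → StrictMono c' →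
      0 < seqMinor (fun i : Fin n => x ((i : ℕ) + 1)) c *
        seqMinor (fun i : Fin n => x ((i : ℕ) + 1)) c') : CycPos n x := by
  intro c c' hc hc'
  obtain ⟨d, hd, e⟩ := exists_linear hn h hc
  obtain ⟨d', hd', e'⟩ := exists_linear hn h hc'
  rw [e, e']
  exact hpos d d' hd hd'

theorem cycNonneg_of_linear {n k : ℕ} (hn : 0 < n) {x : ℤ → Fin k → ℝ}
    (h : Quasi n ((-1) ^ (k + 1)) x)
    (hpos : ∀ c c' : Fin k → Fin n, StrictMono c → StrictMono c' →
      0 ≤ seqMinor (fun i : Fin n => x ((i : ℕ) + 1)) c *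
        seqMinor (fun i : Fin n => x ((i : ℕ) + 1)) c') : CycNonneg n x := by
  intro c c' hc hc'
  obtain ⟨d, hd, e⟩ := exists_linear hn h hc
  obtain ⟨d', hd', e'⟩ := exists_linear hn h hc'
  rw [e, e']
  exact hpos d d' hd hd'

/-! ### Positroids are cut out by cyclic intervals -/

section Oh

variable {ι : Type*} [LinearOrder ι] {k : ℕ}

theorem card_filter_lt_orderEmbOfFin {K : Finset ι} {N : ℕ} (hK : K.card = N) (p : Fin N) :
    (K.filter (· < K.orderEmbOfFin hK p)).card = p := by
  have : K.filter (· < K.orderEmbOfFin hK p) =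
      (Finset.Iio p).map (K.orderEmbOfFin hK).toEmbedding := by
    ext e
    simp only [Finset.mem_filter, Finset.mem_map, Finset.mem_Iio]
    constructor
    · rintro ⟨he, hlt⟩
      have : e ∈ Set.range (K.orderEmbOfFin hK) := by rw [Finset.range_orderEmbOfFin]; exact he
      obtain ⟨q, rfl⟩ := this
      exact ⟨q, (K.orderEmbOfFin hK).lt_iff_lt.1 hlt, rfl⟩
    · rintro ⟨q, hq, rfl⟩
      exact ⟨Finset.orderEmbOfFin_mem _ _ _, (K.orderEmbOfFin hK).lt_iff_lt.2 hq⟩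
  rw [this, Finset.card_map, Fin.card_Iio]

/-- For vectors with weakly same-signed maximal minors, a dependency supported on `k + 1` vectors of
rank `k` alternates in sign. -/
theorem dependency_sign {x : ι → Fin k → ℝ}
    (hNN : ∀ c c' : Fin k → ι, StrictMono c → StrictMono c' → 0 ≤ seqMinor x c * seqMinor x c')
    {K : Finset ι} (hK : K.card = k + 1) {y : ι → ℝ} (hy : ∑ i ∈ K, y i • x i = 0) {c₀ : ι}
    (hc₀ : c₀ ∈ K) (hind : LinearIndepOn ℝ x (K.erase c₀ : Set ι)) {c c' : ι} (hc : c ∈ K)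
    (hc' : c' ∈ K) :
    0 ≤ y c * y c' * (-1) ^ ((K.filter (· < c)).card + (K.filter (· < c')).card) := by
  set s := K.orderEmbOfFin hK with hs
  have hmem : ∀ e ∈ K, ∃ p, s p = e := fun e he => by
    have : e ∈ Set.range s := by rw [hs, Finset.range_orderEmbOfFin]; exact he
    exact this
  obtain ⟨p₀, rfl⟩ := hmem c₀ hc₀
  obtain ⟨p, rfl⟩ := hmem c hc
  obtain ⟨p', rfl⟩ := hmem c' hc'
  rw [card_filter_lt_orderEmbOfFin, card_filter_lt_orderEmbOfFin]
  set t : Fin (k + 1) → ℝ := fun p => (-1) ^ (p : ℕ) * seqMinor x (s ∘ p.succAbove) with ht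
  have hcr : ∑ p, t p • x (s p) = 0 := cramer_dependency x s
  have hli : LinearIndependent ℝ (fun q : Fin k => x (s (p₀.succAbove q))) := by
    have hin : ∀ q, s (p₀.succAbove q) ∈ (K.erase (s p₀) : Set ι) := fun q => by
      simp only [Finset.coe_erase, Set.mem_sdiff, Finset.mem_coe, Set.mem_singleton_iff]
      exact ⟨Finset.orderEmbOfFin_mem _ _ _, fun h => Fin.succAbove_ne _ _ (s.injective h)⟩
    exact LinearIndependent.comp hind (fun q => ⟨s (p₀.succAbove q), hin q⟩) fun a b h => by
      simpa using h
  have hm0 : seqMinor x (s ∘ p₀.succAbove) ≠ 0 := (seqMinor_ne_zero_iff _ _).2 hli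
  have ht0 : t p₀ ≠ 0 := mul_ne_zero (pow_ne_zero _ (by norm_num)) hm0
  have hy' : ∑ p, y (s p) • x (s p) = 0 := by
    rw [← hy]
    have : K = Finset.univ.map s.toEmbedding := by
      rw [hs]; exact (Finset.map_orderEmbOfFin_univ K hK).symm
    conv_rhs => rw [this]
    rw [Finset.sum_map]
    rfl
  -- This combination of the given dependency with Cramer's has no term at `p₀`, and the other `k`
  -- vectors are independent. So the two dependencies are proportional, and the signs of `y` are
  -- those of alternating minors.
  have hzero : ∑ p, (y (s p) * t p₀ - y (s p₀) * t p) • x (s p) = 0 := by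
    have e : ∀ p, (y (s p) * t p₀ - y (s p₀) * t p) • x (s p) =
        t p₀ • (y (s p) • x (s p)) - y (s p₀) • (t p • x (s p)) := fun p => by
      rw [sub_smul, smul_smul, smul_smul, mul_comm (t p₀)]
    rw [Finset.sum_congr rfl fun p _ => e p, Finset.sum_sub_distrib, ← Finset.smul_sum,
      ← Finset.smul_sum, hy', hcr]
    simp
  rw [Fin.sum_univ_succAbove _ p₀] at hzero
  rw [sub_self, zero_smul, zero_add] at hzero
  have hall : ∀ p, y (s p) * t p₀ = y (s p₀) * t p := by
    intro p
    rcases eq_or_ne p p₀ with rfl | hne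
    · rfl
    · obtain ⟨q, rfl⟩ := Fin.exists_succAbove_eq hne
      exact sub_eq_zero.1 (Fintype.linearIndependent_iff.1 hli _ hzero q)
  have hmm := hNN (s ∘ p.succAbove) (s ∘ p'.succAbove)
    (s.strictMono.comp (Fin.strictMono_succAbove _))
    (s.strictMono.comp (Fin.strictMono_succAbove _))
  have hkey : y (s p) * y (s p') * (-1) ^ ((p : ℕ) + p') * (t p₀) ^ 2 =
      (y (s p₀)) ^ 2 * (seqMinor x (s ∘ p.succAbove) * seqMinor x (s ∘ p'.succAbove)) := by
    have h1 := hall p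
    have h2 := hall p'
    have e1 := neg_one_pow_mul_self (p : ℕ)
    have e2 := neg_one_pow_mul_self (p' : ℕ)
    calc y (s p) * y (s p') * (-1) ^ ((p : ℕ) + p') * (t p₀) ^ 2
        = (y (s p) * t p₀) * (y (s p') * t p₀) * ((-1) ^ (p : ℕ) * (-1) ^ (p' : ℕ)) := by
          rw [pow_add]; ring
      _ = _ := by
          rw [h1, h2, ht]
          linear_combination (y (s p₀)) ^ 2 * (seqMinor x (s ∘ p.succAbove) *
            seqMinor x (s ∘ p'.succAbove)) * (((-1) ^ (p' : ℕ) * (-1) ^ (p' : ℕ)) * e1 + e2)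
  have h2 : 0 ≤ y (s p) * y (s p') * (-1) ^ ((p : ℕ) + p') * (t p₀) ^ 2 := by
    rw [hkey]; positivity
  exact nonneg_of_mul_nonneg_left h2 (by positivity)

theorem neg_one_pow_eq_of_mul_nonneg {a : ℝ} (ha : a ≠ 0) {u v : ℕ} (hu : 0 ≤ a * (-1) ^ u)
    (hv : 0 ≤ a * (-1) ^ v) : Even u ↔ Even v := by
  rcases Nat.even_or_odd u with h1 | h1 <;> rcases Nat.even_or_odd v with h2 | h2
  · simp [h1, h2]
  · rw [h1.neg_one_pow] at hu; rw [h2.neg_one_pow] at hv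
    exact absurd (le_antisymm (by linarith) (by linarith)) ha
  · rw [h1.neg_one_pow] at hu; rw [h2.neg_one_pow] at hv
    exact absurd (le_antisymm (by linarith) (by linarith)) ha
  · simp [Nat.not_even_iff_odd.2 h1, Nat.not_even_iff_odd.2 h2]

/-- A basis exchange that keeps a circuit `C` moves within one arc of the complement of `C`. -/
theorem exchange_same_arc {x : ι → Fin k → ℝ}
    (hNN : ∀ c c' : Fin k → ι, StrictMono c → StrictMono c' → 0 ≤ seqMinor x c * seqMinor x c')
    {K C : Finset ι} (hK : K.card = k + 1) (hCK : C ⊆ K) {y : ι → ℝ} (hy : ∑ i ∈ C, y i • x i = 0)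
    (hyC : ∀ i ∈ C, y i ≠ 0) {c₀ p q : ι} (hc₀ : c₀ ∈ C)
    (hind : LinearIndepOn ℝ x (K.erase c₀ : Set ι)) (hp : p ∈ K) (hpC : p ∉ C) (hq : q ∉ K)
    (hind' : LinearIndepOn ℝ x ((insert q (K.erase p)).erase c₀ : Set ι)) {c c' : ι} (hc : c ∈ C)
    (hc' : c' ∈ C) : ((p < c) ↔ (q < c)) ↔ ((p < c') ↔ (q < c')) := by
  set z : ι → ℝ := fun i => if i ∈ C then y i else 0 with hz
  have hzy : ∀ i ∈ C, z i = y i := fun i hi => by simp [hz, hi]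
  have hsum : ∀ L : Finset ι, C ⊆ L → ∑ i ∈ L, z i • x i = 0 := by
    intro L hL
    rw [← hy, ← Finset.sum_subset hL (fun i _ hi => by simp [hz, hi])]
    exact Finset.sum_congr rfl fun i hi => by rw [hzy i hi]
  have hqK : q ∉ K.erase p := fun h => hq (Finset.mem_of_mem_erase h)
  have hC' : C ⊆ insert q (K.erase p) := fun i hi =>
    Finset.mem_insert_of_mem (Finset.mem_erase.2 ⟨fun h => hpC (h ▸ hi), hCK hi⟩)
  have hcard : (insert q (K.erase p)).card = k + 1 := by
    rw [Finset.card_insert_of_notMem hqK, Finset.card_erase_of_mem hp, hK]; rfl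
  have s1 := dependency_sign hNN hK (hsum K hCK) (hCK hc₀) hind (hCK hc) (hCK hc')
  have s2 := dependency_sign hNN hcard (hsum _ hC') (hC' hc₀) hind' (hC' hc) (hC' hc')
  rw [hzy c hc, hzy c' hc'] at s1 s2
  have hpar := neg_one_pow_eq_of_mul_nonneg (mul_ne_zero (hyC c hc) (hyC c' hc')) s1 s2
  -- The same dependency on `C` alternates with respect to positions in `K` and in `K` with `p`
  -- exchanged for `q`. Hence the exchange changes the positions of `c` and `c'` by amounts of equal
  -- parity.
  have hpos : ∀ d : ι, ((insert q (K.erase p)).filter (· < d)).card + (if p < d then 1 else 0) =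
      (K.filter (· < d)).card + (if q < d then 1 else 0) := by
    intro d
    rw [Finset.filter_insert, Finset.filter_erase]
    have e1 : ((K.filter (· < d)).erase p).card + (if p < d then 1 else 0) =
        (K.filter (· < d)).card := by
      split_ifs with h
      · exact Finset.card_erase_add_one (Finset.mem_filter.2 ⟨hp, h⟩)
      · rw [Finset.erase_eq_of_notMem (a := p) (fun h' => h (Finset.mem_filter.1 h').2), add_zero]
    have hn : q ∉ (K.filter (· < d)).erase p := fun h' =>
      hq (Finset.mem_filter.1 (Finset.mem_of_mem_erase h')).1
    by_cases h2 : q < d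
    · rw [if_pos h2, if_pos h2, Finset.card_insert_of_notMem hn]; omega
    · rw [if_neg h2, if_neg h2]; omega
  have h1 := hpos c
  have h2 := hpos c'
  by_cases a1 : p < c <;> by_cases a2 : q < c <;> by_cases a3 : p < c' <;> by_cases a4 : q < c' <;>
    simp only [a1, a2, a3, a4, if_true, if_false, iff_true, iff_false, not_true] at h1 h2 ⊢ <;>
    (rw [Nat.even_iff, Nat.even_iff] at hpar; omega)

/-- The arc of the complement of `C` (in the cyclic order) in which a label lies. -/
def arcLabel (C : Finset ι) (e : ι) : ℕ :=
  -- Labels above all of `C` and labels below all of `C` belong to the same cyclic arc.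
  if (C.filter (· < e)).card = C.card then 0 else (C.filter (· < e)).card

/-- Either `p` and `q` lie on the same side of every element of `C`, or every element of `C`
separates them. In the second case one is below all of `C` and the other above, so both lie in the
arc that wraps around. -/
theorem arcLabel_eq_of_exchange {C : Finset ι} {p q : ι} (hp : p ∉ C) (hq : q ∉ C)
    (h : ∀ c ∈ C, ∀ c' ∈ C, ((p < c) ↔ (q < c)) ↔ ((p < c') ↔ (q < c'))) :
    arcLabel C p = arcLabel C q := by
  have aux : ∀ p q : ι, q ∉ C → p < q → (∀ c ∈ C, ¬ ((p < c) ↔ (q < c))) → arcLabel C p = arcLabel C q := by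
    intro p q hq hpq h
    have h1 : C.filter (· < p) = ∅ := Finset.filter_eq_empty_iff.2 fun c hc hcp => by
      have := h c hc
      simp [hcp.not_gt, (hcp.trans hpq).not_gt] at this
    have h2 : C.filter (· < q) = C := Finset.filter_eq_self.2 fun c hc => by
      by_contra hcq
      have := h c hc
      have h3 : q < c := lt_of_le_of_ne (not_lt.1 hcq) fun h => hq (h ▸ hc)
      simp [h3, hpq.trans h3] at this
    simp [arcLabel, h1, h2]
  rcases C.eq_empty_or_nonempty with rfl | ⟨c₁, hc₁⟩
  · simp [arcLabel]
  by_cases h1 : (p < c₁) ↔ (q < c₁)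
  · have h2 : C.filter (· < p) = C.filter (· < q) := by
      refine Finset.filter_congr fun c hc => ?_
      have h3 := (h c₁ hc₁ c hc).1 h1
      have hcp : c ≠ p := fun e => hp (e ▸ hc)
      have hcq : c ≠ q := fun e => hq (e ▸ hc)
      constructor
      · intro h4; exact lt_of_le_of_ne (not_lt.1 fun h5 => h4.not_gt (h3.2 h5)) hcq
      · intro h4; exact lt_of_le_of_ne (not_lt.1 fun h5 => h4.not_gt (h3.1 h5)) hcp
    simp [arcLabel, h2]
  · have h2 : ∀ c ∈ C, ¬ ((p < c) ↔ (q < c)) := fun c hc h3 => h1 ((h c hc c₁ hc₁).1 h3)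
    rcases lt_trichotomy p q with hlt | rfl | hlt
    · exact aux p q hq hlt h2
    · rfl
    · exact (aux q p hp hlt fun c hc h3 => h2 c hc h3.symm).symm

/-- The complement of an arc is a cyclic interval. -/
theorem compl_arc_isCyclicInterval {C : Finset ι} (hC : C.Nonempty) {e₀ : ι}
    (he₀ : e₀ ∉ C) {S : Finset ι} (hS : ∀ e, e ∈ S ↔ ¬ (e ∉ C ∧ arcLabel C e = arcLabel C e₀)) :
    (∃ a b, a ≤ b ∧ ∀ e, e ∈ S ↔ (a ≤ e ∧ e ≤ b)) ∨
      (∃ a b, a < b ∧ ∀ e, e ∈ S ↔ (e ≤ a ∨ b ≤ e)) := by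
  by_cases h1 : ∃ c ∈ C, c < e₀
  · by_cases h2 : ∃ c ∈ C, e₀ < c
    · right
      have hL : (C.filter (· < e₀)).Nonempty := by
        obtain ⟨c, hc, h⟩ := h1; exact ⟨c, Finset.mem_filter.2 ⟨hc, h⟩⟩
      have hR : (C.filter (e₀ < ·)).Nonempty := by
        obtain ⟨c, hc, h⟩ := h2; exact ⟨c, Finset.mem_filter.2 ⟨hc, h⟩⟩
      have ha := Finset.mem_filter.1 (Finset.max'_mem _ hL)
      have hb := Finset.mem_filter.1 (Finset.min'_mem _ hR)
      set a := (C.filter (· < e₀)).max' hL with hadef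
      set b := (C.filter (e₀ < ·)).min' hR with hbdef
      have hamax : ∀ c ∈ C, c < e₀ → c ≤ a := fun c hc h =>
        Finset.le_max' _ _ (Finset.mem_filter.2 ⟨hc, h⟩)
      have hbmin : ∀ c ∈ C, e₀ < c → b ≤ c := fun c hc h =>
        Finset.min'_le _ _ (Finset.mem_filter.2 ⟨hc, h⟩)
      have hdich : ∀ c ∈ C, c ≤ a ∨ b ≤ c := fun c hc => by
        rcases lt_trichotomy c e₀ with h | rfl | h
        · exact Or.inl (hamax c hc h)
        · exact absurd hc he₀
        · exact Or.inr (hbmin c hc h)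
      have hlt1 : (C.filter (· < e₀)).card < C.card :=
        Finset.card_lt_card (Finset.filter_ssubset.2 ⟨b, hb.1, hb.2.not_gt⟩)
      have hpos1 : 0 < (C.filter (· < e₀)).card := hL.card_pos
      have hlab : arcLabel C e₀ = (C.filter (· < e₀)).card := if_neg hlt1.ne
      refine ⟨a, b, ha.2.trans hb.2, fun e => ?_⟩
      rw [hS, hlab]
      constructor
      · intro h
        by_contra hcon
        push Not at hcon
        refine h ⟨fun he => ?_, ?_⟩
        · rcases hdich e he with h3 | h3
          · exact h3.not_gt hcon.1
          · exact h3.not_gt hcon.2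
        · have : C.filter (· < e) = C.filter (· < e₀) := Finset.filter_congr fun c hc => by
            rcases hdich c hc with h3 | h3
            · simp [h3.trans_lt hcon.1, h3.trans_lt ha.2]
            · simp [(hcon.2.trans_le h3).not_gt, (hb.2.trans_le h3).not_gt]
          rw [arcLabel, this, if_neg hlt1.ne]
      · rintro h ⟨heC, hel⟩
        have hel' : (C.filter (· < e)).card = (C.filter (· < e₀)).card := by
          unfold arcLabel at hel
          split_ifs at hel with h3
          · omega
          · exact hel
        rcases h with h | h
        · have hea : e < a := lt_of_le_of_ne h fun h3 => heC (h3 ▸ ha.1)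
          have : C.filter (· < e) ⊂ C.filter (· < e₀) := by
            refine Finset.ssubset_iff_of_subset (fun c hc => ?_) |>.2 ⟨a, Finset.mem_filter.2 ha,
              fun h3 => (Finset.mem_filter.1 h3).2.not_gt hea⟩
            rw [Finset.mem_filter] at hc ⊢
            exact ⟨hc.1, hc.2.trans (hea.trans ha.2)⟩
          exact (Finset.card_lt_card this).ne hel'
        · have hbe : b < e := lt_of_le_of_ne h fun h3 => heC (h3 ▸ hb.1)
          have : C.filter (· < e₀) ⊂ C.filter (· < e) := by
            refine Finset.ssubset_iff_of_subset (fun c hc => ?_) |>.2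
              ⟨b, Finset.mem_filter.2 ⟨hb.1, hbe⟩, fun h3 =>
              (Finset.mem_filter.1 h3).2.not_gt hb.2⟩
            rw [Finset.mem_filter] at hc ⊢
            exact ⟨hc.1, hc.2.trans (hb.2.trans hbe)⟩
          exact (Finset.card_lt_card this).ne hel'.symm
    · left
      have h0 : arcLabel C e₀ = 0 := by
        refine if_pos (congrArg _ (Finset.filter_eq_self.2 fun c hc => ?_))
        exact lt_of_le_of_ne (not_lt.1 fun h => h2 ⟨c, hc, h⟩) fun h => he₀ (h ▸ hc)
      exact outer hC hS h0
  · left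
    have h0 : arcLabel C e₀ = 0 := by
      have : C.filter (· < e₀) = ∅ := Finset.filter_eq_empty_iff.2 fun c hc h => h1 ⟨c, hc, h⟩
      simp [arcLabel, this]
    exact outer hC hS h0
where
  outer {C : Finset ι} (hC : C.Nonempty) {e₀ : ι} {S : Finset ι}
      (hS : ∀ e, e ∈ S ↔ ¬ (e ∉ C ∧ arcLabel C e = arcLabel C e₀)) (h0 : arcLabel C e₀ = 0) :
      ∃ a b, a ≤ b ∧ ∀ e, e ∈ S ↔ (a ≤ e ∧ e ≤ b) := by
    refine ⟨C.min' hC, C.max' hC, Finset.min'_le_max' _ _, fun e => ?_⟩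
    rw [hS, h0]
    constructor
    · intro h
      by_contra hcon
      refine h ⟨fun he => hcon ⟨Finset.min'_le _ _ he, Finset.le_max' _ _ he⟩, ?_⟩
      rw [not_and_or, not_le, not_le] at hcon
      rcases hcon with h1 | h1
      · have : C.filter (· < e) = ∅ := Finset.filter_eq_empty_iff.2 fun c hc h =>
          ((Finset.min'_le _ _ hc).trans_lt h).not_gt h1
        simp [arcLabel, this]
      · exact if_pos (congrArg _ (Finset.filter_eq_self.2 fun c hc =>
          (Finset.le_max' _ _ hc).trans_lt h1))
    · rintro ⟨h1, h2⟩ ⟨heC, hel⟩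
      have h1' : C.min' hC < e := lt_of_le_of_ne h1 fun h => heC (h ▸ Finset.min'_mem _ _)
      have h2' : e < C.max' hC := lt_of_le_of_ne h2 fun h => heC (h ▸ Finset.max'_mem _ _)
      have hlt : (C.filter (· < e)).card < C.card := Finset.card_lt_card
        (Finset.filter_ssubset.2 ⟨_, Finset.max'_mem _ hC, h2'.not_gt⟩)
      have hpos : 0 < (C.filter (· < e)).card :=
        Finset.card_pos.2 ⟨_, Finset.mem_filter.2 ⟨Finset.min'_mem _ hC, h1'⟩⟩
      rw [arcLabel, if_neg hlt.ne] at hel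
      omega

theorem exists_circuit {x : ι → Fin k → ℝ} {J : Finset ι}
    (hdep : ¬ LinearIndepOn ℝ x (J : Set ι)) :
    ∃ C ⊆ J, ∃ y : ι → ℝ, C.Nonempty ∧ (∑ i ∈ C, y i • x i = 0) ∧ (∀ i ∈ C, y i ≠ 0) ∧
      ∀ c ∈ C, LinearIndepOn ℝ x (C.erase c : Set ι) := by
  classical
  have hne : (J.powerset.filter fun C : Finset ι => ¬ LinearIndepOn ℝ x (C : Set ι)).Nonempty :=
    ⟨J, by simp [hdep]⟩
  obtain ⟨C, hC, hmin⟩ := Finset.exists_min_image _ Finset.card hne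
  simp only [Finset.mem_filter, Finset.mem_powerset] at hC hmin
  have herase : ∀ c ∈ C, LinearIndepOn ℝ x (C.erase c : Set ι) := by
    intro c hc
    by_contra h
    have := hmin (C.erase c) ⟨(Finset.erase_subset _ _).trans hC.1, h⟩
    exact (Finset.card_erase_lt_of_mem hc).not_ge this
  have h1 := hC.2
  rw [linearIndepOn_finset_iff] at h1
  push Not at h1
  obtain ⟨y, hy, c, hc, hyc⟩ := h1
  refine ⟨C, hC.1, y, ⟨c, hc⟩, hy, fun i hi h0 => ?_, herase⟩
  have h2 := herase i hi
  rw [linearIndepOn_finset_iff] at h2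
  refine hyc (h2 y ?_ c (Finset.mem_erase.2 ⟨fun h => hyc (h ▸ h0), hc⟩))
  rw [← Finset.add_sum_erase C _ hi, h0, zero_smul, zero_add] at hy
  exact hy

/-- **Oh's theorem**: a set of labels violating no cyclic interval rank condition is a basis. -/
theorem exists_cyclicInterval_of_dependent [Fintype ι] {x : ι → Fin k → ℝ}
    (hNN : ∀ c c' : Fin k → ι, StrictMono c → StrictMono c' → 0 ≤ seqMinor x c * seqMinor x c')
    (hspan : Submodule.span ℝ (Set.range x) = ⊤) {J : Finset ι} (hJ : J.card = k)
    (hdep : ¬ LinearIndepOn ℝ x (J : Set ι)) :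
    ∃ S : Finset ι, ((∃ a b, a ≤ b ∧ ∀ e, e ∈ S ↔ (a ≤ e ∧ e ≤ b)) ∨
        (∃ a b, a < b ∧ ∀ e, e ∈ S ↔ (e ≤ a ∨ b ≤ e))) ∧
      Module.finrank ℝ (Submodule.span ℝ (x '' (S : Set ι))) < (J ∩ S).card := by
  classical
  obtain ⟨C, hCJ, y, hCne, hy, hyC, herase⟩ := exists_circuit hdep
  obtain ⟨c₀, hc₀⟩ := hCne
  have hCdep : ¬ LinearIndepOn ℝ x (C : Set ι) := fun h =>
    hyC c₀ hc₀ ((linearIndepOn_finset_iff.1 h) y hy c₀ hc₀)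
  -- A circuit `C` inside `J`, less one element `c₀`, is completed to a basis `B`. Then `K = B ∪
  -- {c₀}` has one element more than `J`, and both contain `C`.
  obtain ⟨b, -, hb1, hb2, hb3⟩ :=
    exists_linearIndepOn_extension (herase c₀ hc₀) (Set.subset_univ _)
  obtain ⟨B, rfl⟩ := b.toFinite.exists_finset_coe
  have hBspan : Submodule.span ℝ (x '' (B : Set ι)) = ⊤ := by
    rw [eq_top_iff, ← hspan, Submodule.span_le, ← Set.image_univ]
    exact hb2
  have hBcard : B.card = k := by
    have h1 := finrank_span_eq_card (R := ℝ) (b := fun i : B => x i) hb3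
    have h2 : Set.range (fun i : B => x i) = x '' (B : Set ι) := by
      rw [Set.image_eq_range]; rfl
    rw [h2, hBspan, finrank_top, Module.finrank_fin_fun, Fintype.card_coe] at h1
    exact h1.symm
  have hc₀B : c₀ ∉ B := by
    intro h
    refine hCdep (hb3.mono ?_)
    intro i hi
    by_cases hi0 : i = c₀
    · exact hi0 ▸ h
    · exact hb1 (by simpa using ⟨hi, hi0⟩)
  set K := insert c₀ B with hKdef
  have hKcard : K.card = k + 1 := by rw [hKdef, Finset.card_insert_of_notMem hc₀B, hBcard]
  have hCK : C ⊆ K := by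
    intro i hi
    by_cases hi0 : i = c₀
    · exact hi0 ▸ Finset.mem_insert_self _ _
    · exact Finset.mem_insert_of_mem (hb1 (by simpa using ⟨hi, hi0⟩))
  have hKe : K.erase c₀ = B := Finset.erase_insert hc₀B
  have hlt : (J \ C).card < (K \ C).card := by
    have h1 := Finset.card_sdiff_add_card_eq_card hCJ
    have h2 := Finset.card_sdiff_add_card_eq_card hCK
    omega
  -- By pigeonhole some arc of the complement of `C` meets `K` in more elements than `J`. The
  -- violated interval `S` is the complement of that arc; it suffices that `B ∩ S` spans `S`, since
  -- `|B ∩ S| + 1 = |K ∩ S| ≤ |J ∩ S|`.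
  obtain ⟨lab, hlab⟩ : ∃ lab, ((J \ C).filter (arcLabel C · = lab)).card <
      ((K \ C).filter (arcLabel C · = lab)).card := by
    by_contra hcon
    push Not at hcon
    have hmaps : ∀ L : Finset ι, ∀ e ∈ L, arcLabel C e ∈ Finset.range (C.card + 1) := by
      intro L e _
      have := Finset.card_filter_le C (· < e)
      rw [Finset.mem_range, arcLabel]
      split_ifs <;> omega
    rw [Finset.card_eq_sum_card_fiberwise (hmaps (J \ C)),
      Finset.card_eq_sum_card_fiberwise (hmaps (K \ C))] at hlt
    exact hlt.not_ge (Finset.sum_le_sum fun i _ => hcon i)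
  obtain ⟨e₀, he₀⟩ := Finset.card_pos.1 ((Nat.zero_le _).trans_lt hlab)
  simp only [Finset.mem_filter, Finset.mem_sdiff] at he₀
  obtain ⟨⟨he₀K, he₀C⟩, rfl⟩ := he₀
  set S : Finset ι := Finset.univ.filter fun e => ¬ (e ∉ C ∧ arcLabel C e = arcLabel C e₀)
    with hSdef
  have hS : ∀ e, e ∈ S ↔ ¬ (e ∉ C ∧ arcLabel C e = arcLabel C e₀) := by simp [hSdef]
  refine ⟨S, compl_arc_isCyclicInterval ⟨c₀, hc₀⟩ he₀C hS, ?_⟩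
  have hCS : C ⊆ S := fun c hc => (hS c).2 fun h => h.1 hc
  have hsplit : ∀ L : Finset ι, (L ∩ S).card +
      ((L \ C).filter (arcLabel C · = arcLabel C e₀)).card = L.card := by
    intro L
    rw [← Finset.card_inter_add_card_sdiff L S]
    congr 2
    ext e
    simp only [Finset.mem_filter, Finset.mem_sdiff, hS]
    tauto
  have hJS := hsplit J
  have hKS := hsplit K
  have hBS : (B ∩ S).card + 1 = (K ∩ S).card := by
    rw [hKdef, Finset.insert_inter_of_mem (hCS hc₀), Finset.card_insert_of_notMem]
    exact fun h => hc₀B (Finset.mem_inter.1 h).1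
  have hspanS : Submodule.span ℝ (x '' (S : Set ι)) ≤
      Submodule.span ℝ (x '' ((B ∩ S : Finset ι) : Set ι)) := by
    rw [Submodule.span_le]
    have hBmem : ∀ e ∈ B ∩ S, x e ∈ Submodule.span ℝ (x '' ((B ∩ S : Finset ι) : Set ι)) :=
      fun e he => Submodule.subset_span ⟨e, he, rfl⟩
    rintro _ ⟨q, hq, rfl⟩
    by_cases hqK : q ∈ K
    · rcases Finset.mem_insert.1 hqK with rfl | hqB
      · have h1 : y q • x q = - ∑ i ∈ C.erase q, y i • x i := by
          rw [← Finset.add_sum_erase C _ hc₀] at hy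
          exact eq_neg_of_add_eq_zero_left hy
        have h2 : y q • x q ∈ Submodule.span ℝ (x '' ((B ∩ S : Finset ι) : Set ι)) := by
          rw [h1]
          refine Submodule.neg_mem _ (Submodule.sum_mem _ fun i hi => Submodule.smul_mem _ _ ?_)
          exact hBmem i (Finset.mem_inter.2 ⟨hb1 hi, hCS (Finset.mem_of_mem_erase hi)⟩)
        have h3 := Submodule.smul_mem _ (y q)⁻¹ h2
        rwa [smul_smul, inv_mul_cancel₀ (hyC q hc₀), one_smul] at h3
      · exact hBmem q (Finset.mem_inter.2 ⟨hqB, hq⟩)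
    · have hqB : q ∉ B := fun h => hqK (Finset.mem_insert_of_mem h)
      have hqspan : x q ∈ Submodule.span ℝ (x '' (B : Set ι)) := by rw [hBspan]; trivial
      obtain ⟨ν, hν⟩ := (Submodule.mem_span_image_finset_iff_exists_fun ℝ).1 hqspan
      obtain ⟨μ, hμ⟩ : ∃ μ : ι → ℝ, ∑ i ∈ B, μ i • x i = x q := by
        refine ⟨fun i => if h : i ∈ B then ν ⟨i, h⟩ else 0, ?_⟩
        rw [← hν, ← Finset.sum_coe_sort]
        exact Finset.sum_congr rfl fun i _ => by simp
      rw [← hμ]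
      refine Submodule.sum_mem _ fun p hp => ?_
      by_cases hpS : p ∈ S
      · exact Submodule.smul_mem _ _ (hBmem p (Finset.mem_inter.2 ⟨hp, hpS⟩))
      · suffices h0 : μ p = 0 by rw [h0, zero_smul]; exact Submodule.zero_mem _
        by_contra h0
        -- A nonzero coefficient at `p` allows the basis exchange of `p` for `q`. Such an exchange
        -- stays within one arc, which is impossible with `p` outside `S` and `q` inside.
        have hpC : p ∉ C := fun h => hpS (hCS h)
        have hpK : p ∈ K := Finset.mem_insert_of_mem hp
        have hind' : LinearIndepOn ℝ x ((insert q (K.erase p)).erase c₀ : Set ι) := by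
          have e1 : (insert q (K.erase p)).erase c₀ = insert q (B.erase p) := by
            ext e
            have : q ≠ c₀ := fun h => hqK (h ▸ Finset.mem_insert_self _ _)
            simp only [hKdef, Finset.mem_erase, Finset.mem_insert]
            constructor
            · rintro ⟨h1, h2 | ⟨h2, h3 | h3⟩⟩
              · exact Or.inl h2
              · exact absurd h3 h1
              · exact Or.inr ⟨h2, h3⟩
            · rintro (rfl | ⟨h1, h2⟩)
              · exact ⟨this, Or.inl rfl⟩
              · exact ⟨fun h => hc₀B (h ▸ h2), Or.inr ⟨h1, Or.inr h2⟩⟩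
          have e2 : ((insert q (B.erase p) : Finset ι) : Set ι) =
              insert q ((B.erase p : Finset ι) : Set ι) := Finset.coe_insert _ _
          have hBe : LinearIndepOn ℝ x ((B.erase p : Finset ι) : Set ι) :=
            hb3.mono (by exact_mod_cast Finset.erase_subset _ _)
          rw [e1, e2, linearIndepOn_insert (by simp [hqB])]
          refine ⟨hBe, fun hmem => ?_⟩
          have hp' : μ p • x p ∈ Submodule.span ℝ (x '' ((B.erase p : Finset ι) : Set ι)) := by
            have : μ p • x p = x q - ∑ i ∈ B.erase p, μ i • x i := by
              rw [← hμ, ← Finset.add_sum_erase B _ hp]; abel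
            rw [this]
            exact Submodule.sub_mem _ hmem (Submodule.sum_mem _ fun i hi =>
              Submodule.smul_mem _ _ (Submodule.subset_span ⟨i, hi, rfl⟩))
          have hp'' := Submodule.smul_mem _ (μ p)⁻¹ hp'
          rw [smul_smul, inv_mul_cancel₀ h0, one_smul] at hp''
          rw [Finset.coe_erase] at hp''
          exact LinearIndepOn.notMem_span_of_insert (by rwa [Set.insert_sdiff_singleton, Set.insert_eq_of_mem hp]) (by simp) hp''
        have hqC : q ∉ C := fun h => hqK (hCK h)
        have hlabpq := arcLabel_eq_of_exchange hpC hqC fun c hc c' hc' =>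
          exchange_same_arc hNN hKcard hCK hy hyC hc₀ (by rw [hKe]; exact hb3) hpK hpC hqK hind'
            hc hc'
        have hpS' := (hS p).not.1 hpS
        push Not at hpS'
        exact (hS q).1 hq ⟨hqC, by rw [← hlabpq]; exact hpS'.2⟩
  have hfin : Module.finrank ℝ (Submodule.span ℝ (x '' (S : Set ι))) ≤ (B ∩ S).card := by
    refine (Submodule.finrank_mono hspanS).trans ?_
    have := finrank_span_finset_le_card (R := ℝ) ((B ∩ S).image x)
    rw [Finset.coe_image] at this
    exact this.trans Finset.card_image_le
  omega

end Oh

/-! ### Ranks of cyclic intervals -/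

/-- The rank of the vectors `x a, …, x (a + s - 1)`. -/
def intervalRank {E : Type*} [AddCommGroup E] [Module ℝ E] (x : ℤ → E) (a : ℤ) (s : ℕ) : ℕ :=
  Module.finrank ℝ (Submodule.span ℝ (x '' Set.Ico a (a + s)))

/-- The restriction of a sequence to the period `1, …, n`. -/
def onPeriod {E : Type*} (n : ℕ) (x : ℤ → E) (e : Fin n) : E := x ((e : ℕ) + 1)

theorem residue_val {n : ℕ} [NeZero n] (j : ℤ) : ((residue n j : ℕ) : ℤ) = (j - 1) % n := by
  have hn : (n : ℤ) ≠ 0 := by exact_mod_cast NeZero.ne n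
  simp only [residue, Int.natMod]
  exact Int.toNat_of_nonneg (Int.emod_nonneg _ hn)

theorem cyclicPos_residue {n : ℕ} [NeZero n] (a j : ℤ) :
    cyclicPos n a (residue n j) = (j - a) % n := by
  rw [cyclicPos, residue_val]
  rw [show (j - 1) % (n : ℤ) + 1 - a = (j - 1) % n + (1 - a) by ring, Int.emod_add_emod]
  congr 1
  ring

theorem cyclicPos_nonneg {n : ℕ} [NeZero n] (a : ℤ) (e : Fin n) : 0 ≤ cyclicPos n a e :=
  Int.emod_nonneg _ (by exact_mod_cast NeZero.ne n)

theorem cyclicPos_lt {n : ℕ} [NeZero n] (a : ℤ) (e : Fin n) : cyclicPos n a e < n :=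
  Int.emod_lt_of_pos _ (by exact_mod_cast NeZero.pos n)

theorem residue_add_one {n : ℕ} [NeZero n] (e : Fin n) : residue n ((e : ℕ) + 1) = e := by
  apply Fin.ext
  have h := residue_val (n := n) ((e : ℕ) + 1)
  rw [add_sub_cancel_right, Int.emod_eq_of_lt (by omega) (by exact_mod_cast e.2)] at h
  exact_mod_cast h

theorem residue_cyclicPos {n : ℕ} [NeZero n] (a : ℤ) (e : Fin n) :
    residue n (a + cyclicPos n a e) = e := by
  conv_rhs => rw [← residue_add_one e]
  apply Fin.ext
  have h1 := residue_val (n := n) (a + cyclicPos n a e)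
  have h2 := residue_val (n := n) ((e : ℕ) + 1)
  have : (a + cyclicPos n a e - 1) % (n : ℤ) = ((e : ℕ) + 1 - 1 : ℤ) % n := by
    rw [cyclicPos, show a + ((e : ℕ) + 1 - a : ℤ) % n - 1 = ((e : ℕ) + 1 - a : ℤ) % n + (a - 1) by
      ring, Int.emod_add_emod]
    congr 1
    ring
  rw [this, ← h2] at h1
  exact_mod_cast h1

theorem cyclicPos_injective {n : ℕ} [NeZero n] (a : ℤ) :
    Function.Injective (cyclicPos n a) := fun e e' h => by
  rw [← residue_cyclicPos a e, h, residue_cyclicPos]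

theorem residue_eq_iff {n : ℕ} [NeZero n] (i j : ℤ) :
    residue n i = residue n j ↔ ∃ t : ℤ, i = j + n * t := by
  constructor
  · intro h
    have h1 := residue_val (n := n) i
    rw [h, residue_val, ← Int.ModEq, Int.modEq_iff_dvd] at h1
    obtain ⟨t, ht⟩ := h1
    exact ⟨t, by linarith⟩
  · rintro ⟨t, rfl⟩
    apply Fin.ext
    have h1 := residue_val (n := n) (j + n * t)
    have h2 := residue_val (n := n) j
    rw [show j + n * t - 1 = j - 1 + n * t by ring, Int.add_mul_emod_self_left, ← h2] at h1
    exact_mod_cast h1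

theorem exists_sign_onPeriod {n : ℕ} [NeZero n] {e : ℝ} {E : Type*} [AddCommGroup E] [Module ℝ E]
    {x : ℤ → E} (h : Quasi n e x) (he : e * e = 1) (j : ℤ) :
    ∃ s : ℝ, s * s = 1 ∧ x j = s • onPeriod n x (residue n j) := by
  obtain ⟨t, ht⟩ := (residue_eq_iff (n := n) j ((residue n j : ℕ) + 1)).1 (residue_add_one _).symm
  obtain ⟨s, hs, hx⟩ := quasi_mul h he t ((residue n j : ℕ) + 1)
  exact ⟨s, hs, by rw [onPeriod, ← hx, ← ht]⟩

theorem span_image_Ico_le {n : ℕ} [NeZero n] {e : ℝ} {E : Type*} [AddCommGroup E] [Module ℝ E]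
    {x : ℤ → E} (h : Quasi n e x) (he : e * e = 1) (a : ℤ) {s : ℕ} (hs : s ≤ n) :
    Submodule.span ℝ (x '' Set.Ico a (a + s)) ≤
      Submodule.span ℝ (onPeriod n x '' {e | cyclicPos n a e < s}) := by
  rw [Submodule.span_le]
  rintro _ ⟨j, hj, rfl⟩
  obtain ⟨r, -, hr⟩ := exists_sign_onPeriod h he j
  rw [hr]
  refine Submodule.smul_mem _ _ (Submodule.subset_span ⟨_, ?_, rfl⟩)
  simp only [Set.mem_ofPred_eq, Set.mem_Ico] at hj ⊢
  rw [cyclicPos_residue, Int.emod_eq_of_lt (by omega) (by omega)]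
  omega

theorem span_onPeriod_le {n : ℕ} [NeZero n] {e : ℝ} {E : Type*} [AddCommGroup E] [Module ℝ E]
    {x : ℤ → E} (h : Quasi n e x) (he : e * e = 1) (a : ℤ) (s : ℕ) :
    Submodule.span ℝ (onPeriod n x '' {e | cyclicPos n a e < s}) ≤
      Submodule.span ℝ (x '' Set.Ico a (a + s)) := by
  rw [Submodule.span_le]
  rintro _ ⟨i, hi, rfl⟩
  obtain ⟨r, hrr, hr⟩ := exists_sign_onPeriod h he (a + cyclicPos n a i)
  rw [residue_cyclicPos] at hr
  have : onPeriod n x i = r • x (a + cyclicPos n a i) := by rw [hr, smul_smul, hrr, one_smul]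
  rw [this]
  refine Submodule.smul_mem _ _ (Submodule.subset_span ⟨_, ?_, rfl⟩)
  have := cyclicPos_nonneg a i
  simp only [Set.mem_ofPred_eq, Set.mem_Ico] at hi ⊢
  omega

theorem intervalRank_eq {n : ℕ} [NeZero n] {e : ℝ} {E : Type*} [AddCommGroup E] [Module ℝ E]
    {x : ℤ → E} (h : Quasi n e x) (he : e * e = 1) (a : ℤ) {s : ℕ} (hs : s ≤ n) :
    intervalRank x a s =
      Module.finrank ℝ (Submodule.span ℝ (onPeriod n x '' {e | cyclicPos n a e < s})) := by
  rw [intervalRank, le_antisymm (span_image_Ico_le h he a hs) (span_onPeriod_le h he a s)]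

theorem cycNonneg_linear {n k : ℕ} {x : ℤ → Fin k → ℝ} (h : CycNonneg n x)
    (c c' : Fin k → Fin n) (hc : StrictMono c) (hc' : StrictMono c') :
    0 ≤ seqMinor (onPeriod n x) c * seqMinor (onPeriod n x) c' := by
  have key : ∀ c : Fin k → Fin n, StrictMono c →
      CycMono n (fun p => ((c p : ℕ) : ℤ) + 1) := fun c hc =>
    cycMono_of_mem (fun p q hpq => by
      have : ((c p : ℕ)) < c q := hc hpq
      simpa using this) 1 fun p => ⟨by omega, by have := (c p).2; omega⟩
  exact h _ _ (key c hc) (key c' hc')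

/-- Oh's theorem for quasi-periodic sequences. -/
theorem exists_intervalRank_lt {n k : ℕ} [NeZero n] {e : ℝ} {x : ℤ → Fin k → ℝ}
    (h : Quasi n e x) (he : e * e = 1) (hNN : CycNonneg n x)
    (hspan : Submodule.span ℝ (Set.range x) = ⊤) {J : Finset (Fin n)} (hJ : J.card = k)
    (hdep : ¬ LinearIndepOn ℝ (onPeriod n x) (J : Set (Fin n))) :
    ∃ (a : ℤ) (s : ℕ), s ≤ n ∧ intervalRank x a s < (J.filter (cyclicPos n a · < s)).card := by
  have hspan' : Submodule.span ℝ (Set.range (onPeriod n x)) = ⊤ := by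
    rw [eq_top_iff, ← hspan, Submodule.span_le]
    rintro _ ⟨j, rfl⟩
    obtain ⟨r, -, hr⟩ := exists_sign_onPeriod h he j
    rw [hr]
    exact Submodule.smul_mem _ _ (Submodule.subset_span ⟨_, rfl⟩)
  obtain ⟨S, hS, hlt⟩ :=
    exists_cyclicInterval_of_dependent (cycNonneg_linear hNN) hspan' hJ hdep
  have hmain : ∃ (a : ℤ) (s : ℕ), s ≤ n ∧ ∀ e, e ∈ S ↔ cyclicPos n a e < s := by
    rcases hS with ⟨α, β, hαβ, hS⟩ | ⟨α, β, hαβ, hS⟩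
    · have hαβ' : (α : ℕ) ≤ β := hαβ
      -- The start is `α + 1` because an element `e` of `Fin n` stands for the label `e + 1`.
      refine ⟨α + 1, β - α + 1, by omega, fun e => ?_⟩
      rw [hS, cyclicPos]
      by_cases hle : (α : ℕ) ≤ e
      · rw [Int.emod_eq_of_lt (by omega) (by omega)]
        rw [Fin.le_def, Fin.le_def]
        omega
      · rw [show ((e : ℕ) : ℤ) + 1 - (α + 1) = (e - α + n) + n * (-1) by ring,
          Int.add_mul_emod_self_left, Int.emod_eq_of_lt (by omega) (by omega)]
        rw [Fin.le_def, Fin.le_def]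
        omega
    · have hαβ' : (α : ℕ) < β := hαβ
      refine ⟨β + 1, n - β + α + 1, by omega, fun e => ?_⟩
      rw [hS, cyclicPos]
      by_cases hle : (β : ℕ) ≤ e
      · rw [Int.emod_eq_of_lt (by omega) (by omega)]
        rw [Fin.le_def, Fin.le_def]
        omega
      · rw [show ((e : ℕ) : ℤ) + 1 - (β + 1) = (e - β + n) + n * (-1) by ring,
          Int.add_mul_emod_self_left, Int.emod_eq_of_lt (by omega) (by omega)]
        rw [Fin.le_def, Fin.le_def]
        omega
  obtain ⟨a, s, hs, hSs⟩ := hmain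
  refine ⟨a, s, hs, ?_⟩
  rw [intervalRank_eq h he a hs]
  have e1 : (S : Set (Fin n)) = {e | cyclicPos n a e < s} := by ext e; simp [hSs]
  have e2 : J ∩ S = J.filter (cyclicPos n a · < s) := by ext e; simp [hSs]
  rwa [e1, e2] at hlt

theorem card_filter_cyclicPos_le {n : ℕ} [NeZero n] (J : Finset (Fin n)) (a : ℤ) (s : ℕ) :
    (J.filter (cyclicPos n a · < s)).card ≤ s := by
  have : (J.filter (cyclicPos n a · < s)).card ≤ (Finset.Ico (0 : ℤ) s).card := by
    refine Finset.card_le_card_of_injOn (cyclicPos n a) (fun e he => ?_)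
      (cyclicPos_injective a).injOn
    have h1 := (Finset.mem_filter.1 (Finset.mem_coe.1 he)).2
    simpa using ⟨cyclicPos_nonneg a e, h1⟩
  simpa using this

theorem le_intervalRank_of_linearIndependent {E : Type*} [AddCommGroup E] [Module ℝ E] {x : ℤ → E}
    {a : ℤ} {s k : ℕ} [Module.Finite ℝ E] (c : Fin k → ℤ) (hc : LinearIndependent ℝ (fun p => x (c p)))
    (hmem : ∀ p, a ≤ c p ∧ c p < a + s) : k ≤ intervalRank x a s := by
  have h1 := finrank_span_eq_card hc
  rw [Fintype.card_fin] at h1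
  rw [← h1]
  refine Submodule.finrank_mono (Submodule.span_mono ?_)
  rintro _ ⟨p, rfl⟩
  exact ⟨c p, by simpa using hmem p, rfl⟩

theorem seqMinor_ne_zero_of_linearIndepOn {ι : Type*} {k : ℕ} {x : ι → Fin k → ℝ} {J : Set ι}
    (h : LinearIndepOn ℝ x J) {c : Fin k → ι} (hc : Function.Injective c) (hcJ : ∀ p, c p ∈ J) :
    seqMinor x c ≠ 0 :=
  (seqMinor_ne_zero_iff _ _).2 (LinearIndependent.comp h (fun p => ⟨c p, hcJ p⟩) fun a b hab =>
    hc (by simpa using hab))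

theorem span_range_eq_top_of_seqMinor_ne_zero {ι : Type*} {k : ℕ} {x : ι → Fin k → ℝ}
    {c : Fin k → ι} (hc : seqMinor x c ≠ 0) : Submodule.span ℝ (Set.range x) = ⊤ := by
  have h1 := ((seqMinor_ne_zero_iff _ _).1 hc).span_eq_top_of_card_eq_finrank' (by simp)
  rw [eq_top_iff, ← h1]
  refine Submodule.span_mono ?_
  rintro _ ⟨p, rfl⟩
  exact ⟨c p, rfl⟩

/-- A weakly positive sequence with nonvanishing consecutive minors is strictly positive. -/
theorem CycNonneg.cycPos {n k : ℕ} [NeZero n] {x : ℤ → Fin k → ℝ}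
    (h : Quasi n ((-1) ^ (k + 1)) x) (hNN : CycNonneg n x)
    (hcons : ∀ a : ℤ, seqMinor x (fun p : Fin k => a + (p : ℕ)) ≠ 0) : CycPos n x := by
  have hne : ∀ c : Fin k → ℤ, CycMono n c → seqMinor x c ≠ 0 := by
    intro c hc h0
    obtain ⟨d, hd, e⟩ := exists_linear (NeZero.pos n) h hc
    have hJ : (Finset.univ.image d).card = k := by
      rw [Finset.card_image_of_injective _ hd.injective, Finset.card_fin]
    have hdep : ¬ LinearIndepOn ℝ (onPeriod n x) ((Finset.univ.image d : Finset (Fin n)) :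
        Set (Fin n)) := fun hi =>
      seqMinor_ne_zero_of_linearIndepOn hi hd.injective (fun p => by simp) (e.symm.trans h0)
    -- Nonvanishing consecutive minors give every interval of length `s` rank at least `min s k`,
    -- which already bounds the number of its elements in a `k`-set. So no interval can be violated.
    obtain ⟨a, s, hs, hlt⟩ := exists_intervalRank_lt h (neg_one_pow_mul_self _) hNN
      (span_range_eq_top_of_seqMinor_ne_zero (hcons 0)) hJ hdep
    have h1 := card_filter_cyclicPos_le (Finset.univ.image d) a s
    have h2 := Finset.card_filter_le (Finset.univ.image d) (cyclicPos n a · < s)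
    rw [hJ] at h2
    have h3 : min s k ≤ intervalRank x a s := by
      refine le_intervalRank_of_linearIndependent (fun p : Fin (min s k) => a + (p : ℕ))
        (LinearIndependent.comp ((seqMinor_ne_zero_iff _ _).1 (hcons a))
          (Fin.castLE (min_le_right s k)) (Fin.castLE_injective _)) fun p => ?_
      have := p.2
      omega
    omega
  intro c c' hc hc'
  exact lt_of_le_of_ne (hNN c c' hc hc') (mul_ne_zero (hne c hc) (hne c' hc')).symm

/-! ### The twist of a sequence -/

section Dual

variable {ι : Type*} [Fintype ι] {N ℓ : ℕ}

/-- The defining relations of the twisted sequence, for windows of length `N`. -/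
def IsDualSeq (N ℓ : ℕ) (u t : ℤ → ι → ℝ) : Prop :=
  ∀ (j : ℤ) (i : ℕ), i < N → t j ⬝ᵥ u (j - ℓ + i) = if i = 0 then (-1 : ℝ) ^ j else 0

/-- All windows of length `N` are linearly independent. -/
def WindowsIndep (N : ℕ) (u : ℤ → ι → ℝ) : Prop :=
  ∀ j : ℤ, LinearIndependent ℝ (fun i : Fin N => u (j + (i : ℕ)))

theorem WindowsIndep.exists_coeff {u : ℤ → ι → ℝ} (hu : WindowsIndep N u) (hN : Fintype.card ι = N)
    (a : ℤ) (X : ι → ℝ) : ∃ α : ℕ → ℝ, X = ∑ i ∈ Finset.range N, α i • u (a + i) := by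
  have h1 := (hu a).span_eq_top_of_card_eq_finrank' (by simp [hN])
  have hX : X ∈ Submodule.span ℝ (Set.range fun i : Fin N => u (a + (i : ℕ))) := by rw [h1]; trivial
  obtain ⟨c, hc⟩ := (Submodule.mem_span_range_iff_exists_fun ℝ).1 hX
  refine ⟨fun i => if h : i < N then c ⟨i, h⟩ else 0, ?_⟩
  rw [← hc, ← Fin.sum_univ_eq_sum_range (fun i => (if h : i < N then c ⟨i, h⟩ else 0) • u (a + i))]
  exact Finset.sum_congr rfl fun i _ => by simp

theorem WindowsIndep.ext_dot {u : ℤ → ι → ℝ} (hu : WindowsIndep N u) (hN : Fintype.card ι = N)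
    {j : ℤ} {y y' : ι → ℝ}
    (h : ∀ i : ℕ, i < N → y ⬝ᵥ u (j + i) = y' ⬝ᵥ u (j + i)) : y = y' := by
  obtain ⟨α, hα⟩ := hu.exists_coeff hN j (y - y')
  have h0 : (y - y') ⬝ᵥ (y - y') = 0 := by
    conv_lhs => arg 2; rw [hα]
    rw [dotProduct_sum]
    refine Finset.sum_eq_zero fun i hi => ?_
    rw [dotProduct_smul, sub_dotProduct, h i (Finset.mem_range.1 hi), sub_self, smul_zero]
  exact sub_eq_zero.1 (dotProduct_self_eq_zero.1 h0)

/-- In the basis `u (a - ℓ), …, u (a - ℓ + N - 1)` the pairings with `t a, …, t (a + s - 1)` are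
triangular with diagonal entries `±1`. So vanishing of the pairings kills the first `s` coefficients
one after the other. -/
theorem IsDualSeq.annihilator {u t : ℤ → ι → ℝ} (ht : IsDualSeq N ℓ u t) (hu : WindowsIndep N u)
    (hN : Fintype.card ι = N) {a : ℤ} {s : ℕ} (hs : s ≤ N) {X : ι → ℝ}
    (hX : ∀ i : ℕ, i < s → X ⬝ᵥ t (a + i) = 0) :
    ∃ α : ℕ → ℝ, X = ∑ i ∈ Finset.range (N - s), α i • u (a + s - ℓ + i) := by
  obtain ⟨α, hα⟩ := hu.exists_coeff hN (a - ℓ) X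
  have hz : ∀ i : ℕ, i < s → α i = 0 := by
    intro i
    induction i using Nat.strong_induction_on with
    | _ i ih =>
      intro his
      have h1 := hX i his
      rw [hα, sum_dotProduct, Finset.sum_eq_single i] at h1
      · have h2 := ht (a + i) 0 (by omega)
        rw [smul_dotProduct, dotProduct_comm,
          show a - (ℓ : ℤ) + i = a + i - ℓ + ((0 : ℕ) : ℤ) by push_cast; ring, h2, if_pos rfl,
          smul_eq_mul] at h1
        exact (mul_eq_zero.1 h1).resolve_right (zpow_ne_zero _ (by norm_num))
      · intro i' hi' hne
        rw [Finset.mem_range] at hi'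
        rw [smul_dotProduct]
        rcases lt_or_gt_of_ne hne with h3 | h3
        · rw [ih i' h3 (h3.trans his), zero_smul]
        · have h2 := ht (a + i) (i' - i) (by omega)
          rw [if_neg (by omega)] at h2
          rw [dotProduct_comm, show a - (ℓ : ℤ) + i' = a + i - ℓ + ((i' - i : ℕ) : ℤ) by
            rw [Nat.cast_sub h3.le]; ring, h2, smul_zero]
      · intro h3
        exact absurd (Finset.mem_range.2 (his.trans_le hs)) h3
  refine ⟨fun i => α (s + i), ?_⟩
  rw [hα]
  conv_lhs => rw [← Nat.add_sub_cancel' hs]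
  rw [Finset.sum_range_add, Finset.sum_eq_zero (fun i hi => by
    rw [hz i (Finset.mem_range.1 hi), zero_smul]), zero_add]
  refine Finset.sum_congr rfl fun i _ => ?_
  congr 2
  push_cast
  ring

theorem IsDualSeq.dot_eq_zero {u t : ℤ → ι → ℝ} (ht : IsDualSeq N ℓ u t) {i j : ℤ}
    (h1 : i - ℓ < j) (h2 : j < i - ℓ + N) : t i ⬝ᵥ u j = 0 := by
  have := ht i (j - (i - ℓ)).toNat (by omega)
  rw [if_neg (by omega)] at this
  rwa [show i - (ℓ : ℤ) + ((j - (i - ℓ)).toNat : ℤ) = j by omega] at this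

theorem IsDualSeq.quasi {n : ℕ} {e : ℝ} {u t : ℤ → ι → ℝ} (ht : IsDualSeq N ℓ u t)
    (hu : WindowsIndep N u) (hN : Fintype.card ι = N) (hq : Quasi n e u) (he : e * e = 1) :
    Quasi n ((-1) ^ n * e) t := by
  intro j
  refine WindowsIndep.ext_dot hu hN (j := j + n - ℓ) fun i hi => ?_
  rw [ht (j + n) i hi, smul_dotProduct, show j + (n : ℤ) - ℓ + i = j - ℓ + i + n by ring, hq,
    dotProduct_smul, ht j i hi]
  split_ifs
  · rw [zpow_add₀ (by norm_num), zpow_natCast, smul_eq_mul, smul_eq_mul]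
    linear_combination (-(-1) ^ n * (-1) ^ j) * he
  · simp

end Dual

section Stack

variable {k ℓ : ℕ}

/-- The sequence of stacked vectors. -/
def stackSeq (v : ℤ → Fin k → ℝ) (w : ℤ → Fin ℓ → ℝ) (j : ℤ) : Fin k ⊕ Fin ℓ → ℝ :=
  Sum.elim (v j) (w j)

/-- The first coordinates of a stacked sequence. -/
def topSeq (t : ℤ → Fin k ⊕ Fin ℓ → ℝ) (j : ℤ) : Fin k → ℝ := fun p => t j (Sum.inl p)

/-- The last coordinates of a stacked sequence. -/
def botSeq (t : ℤ → Fin k ⊕ Fin ℓ → ℝ) (j : ℤ) : Fin ℓ → ℝ := fun p => t j (Sum.inr p)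

/-- The sequence with alternating signs. -/
def altSeq {E : Type*} [AddCommGroup E] [Module ℝ E] (x : ℤ → E) (j : ℤ) : E := (-1 : ℝ) ^ j • x j

theorem Quasi.stackSeq {n : ℕ} {e : ℝ} {v : ℤ → Fin k → ℝ} {w : ℤ → Fin ℓ → ℝ} (hv : Quasi n e v)
    (hw : Quasi n e w) : Quasi n e (stackSeq v w) := by
  intro j
  funext p
  rcases p with p | p
  · simpa [StackedTwist.stackSeq] using congrFun (hv j) p
  · simpa [StackedTwist.stackSeq] using congrFun (hw j) p

theorem Quasi.topSeq {n : ℕ} {e : ℝ} {t : ℤ → Fin k ⊕ Fin ℓ → ℝ} (h : Quasi n e t) :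
    Quasi n e (topSeq t) := fun j => funext fun p => congrFun (h j) (Sum.inl p)

theorem Quasi.botSeq {n : ℕ} {e : ℝ} {t : ℤ → Fin k ⊕ Fin ℓ → ℝ} (h : Quasi n e t) :
    Quasi n e (botSeq t) := fun j => funext fun p => congrFun (h j) (Sum.inr p)

theorem Quasi.altSeq {n : ℕ} {e : ℝ} {E : Type*} [AddCommGroup E] [Module ℝ E] {x : ℤ → E}
    (h : Quasi n e x) : Quasi n ((-1) ^ n * e) (altSeq x) := by
  intro j
  simp only [StackedTwist.altSeq]
  rw [h, zpow_add₀ (by norm_num), zpow_natCast, smul_smul, smul_smul]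
  congr 1
  ring

theorem dotProduct_elim_left (y : Fin k → ℝ) (X : Fin k ⊕ Fin ℓ → ℝ) :
    (Sum.elim y 0 : Fin k ⊕ Fin ℓ → ℝ) ⬝ᵥ X = y ⬝ᵥ fun p => X (Sum.inl p) := by
  simp [dotProduct]

theorem dotProduct_elim_right (y : Fin ℓ → ℝ) (X : Fin k ⊕ Fin ℓ → ℝ) :
    (Sum.elim 0 y : Fin k ⊕ Fin ℓ → ℝ) ⬝ᵥ X = y ⬝ᵥ fun p => X (Sum.inr p) := by
  simp [dotProduct]

theorem linearIndependent_range_sum {E : Type*} [AddCommGroup E] [Module ℝ E] {N : ℕ} {x : ℤ → E}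
    {a : ℤ} (h : LinearIndependent ℝ (fun i : Fin N => x (a + (i : ℕ)))) {α : ℕ → ℝ}
    (h0 : ∑ i ∈ Finset.range N, α i • x (a + i) = 0) : ∀ i < N, α i = 0 := by
  intro i hi
  rw [← Fin.sum_univ_eq_sum_range (fun i => α i • x (a + i))] at h0
  exact Fintype.linearIndependent_iff.1 h (fun i => α i) h0 ⟨i, hi⟩

/-- Consecutive maximal minors of the top part of the twist do not vanish. -/
theorem seqMinor_topSeq_ne_zero {v : ℤ → Fin k → ℝ} {w : ℤ → Fin ℓ → ℝ}
    {t : ℤ → Fin k ⊕ Fin ℓ → ℝ} (ht : IsDualSeq (k + ℓ) ℓ (stackSeq v w) t)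
    (hu : WindowsIndep (k + ℓ) (stackSeq v w)) (hw : WindowsIndep ℓ w) (a : ℤ) :
    seqMinor (topSeq t) (fun p : Fin k => a + (p : ℕ)) ≠ 0 := by
  intro h0
  obtain ⟨y, hy0, hy⟩ := Matrix.exists_mulVec_eq_zero_iff.2 h0
  -- A vector `(y, 0)` orthogonal to `k` consecutive twisted vectors is a combination of `ℓ`
  -- consecutive stacked vectors. The lower coordinates give a relation among `ℓ` consecutive values
  -- of `w`, which must be trivial.
  have hX := ht.annihilator hu (by simp) (a := a) (s := k) (by omega) (X := Sum.elim y 0) (by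
    intro i hi
    rw [dotProduct_elim_left, dotProduct_comm]
    exact congrFun hy ⟨i, hi⟩)
  obtain ⟨α, hα⟩ := hX
  rw [Nat.add_sub_cancel_left] at hα
  have h1 : ∑ i ∈ Finset.range ℓ, α i • w (a + k - ℓ + i) = 0 := by
    funext q
    have := congrFun hα (Sum.inr q)
    simp only [Sum.elim_inr, Pi.zero_apply, Finset.sum_apply, Pi.smul_apply, stackSeq] at this ⊢
    exact this.symm
  have h2 := linearIndependent_range_sum (hw _) h1
  apply hy0
  funext p
  have := congrFun hα (Sum.inl p)
  rw [Finset.sum_eq_zero fun i hi => by rw [h2 i (Finset.mem_range.1 hi), zero_smul]] at this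
  simpa using this

/-- Consecutive maximal minors of the bottom part of the twist do not vanish. -/
theorem seqMinor_botSeq_ne_zero {v : ℤ → Fin k → ℝ} {w : ℤ → Fin ℓ → ℝ}
    {t : ℤ → Fin k ⊕ Fin ℓ → ℝ} (ht : IsDualSeq (k + ℓ) ℓ (stackSeq v w) t)
    (hu : WindowsIndep (k + ℓ) (stackSeq v w)) (hv : WindowsIndep k v) (a : ℤ) :
    seqMinor (botSeq t) (fun p : Fin ℓ => a + (p : ℕ)) ≠ 0 := by
  intro h0
  obtain ⟨y, hy0, hy⟩ := Matrix.exists_mulVec_eq_zero_iff.2 h0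
  have hX := ht.annihilator hu (by simp) (a := a) (s := ℓ) (by omega) (X := Sum.elim 0 y) (by
    intro i hi
    rw [dotProduct_elim_right, dotProduct_comm]
    exact congrFun hy ⟨i, hi⟩)
  obtain ⟨α, hα⟩ := hX
  rw [Nat.add_sub_cancel] at hα
  have h1 : ∑ i ∈ Finset.range k, α i • v (a + ℓ - ℓ + i) = 0 := by
    funext q
    have := congrFun hα (Sum.inl q)
    simp only [Sum.elim_inl, Pi.zero_apply, Finset.sum_apply, Pi.smul_apply, stackSeq] at this ⊢
    exact this.symm
  have h2 := linearIndependent_range_sum (hv _) h1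
  apply hy0
  funext p
  have := congrFun hα (Sum.inr p)
  rw [Finset.sum_eq_zero fun i hi => by rw [h2 i (Finset.mem_range.1 hi), zero_smul]] at this
  simpa using this

theorem finrank_ker_add_intervalRank {E : Type*} [AddCommGroup E] [Module ℝ E] [Module.Finite ℝ E]
    (x : ℤ → E) (b : ℤ) (M : ℕ) :
    Module.finrank ℝ (LinearMap.ker (Fintype.linearCombination ℝ
      (fun i : Fin M => x (b + (i : ℕ))))) + intervalRank x b M = M := by
  have h1 := LinearMap.finrank_range_add_finrank_ker (Fintype.linearCombination ℝ
    (fun i : Fin M => x (b + (i : ℕ))))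
  rw [Fintype.range_linearCombination, Module.finrank_fin_fun] at h1
  have h2 : Set.range (fun i : Fin M => x (b + (i : ℕ))) = x '' Set.Ico b (b + M) := by
    ext y
    constructor
    · rintro ⟨i, rfl⟩
      exact ⟨_, by simp, rfl⟩
    · rintro ⟨j, hj, rfl⟩
      simp only [Set.mem_Ico] at hj
      exact ⟨⟨(j - b).toNat, by omega⟩, by
        simp only
        rw [show b + ((j - b).toNat : ℤ) = j by omega]⟩
  rw [h2] at h1
  rw [intervalRank]
  omega

theorem finrank_ker_dot_add_intervalRank (x : ℤ → Fin ℓ → ℝ) (a : ℤ) (s : ℕ) :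
    Module.finrank ℝ (LinearMap.ker (Matrix.mulVecLin
      (Matrix.of fun i : Fin s => x (a + (i : ℕ))))) + intervalRank x a s = ℓ := by
  have h1 := LinearMap.finrank_range_add_finrank_ker (Matrix.mulVecLin
      (Matrix.of fun i : Fin s => x (a + (i : ℕ))))
  have h3 := (Matrix.of fun i : Fin s => x (a + (i : ℕ))).rank_eq_finrank_span_row
  rw [Matrix.rank] at h3
  rw [h3, Module.finrank_fin_fun] at h1
  have h2 : Set.range (Matrix.of fun i : Fin s => x (a + (i : ℕ))).row = x '' Set.Ico a (a + s) := by
    ext y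
    constructor
    · rintro ⟨i, rfl⟩
      exact ⟨a + (i : ℕ), by simp, rfl⟩
    · rintro ⟨j, hj, rfl⟩
      simp only [Set.mem_Ico] at hj
      exact ⟨⟨(j - a).toNat, by omega⟩, by
        change x (a + ((j - a).toNat : ℤ)) = x j
        rw [show a + ((j - a).toNat : ℤ) = j by omega]⟩
  rw [h2] at h1
  rw [intervalRank]
  omega

/-- The ranks of the bottom part of the twist on intervals, in terms of those of `v`. -/
theorem intervalRank_botSeq {v : ℤ → Fin k → ℝ} {w : ℤ → Fin ℓ → ℝ}
    {t : ℤ → Fin k ⊕ Fin ℓ → ℝ} (ht : IsDualSeq (k + ℓ) ℓ (stackSeq v w) t)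
    (hu : WindowsIndep (k + ℓ) (stackSeq v w)) (a : ℤ) {s : ℕ} (hs : s ≤ k + ℓ) :
    intervalRank (botSeq t) a s + k = s + intervalRank v (a + s - ℓ) (k + ℓ - s) := by
  have h1 := finrank_ker_add_intervalRank v (a + s - ℓ) (k + ℓ - s)
  have h2 := finrank_ker_dot_add_intervalRank (botSeq t) a s
  set Kv := LinearMap.ker (Fintype.linearCombination ℝ
    (fun i : Fin (k + ℓ - s) => v (a + s - ℓ + (i : ℕ)))) with hKv
  set D := LinearMap.ker (Matrix.mulVecLin
      (Matrix.of fun i : Fin s => botSeq t (a + (i : ℕ)))) with hD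
  -- A vector `(0, y)` annihilates the interval of the twist exactly when it equals `∑ αᵢ (v, w)`
  -- over the remaining window of `k + ℓ - s` indices. So `α ↦ ∑ αᵢ w` maps the relations among the
  -- `v` isomorphically onto the annihilator; it is injective because the stacked vectors are
  -- independent.
  suffices h : Module.finrank ℝ Kv = Module.finrank ℝ D by omega
  let L : (Fin (k + ℓ - s) → ℝ) →ₗ[ℝ] (Fin ℓ → ℝ) := Fintype.linearCombination ℝ
    (fun i : Fin (k + ℓ - s) => w (a + s - ℓ + (i : ℕ)))
  have hmapeq : Kv.map L = D := by
    ext y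
    constructor
    · rintro ⟨α, hα, rfl⟩
      have hα' : ∑ i, α i • v (a + s - ℓ + (i : ℕ)) = 0 := by
        have : Fintype.linearCombination ℝ (fun i : Fin (k + ℓ - s) => v (a + s - ℓ + (i : ℕ))) α = 0 :=
          hα
        rwa [Fintype.linearCombination_apply] at this
      have hsum : (Sum.elim 0 (L α) : Fin k ⊕ Fin ℓ → ℝ) =
          ∑ i, α i • stackSeq v w (a + s - ℓ + (i : ℕ)) := by
        funext p
        rcases p with p | p
        · have := congrFun hα' p
          simp only [Finset.sum_apply, Pi.smul_apply, stackSeq, Sum.elim_inl, Pi.zero_apply] at this ⊢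
          exact this.symm
        · simp [L, Fintype.linearCombination_apply, stackSeq]
      change (Matrix.of fun i : Fin s => botSeq t (a + (i : ℕ))) *ᵥ (L α) = 0
      funext i
      change botSeq t (a + (i : ℕ)) ⬝ᵥ L α = 0
      rw [dotProduct_comm]
      have h3 := dotProduct_elim_right (k := k) (L α) (t (a + (i : ℕ)))
      refine h3.symm.trans ?_
      rw [hsum, sum_dotProduct]
      refine Finset.sum_eq_zero fun q _ => ?_
      have := q.2
      have := i.2
      rw [smul_dotProduct, dotProduct_comm, ht.dot_eq_zero (by omega) (by push_cast; omega), smul_zero]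
    · intro hy
      have hy' : ∀ i : ℕ, i < s → (Sum.elim 0 y : Fin k ⊕ Fin ℓ → ℝ) ⬝ᵥ t (a + i) = 0 := by
        intro i hi
        have : (Matrix.of fun i : Fin s => botSeq t (a + (i : ℕ))) *ᵥ y = 0 := hy
        rw [dotProduct_elim_right, dotProduct_comm]
        exact congrFun this ⟨i, hi⟩
      obtain ⟨α, hα⟩ := ht.annihilator hu (by simp) hs hy'
      rw [← Fin.sum_univ_eq_sum_range (fun i => α i • stackSeq v w (a + s - ℓ + i))] at hα
      refine ⟨fun i => α i, ?_, ?_⟩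
      · change Fintype.linearCombination ℝ (fun i : Fin (k + ℓ - s) => v (a + s - ℓ + (i : ℕ))) _ = 0
        rw [Fintype.linearCombination_apply]
        funext p
        have := congrFun hα (Sum.inl p)
        simp only [Finset.sum_apply, Pi.smul_apply, stackSeq, Sum.elim_inl, Pi.zero_apply] at this ⊢
        exact this.symm
      · simp only [L, Fintype.linearCombination_apply]
        funext p
        have := congrFun hα (Sum.inr p)
        simp only [Finset.sum_apply, Pi.smul_apply, stackSeq, Sum.elim_inr] at this ⊢
        exact this.symm
  rw [← hmapeq]
  rw [← LinearMap.range_domRestrict]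
  refine (LinearMap.finrank_range_of_inj ?_).symm
  rintro ⟨α, hα⟩ ⟨β, hβ⟩ hαβ
  replace hαβ : L α = L β := hαβ
  have hα' : Fintype.linearCombination ℝ (fun i : Fin (k + ℓ - s) => v (a + s - ℓ + (i : ℕ))) α = 0 :=
    hα
  have hβ' : Fintype.linearCombination ℝ (fun i : Fin (k + ℓ - s) => v (a + s - ℓ + (i : ℕ))) β = 0 :=
    hβ
  have h0 : ∑ i, (α - β) i • stackSeq v w (a + s - ℓ + (i : ℕ)) = 0 := by
    funext p
    rcases p with p | p
    · have := congrFun (hα'.trans hβ'.symm) p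
      simp only [Fintype.linearCombination_apply, Finset.sum_apply, Pi.smul_apply, smul_eq_mul]
        at this
      simp [stackSeq, sub_mul, this]
    · have := congrFun hαβ p
      simp only [L, Fintype.linearCombination_apply, Finset.sum_apply, Pi.smul_apply, smul_eq_mul]
        at this
      simp [stackSeq, sub_mul, this]
  have hli : LinearIndependent ℝ (fun i : Fin (k + ℓ - s) => stackSeq v w (a + s - ℓ + (i : ℕ))) :=
    (hu (a + s - ℓ)).comp (Fin.castLE (by omega)) (Fin.castLE_injective _)
  have := Fintype.linearIndependent_iff.1 hli _ h0
  exact Subtype.ext (funext fun i => sub_eq_zero.1 (this i))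

end Stack

/-! ### Existence and continuity of the twist -/

section TwistSeq

variable {k ℓ : ℕ}

/-- The matrix with rows `u a, …, u (a + k + ℓ - 1)`. -/
def windowMatrix (u : ℤ → Fin k ⊕ Fin ℓ → ℝ) (a : ℤ) :
    Matrix (Fin k ⊕ Fin ℓ) (Fin k ⊕ Fin ℓ) ℝ :=
  Matrix.of fun s => u (a + (finSumFinEquiv s : ℕ))

/-- The twisted sequence. -/
def twistSeq (u : ℤ → Fin k ⊕ Fin ℓ → ℝ) (j : ℤ) : Fin k ⊕ Fin ℓ → ℝ :=
  (windowMatrix u (j - ℓ))⁻¹ *ᵥ fun s => if (finSumFinEquiv s : ℕ) = 0 then (-1 : ℝ) ^ j else 0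

theorem WindowsIndep.isUnit_det {u : ℤ → Fin k ⊕ Fin ℓ → ℝ} (hu : WindowsIndep (k + ℓ) u) (a : ℤ) :
    IsUnit (windowMatrix u a).det := by
  rw [← Matrix.isUnit_iff_isUnit_det, ← Matrix.linearIndependent_rows_iff_isUnit]
  exact (hu a).comp finSumFinEquiv finSumFinEquiv.injective

theorem isDualSeq_twistSeq {u : ℤ → Fin k ⊕ Fin ℓ → ℝ} (hu : WindowsIndep (k + ℓ) u) :
    IsDualSeq (k + ℓ) ℓ u (twistSeq u) := by
  intro j i hi
  have h1 : windowMatrix u (j - ℓ) *ᵥ twistSeq u j =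
      fun s => if (finSumFinEquiv s : ℕ) = 0 then (-1 : ℝ) ^ j else 0 := by
    rw [twistSeq, Matrix.mulVec_mulVec, Matrix.mul_nonsing_inv _ (hu.isUnit_det _),
      Matrix.one_mulVec]
  have h2 := congrFun h1 (finSumFinEquiv.symm ⟨i, hi⟩)
  simp only [Equiv.apply_symm_apply] at h2
  rw [← h2, dotProduct_comm]
  simp [windowMatrix, Matrix.mulVec]

/-- Only the limit needs independent windows: the inverse matrix is the inverse determinant times
the adjugate, and is continuous wherever the determinant is nonzero. -/
theorem tendsto_twistSeq {X : Type*} {l : Filter X} {U : X → ℤ → Fin k ⊕ Fin ℓ → ℝ}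
    {u : ℤ → Fin k ⊕ Fin ℓ → ℝ} (hu : WindowsIndep (k + ℓ) u)
    (hU : ∀ j, Filter.Tendsto (fun x => U x j) l (nhds (u j))) (j : ℤ) :
    Filter.Tendsto (fun x => twistSeq (U x) j) l (nhds (twistSeq u j)) := by
  have hA : Filter.Tendsto (fun x => windowMatrix (U x) (j - ℓ)) l
      (nhds (windowMatrix u (j - ℓ))) := by
    refine tendsto_pi_nhds.2 fun s => ?_
    exact hU _
  have hdet : Filter.Tendsto (fun x => (windowMatrix (U x) (j - ℓ)).det) l
      (nhds (windowMatrix u (j - ℓ)).det) :=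
    ((continuous_id.matrix_det).tendsto _).comp hA
  have hadj : Filter.Tendsto (fun x => (windowMatrix (U x) (j - ℓ)).adjugate) l
      (nhds (windowMatrix u (j - ℓ)).adjugate) :=
    ((continuous_id.matrix_adjugate).tendsto _).comp hA
  have hinv : Filter.Tendsto (fun x => (windowMatrix (U x) (j - ℓ))⁻¹) l
      (nhds (windowMatrix u (j - ℓ))⁻¹) := by
    simp only [Matrix.inv_def, Ring.inverse_eq_inv']
    exact (hdet.inv₀ (hu.isUnit_det _).ne_zero).smul hadj
  have hcont : Continuous fun A : Matrix (Fin k ⊕ Fin ℓ) (Fin k ⊕ Fin ℓ) ℝ =>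
      A *ᵥ fun s => if (finSumFinEquiv s : ℕ) = 0 then (-1 : ℝ) ^ j else 0 :=
    continuous_id.matrix_mulVec continuous_const
  exact (hcont.tendsto _).comp hinv

theorem tendsto_seqMinor {X : Type*} {l : Filter X} {U : X → ℤ → Fin k → ℝ} {u : ℤ → Fin k → ℝ}
    (hU : ∀ j, Filter.Tendsto (fun x => U x j) l (nhds (u j))) (c : Fin k → ℤ) :
    Filter.Tendsto (fun x => seqMinor (U x) c) l (nhds (seqMinor u c)) := by
  have hA : Filter.Tendsto (fun x => (Matrix.of fun p => U x (c p) : Matrix (Fin k) (Fin k) ℝ)) l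
      (nhds (Matrix.of fun p => u (c p))) := by
    refine tendsto_pi_nhds.2 fun s => ?_
    exact hU _
  exact ((continuous_id.matrix_det).tendsto _).comp hA

end TwistSeq

/-! ### The orthogonality setting -/

/-- A totally nonnegative sequence `v` of rank `k` on all windows of length `k + ℓ`, together with
sequences `z`, totally positive, and `w`, spanning the orthogonal complement of `z`. -/
structure Admissible (k ℓ m n : ℕ) (v : ℤ → Fin k → ℝ) (z : ℤ → Fin (k + m) → ℝ)
    (w : ℤ → Fin ℓ → ℝ) : Prop where
  hv : Quasi n ((-1) ^ (k + 1)) v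
  hz : Quasi n ((-1) ^ (k + 1)) z
  hw : Quasi n ((-1) ^ (k + 1)) w
  zpos : CycPos n z
  orth : ∀ (s : ℤ) a b, ∑ i ∈ Finset.range n, z (s + i) a * w (s + i) b = 0
  wfull : ∀ y : Fin ℓ → ℝ, (∀ j, y ⬝ᵥ w j = 0) → y = 0
  vnonneg : CycNonneg n v
  vwin : ∀ a : ℤ, ∃ c : Fin k → ℤ, StrictMono c ∧ (∀ p, a ≤ c p ∧ c p < a + (k + ℓ : ℕ)) ∧
    seqMinor v c ≠ 0

/-- A spanning system annihilating a system of complementary rank has that system as its full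
annihilator. -/
theorem exists_of_sum_smul_eq_zero {n r ℓ : ℕ} (hn : r + ℓ = n) {z : Fin n → Fin r → ℝ}
    {w : Fin n → Fin ℓ → ℝ} (horth : ∀ a b, ∑ i, z i a * w i b = 0)
    (hz : ∀ y, (∀ i, y ⬝ᵥ z i = 0) → y = 0) (hw : ∀ y, (∀ i, y ⬝ᵥ w i = 0) → y = 0)
    {γ : Fin n → ℝ} (hγ : ∑ i, γ i • w i = 0) : ∃ y, ∀ i, γ i = y ⬝ᵥ z i := by
  let Z : (Fin r → ℝ) →ₗ[ℝ] (Fin n → ℝ) := Matrix.mulVecLin (Matrix.of z)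
  let Wt : (Fin n → ℝ) →ₗ[ℝ] (Fin ℓ → ℝ) := Matrix.mulVecLin (Matrix.of w)ᵀ
  have hZinj : Function.Injective Z := by
    rw [injective_iff_map_eq_zero]
    intro y hy
    refine hz y fun i => ?_
    rw [dotProduct_comm]
    exact congrFun hy i
  have hWrank : Module.finrank ℝ (LinearMap.range Wt) = ℓ := by
    have h1 : (Matrix.of w)ᵀ.rank = (Matrix.of w).rank := Matrix.rank_transpose _
    have h2 : Module.finrank ℝ (LinearMap.range (Matrix.mulVecLin (Matrix.of w))) = ℓ := by
      rw [LinearMap.finrank_range_of_inj, Module.finrank_fin_fun]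
      rw [injective_iff_map_eq_zero]
      intro y hy
      refine hw y fun i => ?_
      rw [dotProduct_comm]
      exact congrFun hy i
    exact h1.trans h2
  have hle : LinearMap.range Z ≤ LinearMap.ker Wt := by
    rintro _ ⟨y, rfl⟩
    rw [LinearMap.mem_ker]
    funext b
    change ∑ i, w i b * ∑ a, z i a * y a = 0
    simp only [Finset.mul_sum]
    rw [Finset.sum_comm]
    refine Finset.sum_eq_zero fun a _ => ?_
    have := horth a b
    calc ∑ i, w i b * (z i a * y a) = (∑ i, z i a * w i b) * y a := by
          rw [Finset.sum_mul]; exact Finset.sum_congr rfl fun i _ => by ring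
      _ = 0 := by rw [this, zero_mul]
  have heq : LinearMap.range Z = LinearMap.ker Wt := by
    refine Submodule.eq_of_le_of_finrank_eq hle ?_
    have h1 := LinearMap.finrank_range_add_finrank_ker Wt
    rw [LinearMap.finrank_range_of_inj hZinj, Module.finrank_fin_fun]
    rw [hWrank, Module.finrank_fin_fun] at h1
    omega
  have hmem : γ ∈ LinearMap.ker Wt := by
    rw [LinearMap.mem_ker]
    funext b
    have := congrFun hγ b
    simp only [Finset.sum_apply, Pi.smul_apply, smul_eq_mul, Pi.zero_apply] at this
    change ∑ i, w i b * γ i = 0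
    rw [← this]
    exact Finset.sum_congr rfl fun i _ => mul_comm _ _
  rw [← heq] at hmem
  obtain ⟨y, rfl⟩ := hmem
  exact ⟨y, fun i => dotProduct_comm (z i) y⟩

/-- Terms of weakly equal sign cannot cancel. Using pairwise products avoids deciding what the
common sign is. -/
theorem sum_ne_zero_of_pairwise {ι : Type*} {s : Finset ι} {T : ι → ℝ}
    (h : ∀ i ∈ s, ∀ j ∈ s, 0 ≤ T i * T j) {i₀ : ι} (hi₀ : i₀ ∈ s) (h0 : T i₀ ≠ 0) :
    ∑ i ∈ s, T i ≠ 0 := by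
  intro hs
  have h1 : T i₀ * T i₀ ≤ ∑ i ∈ s, T i₀ * T i :=
    Finset.single_le_sum (f := fun i => T i₀ * T i) (fun i hi => h i₀ hi₀ i hi) hi₀
  rw [← Finset.mul_sum, hs, mul_zero] at h1
  have := mul_self_pos.2 h0
  linarith

theorem append_update {k m : ℕ} {E : Type*} (η : Fin k → E) (y : Fin m → E) (i : Fin k) (c : E) :
    Fin.append (Function.update η i c) y = Function.update (Fin.append η y) (Fin.castAdd m i) c := by
  funext p
  induction p using Fin.addCases with
  | left p =>
    by_cases hp : p = i
    · subst hp; simp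
    · rw [Fin.append_left, Function.update_of_ne hp, Function.update_of_ne, Fin.append_left]
      simpa using hp
  | right p =>
    rw [Fin.append_right, Function.update_of_ne, Fin.append_right]
    intro h
    have := congrArg Fin.val h
    simp only [Fin.val_natAdd, Fin.val_castAdd] at this
    omega

/-- The determinant with its last arguments fixed, as an alternating map. -/
def detAppend {k m : ℕ} (y : Fin m → Fin (k + m) → ℝ) :
    (Fin (k + m) → ℝ) [⋀^Fin k]→ₗ[ℝ] ℝ where
  toFun η := (detRowAlternating : (Fin (k + m) → ℝ) [⋀^Fin (k + m)]→ₗ[ℝ] ℝ) (Fin.append η y)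
  map_update_add' := by
    intro inst η i a b
    rw [Subsingleton.elim inst (instDecidableEqFin k)]
    rw [append_update, append_update, append_update, AlternatingMap.map_update_add]
  map_update_smul' := by
    intro inst η i a b
    rw [Subsingleton.elim inst (instDecidableEqFin k)]
    rw [append_update, append_update, AlternatingMap.map_update_smul]
  map_eq_zero_of_eq' := by
    intro η i j h hij
    refine AlternatingMap.map_eq_zero_of_eq _ _ (i := Fin.castAdd m i) (j := Fin.castAdd m j) ?_ ?_
    · simpa using h
    · simpa using hij

namespace Admissible

variable {k ℓ m n : ℕ} {v : ℤ → Fin k → ℝ} {z : ℤ → Fin (k + m) → ℝ} {w : ℤ → Fin ℓ → ℝ}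

theorem z_indep (h : Admissible k ℓ m n v z w) {c : Fin (k + m) → ℤ} (hc : CycMono n c)
    {y : Fin (k + m) → ℝ} (hy : ∀ p, y ⬝ᵥ z (c p) = 0) : y = 0 := by
  by_contra hy0
  refine h.zpos.ne_zero hc (Matrix.exists_mulVec_eq_zero_iff.1 ⟨y, hy0, ?_⟩)
  funext p
  simpa [Matrix.mulVec, dotProduct_comm] using hy p

/-- Dependencies of `w` over a period come from `z`. -/
theorem exists_of_sum_w (h : Admissible k ℓ m n v z w) (hn : k + ℓ + m = n) [NeZero n] (s : ℤ)
    {γ : ℕ → ℝ} (hγ : ∑ i ∈ Finset.range n, γ i • w (s + i) = 0) :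
    ∃ y, ∀ i < n, γ i = y ⬝ᵥ z (s + i) := by
  obtain ⟨y, hy⟩ := exists_of_sum_smul_eq_zero (n := n) (r := k + m) (ℓ := ℓ) (by omega)
    (z := fun i => z (s + (i : ℕ))) (w := fun i => w (s + (i : ℕ))) (γ := fun i => γ i)
    (fun a b => by
      rw [← h.orth s a b, ← Fin.sum_univ_eq_sum_range (fun i => z (s + i) a * w (s + i) b)])
    (fun y hy => h.z_indep (cycMono_consec (n := n) (k := k + m) (by omega) s)
      fun p => hy ⟨p, by have := p.2; omega⟩)
    (fun y hy => h.wfull y fun j => by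
      have he := neg_one_pow_mul_self (k + 1)
      obtain ⟨t, ht⟩ : ∃ t : ℤ, j = (s + ((j - s) % n).toNat) + n * t := by
        refine ⟨(j - s) / n, ?_⟩
        rw [Int.toNat_of_nonneg (Int.emod_nonneg _ (by exact_mod_cast NeZero.ne n))]
        have := Int.emod_add_mul_ediv (j - s) n
        linarith
      obtain ⟨r, -, hr⟩ := quasi_mul h.hw he t (s + ((j - s) % n).toNat)
      rw [ht, hr, dotProduct_smul]
      have := hy ⟨((j - s) % n).toNat, by
        have := Int.emod_lt_of_pos (j - s) (show (0 : ℤ) < n by exact_mod_cast NeZero.pos n)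
        have := Int.emod_nonneg (j - s) (show (n : ℤ) ≠ 0 by exact_mod_cast NeZero.ne n)
        omega⟩
      simp only at this
      rw [this, smul_zero])
    (by rw [← hγ, ← Fin.sum_univ_eq_sum_range (fun i => γ i • w (s + i))])
  exact ⟨y, fun i hi => hy ⟨i, hi⟩⟩

/-- A relation among `ℓ` consecutive vectors `w`, padded by zeros to a full period, has the form `y
· z`. It vanishes at the other `k + m` indices, where the vectors `z` form a basis, so `y = 0`. -/
theorem windowsIndep_w (h : Admissible k ℓ m n v z w) (hn : k + ℓ + m = n) [NeZero n] :
    WindowsIndep ℓ w := by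
  intro a
  rw [Fintype.linearIndependent_iff]
  intro g hg i
  obtain ⟨y, hy⟩ := h.exists_of_sum_w hn a (γ := fun i => if hi : i < ℓ then g ⟨i, hi⟩ else 0) (by
    rw [← Finset.sum_subset (Finset.range_subset_range.2 (show ℓ ≤ n by omega)), ←
      Fin.sum_univ_eq_sum_range (fun i => (if hi : i < ℓ then g ⟨i, hi⟩ else 0) • w (a + i))]
    · rw [← hg]
      exact Finset.sum_congr rfl fun i _ => by simp
    · intro i _ hi
      rw [Finset.mem_range] at hi
      rw [dif_neg hi, zero_smul])
  have hy0 : y = 0 := by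
    refine h.z_indep (cycMono_consec (n := n) (k := k + m) (by omega) (a + ℓ)) fun p => ?_
    have := hy (ℓ + p) (by have := p.2; omega)
    rw [dif_neg (by omega)] at this
    rw [this]
    push_cast
    rw [add_assoc]
  have := hy i (by have := i.2; omega)
  rw [dif_pos i.2, hy0, zero_dotProduct] at this
  exact this

/-- The `w`-part of a relation `g` gives `gᵢ = y · z(s + i)`, with `y` orthogonal to the `m` vectors
`z` in the rest of the period. The `v`-part says that `y` is also orthogonal to the `k` vectors `∑ᵢ
vᵢ(p) zᵢ`. If `y ≠ 0`, these `k + m` vectors have determinant zero. Cauchy–Binet expands that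
determinant into products of a minor of `v` and a minor of `z` in cyclic order, all of one sign, and
`vwin` supplies a nonzero one. -/
theorem windowsIndep_stackSeq (h : Admissible k ℓ m n v z w) (hn : k + ℓ + m = n) [NeZero n] :
    WindowsIndep (k + ℓ) (stackSeq v w) := by
  intro s
  rw [Fintype.linearIndependent_iff]
  intro g hg
  have hgv : ∑ i : Fin (k + ℓ), g i • v (s + (i : ℕ)) = 0 := by
    funext p
    have := congrFun hg (Sum.inl p)
    simpa [stackSeq] using this
  have hgw : ∑ i : Fin (k + ℓ), g i • w (s + (i : ℕ)) = 0 := by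
    funext p
    have := congrFun hg (Sum.inr p)
    simpa [stackSeq] using this
  obtain ⟨y, hy⟩ := h.exists_of_sum_w hn s
    (γ := fun i => if hi : i < k + ℓ then g ⟨i, hi⟩ else 0) (by
    rw [← Finset.sum_subset (Finset.range_subset_range.2 (show k + ℓ ≤ n by omega)), ←
      Fin.sum_univ_eq_sum_range (fun i => (if hi : i < k + ℓ then g ⟨i, hi⟩ else 0) • w (s + i))]
    · rw [← hgw]
      exact Finset.sum_congr rfl fun i _ => by simp
    · intro i _ hi
      rw [Finset.mem_range] at hi
      rw [dif_neg hi, zero_smul])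
  have hgy : ∀ i : Fin (k + ℓ), g i = y ⬝ᵥ z (s + (i : ℕ)) := fun i => by
    have := hy i (by have := i.2; omega)
    rwa [dif_pos i.2] at this
  set zc : Fin m → Fin (k + m) → ℝ := fun q => z (s + (k + ℓ : ℕ) + (q : ℕ)) with hzc
  have hyc : ∀ q, y ⬝ᵥ zc q = 0 := fun q => by
    have := hy (k + ℓ + q) (by have := q.2; omega)
    rw [dif_neg (by omega)] at this
    rw [hzc, this]
    push_cast
    rw [add_assoc]
  suffices hy0 : y = 0 by
    intro i
    rw [hgy, hy0, zero_dotProduct]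
  by_contra hy0
  have hdet0 : detAppend zc (fun p => ∑ i : Fin (k + ℓ), v (s + (i : ℕ)) p • z (s + (i : ℕ))) = 0 := by
    change Matrix.det _ = 0
    refine Matrix.exists_mulVec_eq_zero_iff.1 ⟨y, hy0, ?_⟩
    funext p
    change Fin.append _ zc p ⬝ᵥ y = 0
    induction p using Fin.addCases with
    | left p =>
      rw [Fin.append_left, sum_dotProduct]
      have := congrFun hgv p
      rw [Finset.sum_apply] at this
      refine Eq.trans (Finset.sum_congr rfl fun i _ => ?_) this
      rw [smul_dotProduct, dotProduct_comm, ← hgy, Pi.smul_apply, smul_eq_mul, smul_eq_mul,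
        mul_comm]
    | right p => rw [Fin.append_right, dotProduct_comm, hyc]
  rw [AlternatingMap.cauchyBinet] at hdet0
  have hterm : ∀ c : Fin k → Fin (k + ℓ),
      Matrix.det (Matrix.of fun p q => v (s + (c q : ℕ)) p) * detAppend zc (fun p => z (s + (c p : ℕ))) =
      seqMinor v (fun p => s + (c p : ℕ)) *
        seqMinor z (Fin.append (fun p => s + ((c p : ℕ) : ℤ)) fun q : Fin m => s + (k + ℓ : ℕ) + (q : ℕ)) := by
    intro c
    rw [← Matrix.det_transpose]
    congr 1
    change detRowAlternating (Fin.append _ zc) = _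
    rw [seqMinor_def]
    congr 1
    funext p
    induction p using Fin.addCases with
    | left p => rw [Fin.append_left, Fin.append_left]
    | right p => rw [Fin.append_right, Fin.append_right]
  have hcm : ∀ c : Fin k → Fin (k + ℓ), StrictMono c → CycMono n (fun p => s + ((c p : ℕ) : ℤ)) :=
    fun c hc => cycMono_of_mem (fun p q hpq => by
      have : (c p : ℕ) < c q := hc hpq
      simpa using this) s fun p => by have := (c p).2; omega
  have hcm' : ∀ c : Fin k → Fin (k + ℓ), StrictMono c →
      CycMono n (Fin.append (fun p => s + ((c p : ℕ) : ℤ)) fun q : Fin m => s + (k + ℓ : ℕ) + (q : ℕ)) := by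
    intro c hc
    refine cycMono_of_mem ?_ s ?_
    · intro p q hpq
      induction p using Fin.addCases with
      | left p =>
        induction q using Fin.addCases with
        | left q =>
          have : (c p : ℕ) < c q := hc (Fin.lt_def.2 (Fin.lt_def.1 hpq))
          rw [Fin.append_left, Fin.append_left]
          omega
        | right q =>
          have := (c p).2
          rw [Fin.append_left, Fin.append_right]
          omega
      | right p =>
        induction q using Fin.addCases with
        | left q => rw [Fin.lt_def] at hpq; simp at hpq; omega
        | right q =>
          rw [Fin.lt_def] at hpq
          simp only [Fin.val_natAdd] at hpq
          rw [Fin.append_right, Fin.append_right]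
          omega
    · intro p
      induction p using Fin.addCases with
      | left p => have := (c p).2; rw [Fin.append_left]; omega
      | right p => have := p.2; rw [Fin.append_right]; omega
  obtain ⟨c₀, hc₀, hc₀', hne⟩ := h.vwin s
  set d : Fin k → Fin (k + ℓ) := fun p => ⟨(c₀ p - s).toNat, by have := hc₀' p; omega⟩ with hd
  have hdm : StrictMono d := fun p q hpq => by
    have := hc₀ hpq; have := hc₀' p; have := hc₀' q
    simp only [hd, Fin.mk_lt_mk]; omega
  refine sum_ne_zero_of_pairwise ?_ (Finset.mem_univ ⟨d, hdm⟩) ?_ hdet0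
  · intro c _ c' _
    rw [hterm, hterm, mul_mul_mul_comm]
    exact mul_nonneg (h.vnonneg _ _ (hcm c.1 c.2) (hcm c'.1 c'.2))
      (h.zpos _ _ (hcm' c.1 c.2) (hcm' c'.1 c'.2)).le
  · rw [hterm]
    refine mul_ne_zero ?_ (h.zpos.ne_zero (hcm' d hdm))
    convert hne using 2
    funext p
    have := hc₀' p
    simp only [hd]
    omega

end Admissible

/-! ### The flow `x ↦ x + a • x (· + d)` -/

section Flow

variable {E : Type*} [AddCommGroup E] [Module ℝ E]

/-- The sequence `x + a • x (· + d)`. -/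
def flowSeq (a : ℝ) (d : ℤ) (x : ℤ → E) (j : ℤ) : E := x j + a • x (j + d)

theorem Quasi.flowSeq {n : ℕ} {e : ℝ} {x : ℤ → E} (h : Quasi n e x) (a : ℝ) (d : ℤ) :
    Quasi n e (flowSeq a d x) := by
  intro j
  simp only [StackedTwist.flowSeq]
  rw [h, show j + (n : ℤ) + d = j + d + n by ring, h, smul_add, smul_smul, smul_smul, mul_comm]

/-- Shift the indices in `S` by `d`. -/
def shiftOn {k : ℕ} (S : Finset (Fin k)) (d : ℤ) (c : Fin k → ℤ) (p : Fin k) : ℤ :=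
  if p ∈ S then c p + d else c p

theorem seqMinor_flowSeq {k : ℕ} (a : ℝ) (d : ℤ) (x : ℤ → Fin k → ℝ) (c : Fin k → ℤ) :
    seqMinor (flowSeq a d x) c = ∑ S : Finset (Fin k), a ^ S.card * seqMinor x (shiftOn S d c) := by
  have h1 : (fun p => flowSeq a d x (c p)) = (fun p => a • x (c p + d)) + fun p => x (c p) := by
    funext p; simp [flowSeq, add_comm]
  rw [seqMinor_def, h1, AlternatingMap.map_add_univ]
  refine Finset.sum_congr rfl fun S _ => ?_
  have h2 : S.piecewise (fun p => a • x (c p + d)) (fun p => x (c p)) =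
      fun p => (if p ∈ S then a else 1) • x (shiftOn S d c p) := by
    funext p
    by_cases hp : p ∈ S <;> simp [hp, shiftOn]
  rw [h2]
  have h3 := (detRowAlternating : (Fin k → ℝ) [⋀^Fin k]→ₗ[ℝ] ℝ).map_smul_univ
    (fun p => if p ∈ S then a else 1) (fun p => x (shiftOn S d c p))
  rw [h3, smul_eq_mul, seqMinor_def]
  congr 1
  rw [Finset.prod_ite_mem, Finset.univ_inter, Finset.prod_const]

theorem seqMinor_eq_zero_of_eq_smul {ι : Type*} {k : ℕ} {x : ι → Fin k → ℝ} {c : Fin k → ι}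
    {p q : Fin k} (hpq : p ≠ q) {e : ℝ} (h : x (c p) = e • x (c q)) : seqMinor x c = 0 := by
  by_contra h0
  have hli := (seqMinor_ne_zero_iff _ _).1 h0
  have := linearIndependent_iff'.1 hli {p, q} (fun i => if i = p then 1 else -e) (by
    rw [Finset.sum_pair hpq, if_pos rfl, if_neg hpq.symm, h]
    simp) p (by simp)
  simp at this

/-- When some indices move by one step in a common direction, the order can fail only through a
coincidence of two indices, possibly modulo `n`. A coincidence makes two rows proportional, so the
minor vanishes. Hence the flow expands minors with nonnegative coefficients into cyclic minors only.
-/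
theorem cycMono_shiftOn_or {n k : ℕ} {x : ℤ → Fin k → ℝ} {e : ℝ} (h : Quasi n e x) (hn : 0 < n)
    {d : ℤ} (hd : d = 1 ∨ d = -1) {c : Fin k → ℤ} (hc : CycMono n c) (S : Finset (Fin k)) :
    seqMinor x (shiftOn S d c) = 0 ∨ CycMono n (shiftOn S d c) := by
  by_cases h1 : ∃ p q, p < q ∧ shiftOn S d c p = shiftOn S d c q
  · obtain ⟨p, q, hpq, heq⟩ := h1
    exact Or.inl (seqMinor_eq_zero_of_eq_smul (e := 1) hpq.ne (by rw [heq, one_smul]))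
  by_cases h2 : ∃ p q, p ≠ q ∧ shiftOn S d c p = shiftOn S d c q + n
  · obtain ⟨p, q, hpq, heq⟩ := h2
    exact Or.inl (seqMinor_eq_zero_of_eq_smul (e := e) hpq (by rw [heq, h]))
  right
  push Not at h1 h2
  refine ⟨fun p q hpq => ?_, fun p q => ?_⟩
  · have h3 := hc.1 hpq
    have h4 := h1 p q hpq
    unfold shiftOn at h4 ⊢
    split_ifs at h4 ⊢ <;> omega
  · by_cases hpq : p = q
    · subst hpq; omega
    · have h3 := hc.2 p q
      have h4 := h2 p q hpq
      unfold shiftOn at h4 ⊢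
      split_ifs at h4 ⊢ <;> omega

theorem flow_terms_nonneg {n k : ℕ} {x : ℤ → Fin k → ℝ} {e : ℝ} (h : Quasi n e x) (hn : 0 < n)
    (hx : CycNonneg n x) {d : ℤ} (hd : d = 1 ∨ d = -1) {a : ℝ} (ha : 0 ≤ a) {c c' : Fin k → ℤ}
    (hc : CycMono n c) (hc' : CycMono n c') (S S' : Finset (Fin k)) :
    0 ≤ (a ^ S.card * seqMinor x (shiftOn S d c)) * (a ^ S'.card * seqMinor x (shiftOn S' d c')) := by
  rw [mul_mul_mul_comm]
  refine mul_nonneg (by positivity) ?_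
  rcases cycMono_shiftOn_or h hn hd hc S with h1 | h1
  · rw [h1, zero_mul]
  rcases cycMono_shiftOn_or h hn hd hc' S' with h2 | h2
  · rw [h2, mul_zero]
  exact hx _ _ h1 h2

theorem CycNonneg.flowSeq {n k : ℕ} {x : ℤ → Fin k → ℝ} {e : ℝ} (h : Quasi n e x) (hn : 0 < n)
    (hx : CycNonneg n x) {d : ℤ} (hd : d = 1 ∨ d = -1) {a : ℝ} (ha : 0 ≤ a) :
    CycNonneg n (flowSeq a d x) := by
  intro c c' hc hc'
  rw [seqMinor_flowSeq, seqMinor_flowSeq, Finset.sum_mul_sum]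
  exact Finset.sum_nonneg fun S _ => Finset.sum_nonneg fun S' _ =>
    flow_terms_nonneg h hn hx hd ha hc hc' S S'

theorem seqMinor_flowSeq_ne_zero {n k : ℕ} {x : ℤ → Fin k → ℝ} {e : ℝ} (h : Quasi n e x)
    (hn : 0 < n) (hx : CycNonneg n x) {d : ℤ} (hd : d = 1 ∨ d = -1) {a : ℝ} (ha : 0 ≤ a)
    {c : Fin k → ℤ} (hc : CycMono n c) (S : Finset (Fin k)) (haS : a ^ S.card ≠ 0)
    (hS : seqMinor x (shiftOn S d c) ≠ 0) : seqMinor (flowSeq a d x) c ≠ 0 := by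
  rw [seqMinor_flowSeq]
  exact sum_ne_zero_of_pairwise (fun S _ S' _ => flow_terms_nonneg h hn hx hd ha hc hc S S')
    (Finset.mem_univ S) (mul_ne_zero haS hS)

theorem shiftOn_empty {k : ℕ} (d : ℤ) (c : Fin k → ℤ) : shiftOn ∅ d c = c := by
  funext p; simp [shiftOn]

theorem seqMinor_flowSeq_ne_zero_self {n k : ℕ} {x : ℤ → Fin k → ℝ} {e : ℝ} (h : Quasi n e x)
    (hn : 0 < n) (hx : CycNonneg n x) {d : ℤ} (hd : d = 1 ∨ d = -1) {a : ℝ} (ha : 0 ≤ a)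
    {c : Fin k → ℤ} (hc : CycMono n c) (hS : seqMinor x c ≠ 0) :
    seqMinor (flowSeq a d x) c ≠ 0 :=
  seqMinor_flowSeq_ne_zero h hn hx hd ha hc ∅ (by simp) (by rwa [shiftOn_empty])

theorem CycPos.flowSeq {n k : ℕ} {x : ℤ → Fin k → ℝ} {e : ℝ} (h : Quasi n e x) (hn : 0 < n)
    (hx : CycPos n x) {d : ℤ} (hd : d = 1 ∨ d = -1) {a : ℝ} (ha : 0 ≤ a) :
    CycPos n (flowSeq a d x) := fun c c' hc hc' =>
  lt_of_le_of_ne (CycNonneg.flowSeq h hn hx.cycNonneg hd ha c c' hc hc')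
    (mul_ne_zero (seqMinor_flowSeq_ne_zero_self h hn hx.cycNonneg hd ha hc (hx.ne_zero hc))
      (seqMinor_flowSeq_ne_zero_self h hn hx.cycNonneg hd ha hc' (hx.ne_zero hc'))).symm

theorem quasi_flow_iterate {n : ℕ} {e : ℝ} {x : ℤ → E} (h : Quasi n e x) (a : ℝ) (d : ℤ) (L : ℕ) :
    Quasi n e ((flowSeq a d)^[L] x) := by
  induction L with
  | zero => exact h
  | succ L ih => rw [Function.iterate_succ_apply']; exact ih.flowSeq a d

theorem cycNonneg_flow_iterate {n k : ℕ} {x : ℤ → Fin k → ℝ} {e : ℝ} (h : Quasi n e x) (hn : 0 < n)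
    (hx : CycNonneg n x) {a : ℝ} (ha : 0 ≤ a) (L : ℕ) : CycNonneg n ((flowSeq a 1)^[L] x) := by
  induction L with
  | zero => exact hx
  | succ L ih =>
    rw [Function.iterate_succ_apply']
    exact ih.flowSeq (quasi_flow_iterate h a 1 L) hn (Or.inl rfl) ha

/-- At each step every index that has not reached its target in `c'` moves one to the right. Since
the displacements increase with `p`, an index moves only if all later ones do, so no two collide.
The minor at `c'` therefore contributes to the minor at `c`, and the other contributions cannot
cancel it. -/
theorem seqMinor_flow_iterate_ne_zero {n k : ℕ} {x : ℤ → Fin k → ℝ} {e : ℝ} (h : Quasi n e x)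
    (hn : 0 < n) (hx : CycNonneg n x) {a : ℝ} (ha : 0 < a) (L : ℕ) :
    ∀ {c c' : Fin k → ℤ}, CycMono n c → CycMono n c' → (∀ p, c p ≤ c' p ∧ c' p ≤ c p + L) →
      Monotone (fun p => c' p - c p) → seqMinor x c' ≠ 0 →
      seqMinor ((flowSeq a 1)^[L] x) c ≠ 0 := by
  induction L with
  | zero =>
    intro c c' _ _ hle _ hne
    have : c = c' := funext fun p => by have := hle p; push_cast at this; omega
    rwa [this]
  | succ L ih =>
    intro c c' hc hc' hle hmono hne
    rw [Function.iterate_succ_apply']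
    set S : Finset (Fin k) := Finset.univ.filter fun p => c p < c' p with hS
    have hmem : ∀ p, p ∈ S ↔ c p < c' p := by simp [hS]
    refine seqMinor_flowSeq_ne_zero (quasi_flow_iterate h a 1 L) hn
      (cycNonneg_flow_iterate h hn hx ha.le L) (Or.inl rfl) ha.le hc S (pow_ne_zero _ ha.ne') ?_
    have hval : ∀ p, shiftOn S 1 c p = if c p < c' p then c p + 1 else c p := fun p => by
      simp only [shiftOn, hmem]
    refine ih (c' := c') ?_ hc' ?_ ?_ hne
    · refine ⟨fun p q hpq => ?_, fun p q => ?_⟩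
      · have h1 := hc.1 hpq
        have h2 := hmono hpq.le
        simp only at h2
        rw [hval, hval]
        split_ifs <;> omega
      · have h1 := hc.2 p q
        have h2 := hc'.2 p q
        have h3 := hle p
        have h4 := hle q
        rw [hval, hval]
        split_ifs <;> omega
    · intro p
      have := hle p
      rw [hval]
      push_cast at this
      split_ifs <;> omega
    · intro p q hpq
      have h2 := hmono hpq
      have h3 := hle p
      have h4 := hle q
      simp only at h2 ⊢
      rw [hval, hval]
      split_ifs <;> omega

/-- Enough iterations of the flow make a nonzero weakly positive sequence strictly positive. -/
theorem cycPos_flow_iterate {n k : ℕ} [NeZero n] {x : ℤ → Fin k → ℝ} (hkn : k ≤ n)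
    (h : Quasi n ((-1) ^ (k + 1)) x) (hx : CycNonneg n x) {c₀ : Fin k → ℤ} (hc₀ : CycMono n c₀)
    (hne : seqMinor x c₀ ≠ 0) {a : ℝ} (ha : 0 < a) : CycPos n ((flowSeq a 1)^[2 * n] x) := by
  have hn : 0 < n := NeZero.pos n
  refine CycNonneg.cycPos (quasi_flow_iterate h a 1 _) (cycNonneg_flow_iterate h hn hx ha.le _)
    fun s => ?_
  obtain ⟨c', h1, h2, h3, -⟩ := exists_rotate hn h hc₀ s
  -- The consecutive indices starting at `s` are carried to the sorted representatives `c'` in `[s,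
  -- s + n)`. All displacements are below `n`, so `2 * n` iterations suffice, and they are monotone
  -- because `c'` is strictly increasing.
  refine seqMinor_flow_iterate_ne_zero h hn hx ha (2 * n) (c' := c') (cycMono_consec hkn s)
    (cycMono_of_mem h1 s h2) ?_ ?_ (by rwa [h3])
  · have key : ∀ q : ℕ, ∀ hq : q < k, s + q ≤ c' ⟨q, hq⟩ := by
      intro q
      induction q with
      | zero => intro hq; simpa using (h2 ⟨0, hq⟩).1
      | succ q ih =>
        intro hq
        have := ih (by omega)
        have h4 : c' ⟨q, by omega⟩ < c' ⟨q + 1, hq⟩ := h1 (by simp [Fin.lt_def])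
        push_cast
        omega
    intro p
    have := key p p.2
    have := h2 p
    push_cast
    simp only [Fin.eta] at *
    omega
  · have hstep : ∀ i j : ℕ, ∀ hj : i + j < k, c' ⟨i, by omega⟩ + j ≤ c' ⟨i + j, hj⟩ := by
      intro i j
      induction j with
      | zero => intro hj; simp
      | succ j ih =>
        intro hj
        have h3 := ih (by omega)
        have h4 : c' ⟨i + j, by omega⟩ < c' ⟨i + (j + 1), hj⟩ := h1 (by simp [Fin.lt_def])
        push_cast
        omega
    intro p q hpq
    have hpq' : (p : ℕ) ≤ q := hpq
    have := hstep p (q - p) (by have := q.2; omega)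
    have e : (⟨(p : ℕ) + (q - p), by have := q.2; omega⟩ : Fin k) = q := Fin.ext (by simp; omega)
    rw [e] at this
    simp only [Fin.eta] at this ⊢
    omega

/-- The inverse flow, up to a scalar, on quasi-periodic sequences. -/
def neumannSeq (n : ℕ) (a : ℝ) (d : ℤ) (w : ℤ → E) (j : ℤ) : E :=
  ∑ i ∈ Finset.range n, (-a) ^ i • w (j - d * i)

theorem Quasi.neumannSeq {n : ℕ} {e : ℝ} {w : ℤ → E} (h : Quasi n e w) (a : ℝ) (d : ℤ) :
    Quasi n e (neumannSeq n a d w) := by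
  intro j
  simp only [StackedTwist.neumannSeq, Finset.smul_sum]
  refine Finset.sum_congr rfl fun i _ => ?_
  rw [show j + (n : ℤ) - d * i = j - d * i + n by ring, h, smul_smul, smul_smul, mul_comm]

/-- The geometric series telescopes, and quasi-periodicity returns the last term to `w j`. So up to
a scalar `neumannSeq` inverts `x ↦ x + a • x(· - d)`, the adjoint of the flow for the pairing over a
period. -/
theorem neumannSeq_add {n : ℕ} {e : ℝ} {w : ℤ → E} (h : Quasi n e w) (he : e * e = 1) (a : ℝ)
    {d : ℤ} (hd : d = 1 ∨ d = -1) (j : ℤ) :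
    neumannSeq n a d w j + a • neumannSeq n a d w (j - d) = (1 - (-a) ^ n * e) • w j := by
  have h1 : a • neumannSeq n a d w (j - d) =
      - ∑ i ∈ Finset.range n, (-a) ^ (i + 1) • w (j - d * (i + 1 : ℕ)) := by
    rw [neumannSeq, Finset.smul_sum, ← Finset.sum_neg_distrib]
    refine Finset.sum_congr rfl fun i _ => ?_
    rw [smul_smul, ← neg_smul]
    congr 2
    · ring
    · push_cast; ring
  have h2 : w (j - d * n) = e • w j := by
    rcases hd with rfl | rfl
    · have := h (j - 1 * n)
      rw [show j - 1 * (n : ℤ) + n = j by ring] at this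
      rw [this, smul_smul, he, one_smul]
    · rw [← h]; congr 1; ring
  rw [h1, neumannSeq, ← sub_eq_add_neg, ← Finset.sum_sub_distrib,
    Finset.sum_range_sub' (fun i => (-a) ^ i • w (j - d * (i : ℕ))), h2, smul_smul, sub_smul]
  simp

theorem neumann_scalar_pos {n : ℕ} (hn : 0 < n) {a e : ℝ} (ha : 0 ≤ a) (ha1 : a < 1)
    (he : e * e = 1) : 0 < 1 - (-a) ^ n * e := by
  have h1 : |(-a) ^ n * e| < 1 := by
    have he' : |e| = 1 := by
      have : |e| * |e| = 1 := by rw [← abs_mul, he, abs_one]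
      nlinarith [abs_nonneg e]
    rw [abs_mul, he', mul_one, abs_pow, abs_neg, abs_of_nonneg ha]
    exact pow_lt_one₀ ha ha1 hn.ne'
  linarith [(abs_lt.1 h1).2]

theorem sum_period {n : ℕ} {f : ℤ → ℝ} (hf : ∀ j, f (j + n) = f j) (s : ℤ) :
    ∑ i ∈ Finset.range n, f (s + i) = ∑ i ∈ Finset.range n, f i := by
  have step : ∀ s : ℤ, ∑ i ∈ Finset.range n, f (s + 1 + i) = ∑ i ∈ Finset.range n, f (s + i) := by
    intro s
    have h1 := Finset.sum_range_succ (fun i : ℕ => f (s + i)) n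
    have h2 := Finset.sum_range_succ' (fun i : ℕ => f (s + i)) n
    rw [h1, hf] at h2
    simp only [Nat.cast_zero, add_zero] at h2
    have h3 := add_right_cancel h2
    rw [h3]
    refine Finset.sum_congr rfl fun i _ => ?_
    push_cast
    congr 1
    ring
  induction s using Int.induction_on with
  | zero => simp
  | succ i ih => rw [step, ih]
  | pred i ih => rw [← ih, ← step]; simp

/-- Summation by parts moves the flow from `z` to its adjoint on `neumannSeq`, where it returns a
multiple of `w`; orthogonality is thus preserved. The scalar is nonzero because `a < 1`, which gives
fullness of the new `w`. -/
theorem Admissible.flow {k ℓ m n : ℕ} {v : ℤ → Fin k → ℝ} {z : ℤ → Fin (k + m) → ℝ}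
    {w : ℤ → Fin ℓ → ℝ} (h : Admissible k ℓ m n v z w) (hn : k + ℓ + m = n) [NeZero n] {d : ℤ}
    (hd : d = 1 ∨ d = -1) {a : ℝ} (ha : 0 ≤ a) (ha1 : a < 1) :
    Admissible k ℓ m n (flowSeq a d v) (flowSeq a d z) (neumannSeq n a d w) := by
  have he := neg_one_pow_mul_self (k + 1)
  have hκ := neumann_scalar_pos (NeZero.pos n) ha ha1 he
  refine ⟨h.hv.flowSeq _ _, h.hz.flowSeq _ _, h.hw.neumannSeq _ _,
    CycPos.flowSeq h.hz (NeZero.pos n) h.zpos hd ha, ?_, ?_,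
    CycNonneg.flowSeq h.hv (NeZero.pos n) h.vnonneg hd ha, ?_⟩
  · intro s α β
    have hw' := h.hw.neumannSeq a d
    have hper : ∀ j, (fun j => z j α * neumannSeq n a d w (j - d) β) (j + n) =
        (fun j => z j α * neumannSeq n a d w (j - d) β) j := by
      intro j
      have h1 := congrFun (h.hz j) α
      have h2 := congrFun (hw' (j - d)) β
      simp only [Pi.smul_apply, smul_eq_mul] at h1 h2 ⊢
      rw [h1, show j + (n : ℤ) - d = j - d + n by ring, h2]
      linear_combination z j α * neumannSeq n a d w (j - d) β * he
    have e1 := sum_period (f := fun j => z j α * neumannSeq n a d w (j - d) β) hper (s + d)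
    rw [← sum_period (f := fun j => z j α * neumannSeq n a d w (j - d) β) hper s] at e1
    have e2 : ∀ i : ℕ, z (s + i) α * neumannSeq n a d w (s + i) β +
        a * (z (s + i) α * neumannSeq n a d w (s + i - d) β) =
        (1 - (-a) ^ n * (-1) ^ (k + 1)) * (z (s + i) α * w (s + i) β) := by
      intro i
      have := congrFun (neumannSeq_add h.hw he a hd (s + i)) β
      simp only [Pi.add_apply, Pi.smul_apply, smul_eq_mul] at this
      linear_combination z (s + i) α * this
    calc ∑ i ∈ Finset.range n, flowSeq a d z (s + i) α * neumannSeq n a d w (s + i) β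
        = ∑ i ∈ Finset.range n, z (s + i) α * neumannSeq n a d w (s + i) β +
          a * ∑ i ∈ Finset.range n, z (s + d + i) α * neumannSeq n a d w (s + d + i - d) β := by
          rw [Finset.mul_sum, ← Finset.sum_add_distrib]
          refine Finset.sum_congr rfl fun i _ => ?_
          simp only [flowSeq, Pi.add_apply, Pi.smul_apply, smul_eq_mul]
          rw [show s + d + (i : ℤ) - d = s + i by ring, show s + d + (i : ℤ) = s + i + d by ring]
          ring
      _ = 0 := by
          rw [e1, Finset.mul_sum, ← Finset.sum_add_distrib, Finset.sum_congr rfl fun i _ => e2 i,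
            ← Finset.mul_sum, h.orth, mul_zero]
  · intro y hy
    refine h.wfull y fun j => ?_
    have h1 := neumannSeq_add h.hw he a hd j
    have h2 : y ⬝ᵥ ((1 - (-a) ^ n * (-1) ^ (k + 1)) • w j) = 0 := by
      rw [← h1, dotProduct_add, dotProduct_smul, hy, hy, smul_zero, add_zero]
    rw [dotProduct_smul, smul_eq_mul] at h2
    exact (mul_eq_zero.1 h2).resolve_left hκ.ne'
  · intro s
    obtain ⟨c, h1, h2, h3⟩ := h.vwin s
    refine ⟨c, h1, h2, seqMinor_flowSeq_ne_zero_self h.hv (NeZero.pos n) h.vnonneg hd ha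
      (cycMono_of_mem h1 s fun p => ⟨(h2 p).1, (h2 p).2.trans_le ?_⟩) h3⟩
    have : k + ℓ ≤ n := by omega
    have : ((k + ℓ : ℕ) : ℤ) ≤ n := by exact_mod_cast this
    linarith

end Flow

/-! ### Positivity along paths -/

/-- The set of parameters with strict positivity is open by continuity. It is also closed: a limit
is weakly positive, and nonvanishing consecutive minors upgrade it to strict positivity by
`CycNonneg.cycPos`. -/
theorem cycPos_of_preconnected {X : Type*} [TopologicalSpace X] [PreconnectedSpace X] {n k : ℕ}
    [NeZero n] {x : X → ℤ → Fin k → ℝ} (hcont : ∀ j, Continuous fun t => x t j)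
    (hq : ∀ t, Quasi n ((-1) ^ (k + 1)) (x t))
    (hcons : ∀ t (a : ℤ), seqMinor (x t) (fun p : Fin k => a + (p : ℕ)) ≠ 0) {t₀ : X}
    (h₀ : CycPos n (x t₀)) (t : X) : CycPos n (x t) := by
  have hn := NeZero.pos n
  have hcm : ∀ c : Fin k → ℤ, Continuous fun t => seqMinor (x t) c := fun c =>
    continuous_iff_continuousAt.2 fun t => tendsto_seqMinor (fun j => (hcont j).tendsto t) c
  have hlin : ∀ c : Fin k → Fin n, StrictMono c →
      CycMono n (fun p => ((c p : ℕ) : ℤ) + 1) := fun c hc =>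
    cycMono_of_mem (fun p q hpq => by
      have : ((c p : ℕ)) < c q := hc hpq
      simpa using this) 1 fun p => ⟨by omega, by have := (c p).2; omega⟩
  have hopen : IsOpen {t | CycPos n (x t)} := by
    have : {t | CycPos n (x t)} = ⋂ (c : {c : Fin k → Fin n // StrictMono c})
        (c' : {c : Fin k → Fin n // StrictMono c}),
        {t | 0 < seqMinor (x t) (fun p => ((c.1 p : ℕ) : ℤ) + 1) *
          seqMinor (x t) (fun p => ((c'.1 p : ℕ) : ℤ) + 1)} := by
      ext t
      simp only [Set.mem_ofPred_eq, Set.mem_iInter]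
      exact ⟨fun h c c' => h _ _ (hlin _ c.2) (hlin _ c'.2), fun h =>
        cycPos_of_linear hn (hq t) fun c c' hc hc' => h ⟨c, hc⟩ ⟨c', hc'⟩⟩
    rw [this]
    exact isOpen_iInter_of_finite fun c => isOpen_iInter_of_finite fun c' =>
      isOpen_lt continuous_const ((hcm _).mul (hcm _))
  have hclosed : IsClosed {t | CycPos n (x t)} := by
    have : {t | CycPos n (x t)} = ⋂ (c : {c : Fin k → Fin n // StrictMono c})
        (c' : {c : Fin k → Fin n // StrictMono c}),
        {t | 0 ≤ seqMinor (x t) (fun p => ((c.1 p : ℕ) : ℤ) + 1) *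
          seqMinor (x t) (fun p => ((c'.1 p : ℕ) : ℤ) + 1)} := by
      ext t
      simp only [Set.mem_ofPred_eq, Set.mem_iInter]
      exact ⟨fun h c c' => (h _ _ (hlin _ c.2) (hlin _ c'.2)).le, fun h =>
        CycNonneg.cycPos (hq t) (cycNonneg_of_linear hn (hq t)
          fun c c' hc hc' => h ⟨c, hc⟩ ⟨c', hc'⟩) (hcons t)⟩
    rw [this]
    exact isClosed_iInter fun c => isClosed_iInter fun c' =>
      isClosed_le continuous_const ((hcm _).mul (hcm _))
  rcases isClopen_iff.1 ⟨hclosed, hopen⟩ with h | h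
  · have : t₀ ∈ {t | CycPos n (x t)} := h₀
    rw [h] at this
    exact this.elim
  · have : t ∈ {t | CycPos n (x t)} := by rw [h]; trivial
    exact this

theorem eventually_cycPos {X : Type*} {l : Filter X} {n k : ℕ} (hn : 0 < n) {x : X → ℤ → Fin k → ℝ}
    {x₀ : ℤ → Fin k → ℝ} (hx : ∀ j, Filter.Tendsto (fun t => x t j) l (nhds (x₀ j)))
    (hq : ∀ t, Quasi n ((-1) ^ (k + 1)) (x t)) (h₀ : CycPos n x₀) :
    ∀ᶠ t in l, CycPos n (x t) := by
  have hlin : ∀ c : Fin k → Fin n, StrictMono c →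
      CycMono n (fun p => ((c p : ℕ) : ℤ) + 1) := fun c hc =>
    cycMono_of_mem (fun p q hpq => by
      have : ((c p : ℕ)) < c q := hc hpq
      simpa using this) 1 fun p => ⟨by omega, by have := (c p).2; omega⟩
  have : ∀ᶠ t in l, ∀ (c c' : {c : Fin k → Fin n // StrictMono c}),
      0 < seqMinor (x t) (fun p => ((c.1 p : ℕ) : ℤ) + 1) *
          seqMinor (x t) (fun p => ((c'.1 p : ℕ) : ℤ) + 1) := by
    rw [Filter.eventually_all]
    intro c
    rw [Filter.eventually_all]
    intro c'
    exact ((tendsto_seqMinor hx _).mul (tendsto_seqMinor hx _)).eventually_const_lt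
      (h₀ _ _ (hlin _ c.2) (hlin _ c'.2))
  filter_upwards [this] with t ht
  exact cycPos_of_linear hn (hq t) fun c c' hc hc' => ht ⟨c, hc⟩ ⟨c', hc'⟩

theorem cycNonneg_of_tendsto {X : Type*} {l : Filter X} [l.NeBot] {n k : ℕ} {x : X → ℤ → Fin k → ℝ}
    {x₀ : ℤ → Fin k → ℝ} (hx : ∀ j, Filter.Tendsto (fun t => x t j) l (nhds (x₀ j)))
    (h : ∀ᶠ t in l, CycNonneg n (x t)) : CycNonneg n x₀ := fun c c' hc hc' =>
  ge_of_tendsto ((tendsto_seqMinor hx c).mul (tendsto_seqMinor hx c'))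
    (h.mono fun _ ht => ht c c' hc hc')

/-! ### The trigonometric moment curve -/

/-- The function `cos θ + sin θ`. -/
def cas (θ : ℝ) : ℝ := Real.cos θ + Real.sin θ

/-- The trigonometric moment sequence in `ℝᴷ`. -/
def hartley (K n : ℕ) (j : ℤ) (p : Fin K) : ℝ :=
  cas ((2 * (p : ℕ) - (K - 1)) * Real.pi / n * j)

theorem cas_eq (θ : ℝ) : ((cas θ : ℝ) : ℂ) =
    (1 - Complex.I) / 2 * Complex.exp (θ * Complex.I) +
      (1 + Complex.I) / 2 * Complex.exp (-θ * Complex.I) := by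
  rw [Complex.exp_mul_I, Complex.exp_mul_I, Complex.cos_neg, Complex.sin_neg, cas]
  push_cast
  linear_combination Complex.sin θ * Complex.I_sq

theorem cas_add_int_mul_pi (θ : ℝ) (t : ℤ) : cas (θ + t * Real.pi) = (-1) ^ t * cas θ := by
  rw [cas, cas, Real.cos_add_int_mul_pi, Real.sin_add_int_mul_pi]
  ring

theorem rev_cast_real {K : ℕ} (p : Fin K) : ((p.rev : ℕ) : ℝ) = K - 1 - (p : ℕ) := by
  have : ((p.rev : ℕ) : ℝ) + (p + 1 : ℕ) = (K : ℝ) := by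
    rw [← Nat.cast_add]; congr 1; rw [Fin.val_rev]; omega
  push_cast at this
  linarith

/-- The basis of `n`-quasi-periodic real sequences that starts with the coordinates of the
trigonometric moment sequence in `ℝʳ`. -/
def hartleyBasis (r n : ℕ) (q : ℕ) (j : ℤ) : ℝ := cas ((2 * q - (r - 1)) * Real.pi / n * j)

theorem hartleyBasis_quasi (r : ℕ) {n : ℕ} (hn : 0 < n) (q : ℕ) :
    Quasi n ((-1) ^ (r + 1)) (hartleyBasis r n q) := by
  intro j
  have hn' : (n : ℝ) ≠ 0 := by positivity
  rw [smul_eq_mul, hartleyBasis, hartleyBasis]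
  have : (2 * (q : ℝ) - (r - 1)) * Real.pi / n * ((j + n : ℤ) : ℝ) =
      (2 * (q : ℝ) - (r - 1)) * Real.pi / n * j + ((2 * q - (r - 1) : ℤ) : ℝ) * Real.pi := by
    push_cast
    field_simp
  rw [this, cas_add_int_mul_pi]
  congr 1
  rw [show (2 * (q : ℤ) - (r - 1)) = ((r + 1 : ℕ) : ℤ) + 2 * (q - r) by push_cast; ring,
    zpow_add₀ (by norm_num), _root_.zpow_mul, zpow_natCast]
  norm_num

theorem hartley_quasi {K n : ℕ} (hn : 0 < n) : Quasi n ((-1) ^ (K + 1)) (hartley K n) := fun j =>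
  funext fun p => hartleyBasis_quasi K hn p j

/-- This matrix passes from exponentials with symmetric frequencies to the functions `cas`. It is `α
+ βP` with `P` the reversal and `P² = 1`; multiplied by `α - βP` it gives the scalar `α² - β² = -i`.
-/
theorem det_cas_mixing_ne_zero (K : ℕ) :
    ((((1 - Complex.I) / 2) • (1 : Matrix (Fin K) (Fin K) ℂ) +
      ((1 + Complex.I) / 2) • (1 : Matrix (Fin K) (Fin K) ℂ).submatrix id Fin.rev)).det ≠ 0 := by
  set P := (1 : Matrix (Fin K) (Fin K) ℂ).submatrix id Fin.rev with hP
  have hPP : P * P = 1 := by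
    ext p q
    rw [Matrix.mul_apply, Finset.sum_eq_single p.rev]
    · simp [P, Matrix.one_apply]
    · intro b _ hb
      have : p ≠ b.rev := fun h => hb (by rw [h, Fin.rev_rev])
      simp [P, Matrix.one_apply, this]
    · simp
  have h : (((1 - Complex.I) / 2) • (1 : Matrix (Fin K) (Fin K) ℂ) + ((1 + Complex.I) / 2) • P) *
      (((1 - Complex.I) / 2) • (1 : Matrix (Fin K) (Fin K) ℂ) - ((1 + Complex.I) / 2) • P) =
      (-Complex.I) • 1 := by
    rw [add_mul, mul_sub, mul_sub]
    simp only [smul_mul_assoc, mul_smul_comm, one_mul, mul_one, hPP, smul_smul]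
    have e1 : (1 - Complex.I) / 2 * ((1 - Complex.I) / 2) - (1 + Complex.I) / 2 * ((1 + Complex.I) / 2)
      = -Complex.I := by ring
    rw [← e1, sub_smul, mul_comm ((1 + Complex.I) / 2) ((1 - Complex.I) / 2)]
    abel
  intro h0
  have := congrArg Matrix.det h
  rw [Matrix.det_mul, h0, zero_mul, Matrix.det_smul, Matrix.det_one, mul_one] at this
  exact pow_ne_zero _ (neg_ne_zero.2 Complex.I_ne_zero) this.symm

/-- The minors of the trigonometric moment sequence, up to a constant factor. -/
theorem seqMinor_hartley (K n : ℕ) : ∃ C : ℂ, C ≠ 0 ∧ ∀ c : Fin K → ℤ,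
    ((seqMinor (hartley K n) c : ℝ) : ℂ) =
      C * ((∏ i : Fin K, ∏ j ∈ Finset.Ioi i, 2 * Real.sin ((c j - c i) * Real.pi / n) : ℝ) : ℂ) := by
  refine ⟨(∏ i : Fin K, ∏ j ∈ Finset.Ioi i, Complex.I) *
    ((((1 - Complex.I) / 2) • (1 : Matrix (Fin K) (Fin K) ℂ) +
      ((1 + Complex.I) / 2) • (1 : Matrix (Fin K) (Fin K) ℂ).submatrix id Fin.rev)).det,
    mul_ne_zero (Finset.prod_ne_zero_iff.2 fun i _ => Finset.prod_ne_zero_iff.2 fun j _ =>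
      Complex.I_ne_zero) (det_cas_mixing_ne_zero K), fun c => ?_⟩
  -- With these points the exponential matrix is a homogeneous Vandermonde matrix, whose factors
  -- `xⱼyᵢ - xᵢyⱼ` are `2i sin((cⱼ - cᵢ)π/n)`.
  let x : Fin K → ℂ := fun i => Complex.exp ((c i * Real.pi / n : ℝ) * Complex.I)
  let y : Fin K → ℂ := fun i => Complex.exp (-(c i * Real.pi / n : ℝ) * Complex.I)
  have hxy : ∀ p q, projVandermonde x y p q =
      Complex.exp (((2 * ((q : ℕ) : ℝ) - (K - 1)) * Real.pi / n * c p : ℝ) * Complex.I) := by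
    intro p q
    rw [projVandermonde_apply, ← Complex.exp_nat_mul, ← Complex.exp_nat_mul, ← Complex.exp_add]
    congr 1
    have := rev_cast_real q
    have h2 : ((q.rev : ℕ) : ℂ) = K - 1 - (q : ℕ) := by exact_mod_cast this
    rw [h2]
    push_cast
    ring
  have h1 : (Matrix.of fun p => hartley K n (c p) : Matrix (Fin K) (Fin K) ℝ).map Complex.ofRealHom =
      projVandermonde x y * (((1 - Complex.I) / 2) • (1 : Matrix (Fin K) (Fin K) ℂ) +
      ((1 + Complex.I) / 2) • (1 : Matrix (Fin K) (Fin K) ℂ).submatrix id Fin.rev) := by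
    ext p q
    have e : (projVandermonde x y * (1 : Matrix (Fin K) (Fin K) ℂ).submatrix id Fin.rev) p q =
        projVandermonde x y p q.rev := by
      simp [Matrix.mul_apply, Matrix.one_apply]
    rw [mul_add, Matrix.add_apply, mul_smul_comm, mul_smul_comm, Matrix.smul_apply,
      Matrix.smul_apply, e, mul_one, hxy, hxy, Matrix.map_apply, Matrix.of_apply, hartley,
      Complex.ofRealHom_eq_coe, cas_eq, smul_eq_mul, smul_eq_mul, rev_cast_real]
    congr 4
    push_cast
    ring
  have h2 : ((seqMinor (hartley K n) c : ℝ) : ℂ) =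
      ((Matrix.of fun p => hartley K n (c p) : Matrix (Fin K) (Fin K) ℝ).map Complex.ofRealHom).det := by
    exact RingHom.map_det Complex.ofRealHom _
  rw [h2, h1, Matrix.det_mul, det_projVandermonde]
  have h3 : ∀ i j : Fin K, x j * y i - x i * y j =
      Complex.I * ((2 * Real.sin ((c j - c i) * Real.pi / n) : ℝ) : ℂ) := by
    intro i j
    simp only [x, y]
    rw [← Complex.exp_add, ← Complex.exp_add]
    set φ : ℝ := (c j - c i) * Real.pi / n with hφ
    have e1 : ((c j * Real.pi / n : ℝ) : ℂ) * Complex.I + -((c i * Real.pi / n : ℝ) : ℂ) * Complex.I =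
        φ * Complex.I := by
      rw [hφ]; push_cast; ring
    have e2 : ((c i * Real.pi / n : ℝ) : ℂ) * Complex.I + -((c j * Real.pi / n : ℝ) : ℂ) * Complex.I =
        -φ * Complex.I := by
      rw [hφ]; push_cast; ring
    rw [e1, e2, Complex.exp_mul_I, Complex.exp_mul_I, Complex.cos_neg, Complex.sin_neg]
    push_cast
    ring
  simp only [h3, Finset.prod_mul_distrib]
  push_cast
  simp only [Finset.prod_mul_distrib]
  ring

theorem hartley_cycPos (K n : ℕ) (hn : 0 < n) : CycPos n (hartley K n) := by
  obtain ⟨C, hC, h⟩ := seqMinor_hartley K n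
  have hpos : ∀ c : Fin K → ℤ, CycMono n c →
      0 < ∏ i : Fin K, ∏ j ∈ Finset.Ioi i, 2 * Real.sin ((c j - c i) * Real.pi / n) := by
    intro c hc
    refine Finset.prod_pos fun i _ => Finset.prod_pos fun j hj => ?_
    have h1 : c i < c j := hc.1 (Finset.mem_Ioi.1 hj)
    have h2 := hc.2 j i
    have h1' : (0 : ℝ) < c j - c i := by rw [sub_pos]; exact_mod_cast h1
    have h2' : (c j : ℝ) - c i < n := by rw [sub_lt_iff_lt_add']; exact_mod_cast h2
    have hn' : (0 : ℝ) < n := by positivity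
    refine mul_pos two_pos (Real.sin_pos_of_pos_of_lt_pi (by have := Real.pi_pos; positivity) ?_)
    rw [div_lt_iff₀ hn', mul_comm]
    exact mul_lt_mul_of_pos_left h2' Real.pi_pos
  intro c c' hc hc'
  -- The complex constant common to all minors is eliminated by cross-multiplication. The products
  -- of sines are positive because index differences lie strictly between `0` and `n`.
  have e : seqMinor (hartley K n) c *
      (∏ i : Fin K, ∏ j ∈ Finset.Ioi i, 2 * Real.sin ((c' j - c' i) * Real.pi / n)) =
      seqMinor (hartley K n) c' *
      (∏ i : Fin K, ∏ j ∈ Finset.Ioi i, 2 * Real.sin ((c j - c i) * Real.pi / n)) := by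
    rw [← Complex.ofReal_inj, Complex.ofReal_mul, Complex.ofReal_mul, h c, h c']
    ring
  have hne : seqMinor (hartley K n) c' ≠ 0 := by
    intro h0
    have := h c'
    rw [h0, Complex.ofReal_zero] at this
    rcases mul_eq_zero.1 this.symm with h1 | h1
    · exact hC h1
    · exact (hpos c' hc').ne' (Complex.ofReal_eq_zero.1 h1)
  have := hpos c hc
  have h2 := hpos c' hc'
  have h3 : 0 < (seqMinor (hartley K n) c * seqMinor (hartley K n) c') *
      (∏ i : Fin K, ∏ j ∈ Finset.Ioi i, 2 * Real.sin ((c' j - c' i) * Real.pi / n)) := by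
    rw [mul_right_comm, e, mul_right_comm]
    exact mul_pos (mul_self_pos.2 hne) this
  exact (pos_iff_pos_of_mul_pos h3).2 h2

/-! ### The Hartley basis -/

theorem cas_mul_cas (α β : ℝ) : cas α * cas β = Real.cos (α - β) + Real.sin (α + β) := by
  rw [cas, cas, Real.cos_sub, Real.sin_add]
  ring

theorem sum_exp_eq {n : ℕ} (hn : 0 < n) (a : ℤ) :
    ∑ j ∈ Finset.range n, Complex.exp ((2 * Real.pi * a / n * j : ℝ) * Complex.I) =
      if (n : ℤ) ∣ a then (n : ℂ) else 0 := by
  have hn' : (n : ℂ) ≠ 0 := by exact_mod_cast hn.ne'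
  set ζ := Complex.exp (2 * Real.pi * Complex.I * (a / n)) with hζ
  have h1 : ∀ j : ℕ, Complex.exp ((2 * Real.pi * a / n * j : ℝ) * Complex.I) = ζ ^ j := by
    intro j
    rw [hζ, ← Complex.exp_nat_mul]
    congr 1
    push_cast
    ring
  have h2 : ζ = 1 ↔ (n : ℤ) ∣ a := by
    rw [hζ, Complex.exp_eq_one_iff]
    constructor
    · rintro ⟨t, ht⟩
      refine ⟨t, ?_⟩
      have h3 : (a : ℂ) / n = t := by
        have h4 : (2 * Real.pi * Complex.I : ℂ) ≠ 0 := Complex.two_pi_I_ne_zero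
        refine mul_left_cancel₀ h4 (ht.trans (by ring))
      rw [div_eq_iff hn'] at h3
      have : a = t * n := by exact_mod_cast h3
      rw [this, mul_comm]
    · rintro ⟨t, rfl⟩
      refine ⟨t, ?_⟩
      push_cast
      field_simp
  have h3 : ζ ^ n = 1 := by
    rw [hζ, ← Complex.exp_nat_mul, Complex.exp_eq_one_iff]
    refine ⟨a, ?_⟩
    field_simp
  rw [Finset.sum_congr rfl fun j _ => h1 j]
  split_ifs with h
  · rw [h2.2 h]; simp
  · have h4 : ζ - 1 ≠ 0 := sub_ne_zero.2 fun h5 => h (h2.1 h5)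
    have h5 := geom_sum_mul ζ n
    rw [h3, sub_self] at h5
    exact (mul_eq_zero.1 h5).resolve_right h4

theorem sum_cos_eq {n : ℕ} (hn : 0 < n) (a : ℤ) :
    ∑ j ∈ Finset.range n, Real.cos (2 * Real.pi * a / n * j) = if (n : ℤ) ∣ a then (n : ℝ) else 0 := by
  have h := congrArg Complex.re (sum_exp_eq hn a)
  rw [Complex.re_sum] at h
  simp only [Complex.exp_ofReal_mul_I_re] at h
  rw [h]
  split_ifs <;> simp

theorem sum_sin_eq {n : ℕ} (hn : 0 < n) (a : ℤ) :
    ∑ j ∈ Finset.range n, Real.sin (2 * Real.pi * a / n * j) = 0 := by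
  have h := congrArg Complex.im (sum_exp_eq hn a)
  rw [Complex.im_sum] at h
  simp only [Complex.exp_ofReal_mul_I_im] at h
  rw [h]
  split_ifs <;> simp

/-- A product of two `cas` values is the cosine of the difference plus the sine of the sum. Over a
period the sines sum to zero, and the cosines do so unless the frequencies agree. -/
theorem sum_hartleyBasis_mul (r : ℕ) {n : ℕ} (hn : 0 < n) {q q' : ℕ} (hq : q < n) (hq' : q' < n) :
    ∑ j ∈ Finset.range n, hartleyBasis r n q j * hartleyBasis r n q' j = if q = q' then (n : ℝ) else 0 := by
  have h : ∀ j ∈ Finset.range n, hartleyBasis r n q j * hartleyBasis r n q' j =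
      Real.cos (2 * Real.pi * ((q - q' : ℤ) : ℝ) / n * j) +
      Real.sin (2 * Real.pi * ((q + q' - (r - 1) : ℤ) : ℝ) / n * j) := by
    intro j _
    rw [hartleyBasis, hartleyBasis, cas_mul_cas]
    congr 2
    · push_cast; ring
    · push_cast; ring
  rw [Finset.sum_congr rfl h, Finset.sum_add_distrib, sum_cos_eq hn, sum_sin_eq hn, add_zero]
  congr 1
  rw [eq_iff_iff]
  constructor
  · intro hd
    have := Int.eq_zero_of_abs_lt_dvd hd (by rw [abs_lt]; omega)
    omega
  · rintro rfl; simp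

/-- The first `k + m` basis frequencies are symmetric about zero; for even `m`, dropping `m / 2` at
each end leaves the frequencies of the moment sequence in `ℝᵏ`. -/
theorem hartleyBasis_eq_hartley {k m n : ℕ} (hm : Even m) (j : ℤ) (p : Fin k) :
    hartleyBasis (k + m) n (p + m / 2) j = hartley k n j p := by
  obtain ⟨t, rfl⟩ := hm
  rw [hartleyBasis, hartley, show (t + t) / 2 = t by omega]
  congr 3
  push_cast
  ring

/-- The last `ℓ` basis frequencies are those of the moment sequence in `ℝ^ℓ` increased by exactly
`π`, which produces the factor `(-1)^j`. -/
theorem hartleyBasis_eq_altSeq {r ℓ n : ℕ} (hn : 0 < n) (hr : r + ℓ = n) (j : ℤ) (b : Fin ℓ) :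
    hartleyBasis r n (r + b) j = altSeq (hartley ℓ n) j b := by
  have hn' : (n : ℝ) ≠ 0 := by positivity
  rw [altSeq, Pi.smul_apply, smul_eq_mul, hartleyBasis, hartley, ← cas_add_int_mul_pi]
  congr 1
  have : (n : ℝ) = r + ℓ := by rw [← hr]; push_cast; ring
  field_simp
  rw [this]
  push_cast
  ring

theorem hartleyBasis_expand (r : ℕ) {n : ℕ} (hn : 0 < n) {x : ℤ → ℝ} (hx : Quasi n ((-1) ^ (r + 1)) x)
    (j : ℤ) : x j = ∑ q ∈ Finset.range n,
      ((∑ i ∈ Finset.range n, x i * hartleyBasis r n q i) / n) * hartleyBasis r n q j := by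
  have hn' : (n : ℝ) ≠ 0 := by positivity
  have hmat : (Matrix.of fun q i : Fin n => hartleyBasis r n q (i : ℕ)) *
      (Matrix.of fun q i : Fin n => hartleyBasis r n q (i : ℕ))ᵀ = (n : ℝ) • 1 := by
    ext q q'
    rw [Matrix.mul_apply, Matrix.smul_apply, Matrix.one_apply, smul_eq_mul]
    have := sum_hartleyBasis_mul r hn q.2 q'.2
    rw [← Fin.sum_univ_eq_sum_range (fun j => hartleyBasis r n q j * hartleyBasis r n q' j)] at this
    simp only [Matrix.of_apply, Matrix.transpose_apply]
    rw [this]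
    simp [Fin.ext_iff]
  -- For a square matrix, orthogonality of the rows implies orthogonality of the columns; the latter
  -- is the expansion formula on one period.
  have hmat' : (Matrix.of fun q i : Fin n => hartleyBasis r n q (i : ℕ))ᵀ *
      (Matrix.of fun q i : Fin n => hartleyBasis r n q (i : ℕ)) = (n : ℝ) • 1 := by
    have h1 : ((1 / n : ℝ) • (Matrix.of fun q i : Fin n => hartleyBasis r n q (i : ℕ))) *
      (Matrix.of fun q i : Fin n => hartleyBasis r n q (i : ℕ))ᵀ = 1 := by
      rw [smul_mul_assoc, hmat, smul_smul, one_div, inv_mul_cancel₀ hn', one_smul]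
    have h2 := mul_eq_one_comm.1 h1
    rw [mul_smul_comm] at h2
    rw [← h2, smul_smul, mul_one_div_cancel hn', one_smul]
  -- the expansion on one period
  have hper : ∀ j : ℕ, j < n → x j = ∑ q ∈ Finset.range n,
      ((∑ i ∈ Finset.range n, x i * hartleyBasis r n q i) / n) * hartleyBasis r n q j := by
    intro j hj
    have h1 : ∀ i : Fin n, ∑ q ∈ Finset.range n, hartleyBasis r n q (i : ℕ) * hartleyBasis r n q j =
        if (i : ℕ) = j then (n : ℝ) else 0 := by
      intro i
      have := congrFun (congrFun hmat' i) ⟨j, hj⟩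
      rw [Matrix.mul_apply, Matrix.smul_apply, Matrix.one_apply, smul_eq_mul] at this
      rw [← Fin.sum_univ_eq_sum_range (fun q => hartleyBasis r n q (i : ℕ) * hartleyBasis r n q j)]
      refine this.trans ?_
      simp [Fin.ext_iff]
    symm
    calc ∑ q ∈ Finset.range n, ((∑ i ∈ Finset.range n, x i * hartleyBasis r n q i) / n) *
          hartleyBasis r n q j
        = (∑ q ∈ Finset.range n, ∑ i : Fin n, x (i : ℕ) *
          (hartleyBasis r n q (i : ℕ) * hartleyBasis r n q j)) / n := by
          rw [Finset.sum_div]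
          refine Finset.sum_congr rfl fun q _ => ?_
          rw [← Fin.sum_univ_eq_sum_range (fun i => x i * hartleyBasis r n q i), div_mul_eq_mul_div,
            Finset.sum_mul]
          congr 1
          exact Finset.sum_congr rfl fun i _ => by ring
      _ = (∑ i : Fin n, x (i : ℕ) * if (i : ℕ) = j then (n : ℝ) else 0) / n := by
          rw [Finset.sum_comm]
          congr 1
          exact Finset.sum_congr rfl fun i _ => by rw [← Finset.mul_sum, h1]
      _ = x j := by
          rw [Finset.sum_eq_single ⟨j, hj⟩]
          · simp [hn']
          · intro b _ hb
            rw [if_neg fun h => hb (Fin.ext h), mul_zero]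
          · simp
  have hq2 : Quasi n ((-1) ^ (r + 1)) fun j : ℤ => ∑ q ∈ Finset.range n,
      ((∑ i ∈ Finset.range n, x i * hartleyBasis r n q i) / n) * hartleyBasis r n q j := by
    intro j
    rw [smul_eq_mul, Finset.mul_sum]
    refine Finset.sum_congr rfl fun q _ => ?_
    rw [hartleyBasis_quasi r hn q j, smul_eq_mul]
    ring
  have hd : Quasi n ((-1) ^ (r + 1)) fun j : ℤ => x j - ∑ q ∈ Finset.range n,
      ((∑ i ∈ Finset.range n, x i * hartleyBasis r n q i) / n) * hartleyBasis r n q j := by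
    intro j
    have h1 := hq2 j
    simp only at h1 ⊢
    rw [h1, hx j, smul_sub]
  obtain ⟨s, -, hs⟩ := quasi_mul hd (neg_one_pow_mul_self (r + 1)) (j / n) (j % n)
  rw [Int.emod_add_mul_ediv] at hs
  have hj0 : 0 ≤ j % n := Int.emod_nonneg _ (by omega)
  have hj1 : j % n < n := Int.emod_lt_of_pos _ (by omega)
  have := hper (j % n).toNat (by omega)
  rw [Int.toNat_of_nonneg hj0] at this
  rw [this] at hs
  rw [sub_self, smul_zero] at hs
  exact sub_eq_zero.1 hs

/-! ### The twist at the trigonometric point -/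

/-- The orthogonal map that shifts the trigonometric moment sequence. -/
def hartleyShift (K n : ℕ) : (Fin K → ℝ) →ₗ[ℝ] (Fin K → ℝ) where
  toFun x p := Real.cos ((2 * (p : ℕ) - (K - 1)) * Real.pi / n) * x p +
    Real.sin ((2 * (p : ℕ) - (K - 1)) * Real.pi / n) * x p.rev
  map_add' x y := by funext p; simp only [Pi.add_apply]; ring
  map_smul' c x := by funext p; simp only [Pi.smul_apply, smul_eq_mul, RingHom.id_apply]; ring

theorem hartleyShift_hartley (K n : ℕ) (j : ℤ) :
    hartleyShift K n (hartley K n j) = hartley K n (j + 1) := by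
  funext p
  simp only [hartleyShift, LinearMap.coe_mk, AddHom.coe_mk, hartley]
  rw [rev_cast_real]
  set φ : ℝ := (2 * (p : ℕ) - (K - 1)) * Real.pi / n with hφ
  have e1 : (2 * ((K : ℝ) - 1 - (p : ℕ)) - (K - 1)) * Real.pi / n * j = -(φ * j) := by rw [hφ]; ring
  have e2 : φ * ((j + 1 : ℤ) : ℝ) = φ * j + φ := by push_cast; ring
  rw [e1, e2, cas, cas, cas, Real.cos_neg, Real.sin_neg, Real.cos_add, Real.sin_add]
  ring

/-- Reversal of coordinates negates the angle, so the map is a rotation in each plane spanned by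
coordinates `p` and `p.rev`. In the sum the cross terms are odd under reversal and cancel. -/
theorem hartleyShift_dot (K n : ℕ) (x y : Fin K → ℝ) :
    hartleyShift K n x ⬝ᵥ hartleyShift K n y = x ⬝ᵥ y := by
  let φ : Fin K → ℝ := fun p => (2 * (p : ℕ) - (K - 1)) * Real.pi / n
  have hφ : ∀ p : Fin K, φ p.rev = -φ p := fun p => by simp only [φ]; rw [rev_cast_real]; ring
  have hrev : ∀ F : Fin K → ℝ, ∑ p : Fin K, F p.rev = ∑ p, F p := fun F =>
    Equiv.sum_comp Fin.revPerm F
  have h1 : ∑ p, Real.sin (φ p) ^ 2 * (x p.rev * y p.rev) = ∑ p, Real.sin (φ p) ^ 2 * (x p * y p) := by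
    rw [← hrev (fun p => Real.sin (φ p) ^ 2 * (x p * y p))]
    refine Finset.sum_congr rfl fun p _ => ?_
    rw [hφ, Real.sin_neg, neg_sq]
  have h2 : ∑ p, Real.cos (φ p) * Real.sin (φ p) * (x p * y p.rev + x p.rev * y p) = 0 := by
    have := hrev (fun p => Real.cos (φ p) * Real.sin (φ p) * (x p * y p.rev + x p.rev * y p))
    simp only [hφ, Real.cos_neg, Real.sin_neg, Fin.rev_rev] at this
    have h3 : ∑ p, Real.cos (φ p) * -Real.sin (φ p) * (x p.rev * y p + x p * y p.rev) =
        -∑ p, Real.cos (φ p) * Real.sin (φ p) * (x p * y p.rev + x p.rev * y p) := by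
      rw [← Finset.sum_neg_distrib]
      exact Finset.sum_congr rfl fun p _ => by ring
    linarith
  calc hartleyShift K n x ⬝ᵥ hartleyShift K n y
      = ∑ p, (Real.cos (φ p) ^ 2 * (x p * y p)) + ∑ p, Real.sin (φ p) ^ 2 * (x p.rev * y p.rev) +
        ∑ p, Real.cos (φ p) * Real.sin (φ p) * (x p * y p.rev + x p.rev * y p) := by
        rw [← Finset.sum_add_distrib, ← Finset.sum_add_distrib]
        refine Finset.sum_congr rfl fun p _ => ?_
        simp only [hartleyShift, LinearMap.coe_mk, AddHom.coe_mk, φ]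
        ring
    _ = x ⬝ᵥ y := by
        rw [h1, h2, add_zero, ← Finset.sum_add_distrib]
        refine Finset.sum_congr rfl fun p _ => ?_
        have := Real.sin_sq_add_cos_sq (φ p)
        linear_combination (x p * y p) * this

theorem hartleyShift_injective (K n : ℕ) : Function.Injective (hartleyShift K n) := by
  rw [injective_iff_map_eq_zero]
  intro x hx
  rw [← dotProduct_self_eq_zero, ← hartleyShift_dot K n, hx, zero_dotProduct]

theorem CycPos.windowsIndep {n K : ℕ} {x : ℤ → Fin K → ℝ} (h : CycPos n x) (hK : K ≤ n) :
    WindowsIndep K x := fun a => (seqMinor_ne_zero_iff x _).1 (h.ne_zero (cycMono_consec hK a))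

theorem seqMinor_altSeq_ne_zero {K : ℕ} {x : ℤ → Fin K → ℝ} {c : Fin K → ℤ} :
    seqMinor (altSeq x) c ≠ 0 ↔ seqMinor x c ≠ 0 := by
  have : seqMinor (altSeq x) c = _ := seqMinor_smul (fun j : ℤ => (-1 : ℝ) ^ j) x c
  rw [this, mul_ne_zero_iff, Finset.prod_ne_zero_iff]
  exact and_iff_right fun p _ => zpow_ne_zero _ (by norm_num)

theorem CycPos.of_linear {n K : ℕ} {x y : ℤ → Fin K → ℝ} (hx : CycPos n x) {A : Matrix (Fin K) (Fin K) ℝ}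
    (hA : A.det ≠ 0) (hy : ∀ j, y j = A *ᵥ x j) : CycPos n y := by
  intro c c' hc hc'
  have : y = fun j => A *ᵥ x j := funext hy
  rw [this, seqMinor_mulVec, seqMinor_mulVec]
  have := mul_pos (mul_self_pos.2 hA) (hx c c' hc hc')
  linarith

/-- A sequence with the shift recurrence of the trigonometric moment sequence is totally positive as
soon as it is nondegenerate. -/
theorem cycPos_of_hartleyShift {K n : ℕ} (hn : 0 < n) (hK : K ≤ n) {y : ℤ → Fin K → ℝ}
    (hy : ∀ j, y (j + 1) = hartleyShift K n (y j))
    (hne : seqMinor y (fun p : Fin K => 0 + (p : ℕ)) ≠ 0) : CycPos n y := by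
  have hpos := hartley_cycPos K n hn
  obtain ⟨β, hβ⟩ := (hpos.windowsIndep hK).exists_coeff (by simp) 0 (y 0)
  -- Being a polynomial in the shift, `B` commutes with it; sending the moment vector at `0` to `y
  -- 0`, it sends the whole moment sequence to `y`.
  let B : (Fin K → ℝ) →ₗ[ℝ] (Fin K → ℝ) := ∑ i ∈ Finset.range K, β i • hartleyShift K n ^ i
  have hpow : ∀ (i : ℕ) (j : ℤ), (hartleyShift K n ^ i) (hartley K n j) = hartley K n (j + i) := by
    intro i
    induction i with
    | zero => intro j; simp
    | succ i ih =>
      intro j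
      rw [pow_succ, Module.End.mul_apply, hartleyShift_hartley, ih]
      congr 1; push_cast; ring
  have hB : ∀ j, B (hartley K n j) = ∑ i ∈ Finset.range K, β i • hartley K n (j + i) := by
    intro j
    simp only [B, LinearMap.sum_apply, LinearMap.smul_apply, hpow]
  have hBshift : ∀ j, B (hartley K n (j + 1)) = hartleyShift K n (B (hartley K n j)) := by
    intro j
    rw [hB, hB, map_sum]
    refine Finset.sum_congr rfl fun i _ => ?_
    rw [map_smul, hartleyShift_hartley]
    congr 2; ring
  have key : ∀ j, y j = B (hartley K n j) := by
    intro j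
    induction j using Int.induction_on with
    | zero => rw [hB, hβ]
    | succ i ih => rw [hy, hBshift, ih]
    | pred i ih =>
      apply hartleyShift_injective K n
      rw [← hy, ← hBshift, sub_add_cancel, ih]
  have key' : ∀ j, y j = LinearMap.toMatrix' B *ᵥ hartley K n j := fun j => by
    rw [key, LinearMap.toMatrix'_mulVec]
  refine hpos.of_linear (A := LinearMap.toMatrix' B) ?_ key'
  intro h0
  apply hne
  have : y = fun j => LinearMap.toMatrix' B *ᵥ hartley K n j := funext key'
  rw [this, seqMinor_mulVec, h0, zero_mul]

/-- The twist of the stacked sequence `(v, w)` consists of totally positive sequences (up to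
alternating signs). -/
def TwistPos (n : ℕ) {k ℓ : ℕ} (v : ℤ → Fin k → ℝ) (w : ℤ → Fin ℓ → ℝ) : Prop :=
  ∀ t, IsDualSeq (k + ℓ) ℓ (stackSeq v w) t → CycPos n (altSeq (topSeq t)) ∧ CycPos n (botSeq t)

theorem IsDualSeq.unique {k ℓ : ℕ} {u t t' : ℤ → Fin k ⊕ Fin ℓ → ℝ} (ht : IsDualSeq (k + ℓ) ℓ u t)
    (ht' : IsDualSeq (k + ℓ) ℓ u t') (hu : WindowsIndep (k + ℓ) u) : t = t' :=
  funext fun j => hu.ext_dot (by simp) fun i hi => (ht j i hi).trans (ht' j i hi).symm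

/-- The rows of `z` are the first `k + m` elements of the orthogonal Hartley basis and those of `w`
are the remaining `ℓ`. Evenness of `m` gives the three sequences the same quasi-period sign. -/
theorem admissible_hartley {k ℓ m n : ℕ} (hn : k + ℓ + m = n) (hm : Even m) (hpos : 0 < n) :
    Admissible k ℓ m n (hartley k n) (hartley (k + m) n) (altSeq (hartley ℓ n)) := by
  have hv : Quasi n ((-1) ^ (k + 1)) (hartley k n) := hartley_quasi hpos
  have hz : Quasi n ((-1) ^ (k + 1)) (hartley (k + m) n) := by
    have := hartley_quasi (K := k + m) hpos
    rwa [show k + m + 1 = k + 1 + m by ring, pow_add, hm.neg_one_pow, mul_one] at this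
  have hw : Quasi n ((-1) ^ (k + 1)) (altSeq (hartley ℓ n)) := by
    have := (hartley_quasi (K := ℓ) hpos).altSeq
    rwa [← pow_add, show n + (ℓ + 1) = k + 1 + m + (ℓ + ℓ) by omega, pow_add, pow_add,
      hm.neg_one_pow, (Even.add_self ℓ).neg_one_pow, mul_one, mul_one] at this
  refine ⟨hv, hz, hw, hartley_cycPos _ _ hpos, fun s a b => ?_, fun y hy => ?_,
    (hartley_cycPos _ _ hpos).cycNonneg, fun a => ⟨fun p => a + (p : ℕ), fun p q h => ?_,
      fun p => ⟨by simp, by have := p.2; simp only; push_cast; omega⟩,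
      (hartley_cycPos _ _ hpos).ne_zero (cycMono_consec (by omega) a)⟩⟩
  · have := sum_hartleyBasis_mul (k + m) hpos (q := a) (q' := (k + m) + b) (by omega) (by omega)
    rw [if_neg (by omega)] at this
    rw [sum_period (f := fun j => hartley (k + m) n j a * altSeq (hartley ℓ n) j b) ?_ s]
    · rw [← this]
      refine Finset.sum_congr rfl fun j _ => ?_
      rw [hartleyBasis_eq_altSeq hpos (by omega)]
      rfl
    · intro j
      have h1 := congrFun (hz j) a
      have h2 := congrFun (hw j) b
      simp only [Pi.smul_apply, smul_eq_mul] at h1 h2 ⊢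
      rw [h1, h2]
      linear_combination (hartley (k + m) n j a * altSeq (hartley ℓ n) j b) *
        neg_one_pow_mul_self (k + 1)
  · have hwin := (hartley_cycPos ℓ n hpos).windowsIndep (by omega)
    refine hwin.ext_dot (by simp) (j := 0) fun i _ => ?_
    have := hy (0 + i)
    rw [altSeq, dotProduct_smul, smul_eq_mul] at this
    rw [(mul_eq_zero.1 this).resolve_left (zpow_ne_zero _ (by norm_num)), zero_dotProduct]
  · have : (p : ℕ) < q := h
    simpa using this

/-- The stacked sequence advances by the orthogonal map `T ⊕ (-T)`, with `T` the shift on each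
factor. The dual vectors therefore advance by its negative `(-T) ⊕ T`, the extra sign coming from
`(-1)^j`. After the alternating signs on top, both halves satisfy the recurrence of the moment
sequence, so nondegeneracy makes them totally positive. -/
theorem twistPos_hartley {k ℓ m n : ℕ} (hn : k + ℓ + m = n) (hm : Even m) [NeZero n] :
    TwistPos n (hartley k n) (altSeq (hartley ℓ n)) := by
  have hpos := NeZero.pos n
  have had := admissible_hartley hn hm hpos
  have hu := had.windowsIndep_stackSeq hn
  intro t ht
  have hshift : ∀ j, topSeq t (j + 1) = -hartleyShift k n (topSeq t j) ∧
      botSeq t (j + 1) = hartleyShift ℓ n (botSeq t j) := by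
    intro j
    have h1 : t (j + 1) =
        Sum.elim (-hartleyShift k n (topSeq t j)) (hartleyShift ℓ n (botSeq t j)) := by
      refine hu.ext_dot (by simp) (j := j + 1 - ℓ) fun i hi => ?_
      rw [ht (j + 1) i hi]
      have h2 := ht j i hi
      have e1 : hartley k n (j + 1 - ℓ + i) = hartleyShift k n (hartley k n (j - ℓ + i)) := by
        rw [hartleyShift_hartley]; congr 1; ring
      have e2 : altSeq (hartley ℓ n) (j + 1 - ℓ + i) =
          -hartleyShift ℓ n (altSeq (hartley ℓ n) (j - ℓ + i)) := by
        rw [altSeq, altSeq, map_smul, hartleyShift_hartley,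
          show j + 1 - (ℓ : ℤ) + i = j - ℓ + i + 1 by ring, zpow_add_one₀ (by norm_num), mul_neg_one,
          neg_smul]
      have h3 : ∀ (x x' : Fin k → ℝ) (y y' : Fin ℓ → ℝ),
          (Sum.elim x y : Fin k ⊕ Fin ℓ → ℝ) ⬝ᵥ Sum.elim x' y' = x ⬝ᵥ x' + y ⬝ᵥ y' := by
        intro x x' y y'
        simp [dotProduct]
      have h4 : t j = Sum.elim (topSeq t j) (botSeq t j) := by
        funext p; rcases p with p | p <;> rfl
      rw [h4, stackSeq, h3] at h2
      rw [stackSeq, h3, e1, e2, neg_dotProduct, dotProduct_neg, hartleyShift_dot, hartleyShift_dot,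
        ← neg_add, h2]
      split_ifs
      · rw [zpow_add_one₀ (by norm_num), mul_neg_one]
      · simp
    exact ⟨funext fun p => congrFun h1 (Sum.inl p), funext fun p => congrFun h1 (Sum.inr p)⟩
  constructor
  · refine cycPos_of_hartleyShift hpos (by omega) (fun j => ?_) (seqMinor_altSeq_ne_zero.2
      (seqMinor_topSeq_ne_zero ht hu (had.windowsIndep_w hn) 0))
    rw [altSeq, altSeq, (hshift j).1, map_smul, zpow_add_one₀ (by norm_num), smul_neg, mul_neg_one,
      neg_smul, neg_neg]
  · exact cycPos_of_hartleyShift hpos (by omega) (fun j => (hshift j).2)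
      (seqMinor_botSeq_ne_zero ht hu ((hartley_cycPos k n hpos).windowsIndep (by omega)) 0)

/-! ### Invariance of positivity of the twist -/

/-- The twist has quasi-period sign `(-1)^(n+k+1)`. Alternating signs cancel `(-1)^n` on top; below,
the sign equals `(-1)^(ℓ+1)` because `n = k + ℓ + m` with `m` even. -/
theorem sign_altSeq_topSeq {k ℓ m n : ℕ} {v : ℤ → Fin k → ℝ} {z : ℤ → Fin (k + m) → ℝ}
    {w : ℤ → Fin ℓ → ℝ} (h : Admissible k ℓ m n v z w) (hn : k + ℓ + m = n) (hm : Even m) [NeZero n]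
    {t : ℤ → Fin k ⊕ Fin ℓ → ℝ} (ht : IsDualSeq (k + ℓ) ℓ (stackSeq v w) t) :
    Quasi n ((-1) ^ (k + 1)) (altSeq (topSeq t)) ∧ Quasi n ((-1) ^ (ℓ + 1)) (botSeq t) := by
  have hq := ht.quasi (h.windowsIndep_stackSeq hn) (by simp) (h.hv.stackSeq h.hw)
    (neg_one_pow_mul_self _)
  refine ⟨?_, ?_⟩
  · have := hq.topSeq.altSeq
    rwa [← mul_assoc, neg_one_pow_mul_self, one_mul] at this
  · have := hq.botSeq
    rwa [← pow_add, show n + (k + 1) = ℓ + 1 + m + (k + k) by omega, pow_add, pow_add,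
      hm.neg_one_pow, (Even.add_self k).neg_one_pow, mul_one, mul_one] at this

theorem continuous_flowSeq {E : Type*} [AddCommGroup E] [Module ℝ E] [TopologicalSpace E]
    [ContinuousAdd E] [ContinuousSMul ℝ E] (d : ℤ) (x : ℤ → E) (j : ℤ) :
    Continuous fun a : ℝ => flowSeq a d x j :=
  continuous_const.add (continuous_id.smul continuous_const)

theorem continuous_neumannSeq {E : Type*} [AddCommGroup E] [Module ℝ E] [TopologicalSpace E]
    [ContinuousAdd E] [ContinuousSMul ℝ E] (n : ℕ) (d : ℤ) (w : ℤ → E) (j : ℤ) :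
    Continuous fun a : ℝ => neumannSeq n a d w j :=
  continuous_finsetSum _ fun i _ => (continuous_neg.pow i).smul continuous_const

theorem tendsto_stackSeq {X : Type*} {k ℓ : ℕ} {l : Filter X} {V : X → ℤ → Fin k → ℝ}
    {W : X → ℤ → Fin ℓ → ℝ} {v : ℤ → Fin k → ℝ} {w : ℤ → Fin ℓ → ℝ}
    (hV : ∀ j, Filter.Tendsto (fun x => V x j) l (nhds (v j)))
    (hW : ∀ j, Filter.Tendsto (fun x => W x j) l (nhds (w j))) (j : ℤ) :
    Filter.Tendsto (fun x => stackSeq (V x) (W x) j) l (nhds (stackSeq v w j)) := by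
  refine tendsto_pi_nhds.2 fun p => ?_
  rcases p with p | p
  · exact (tendsto_pi_nhds.1 (hV j)) p
  · exact (tendsto_pi_nhds.1 (hW j)) p

theorem tendsto_topSeq {X : Type*} {k ℓ : ℕ} {l : Filter X} {T : X → ℤ → Fin k ⊕ Fin ℓ → ℝ}
    {t : ℤ → Fin k ⊕ Fin ℓ → ℝ} (hT : ∀ j, Filter.Tendsto (fun x => T x j) l (nhds (t j))) (j : ℤ) :
    Filter.Tendsto (fun x => altSeq (topSeq (T x)) j) l (nhds (altSeq (topSeq t) j)) :=
  tendsto_pi_nhds.2 fun p => ((tendsto_pi_nhds.1 (hT j)) (Sum.inl p)).const_smul ((-1 : ℝ) ^ j)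

theorem tendsto_botSeq {X : Type*} {k ℓ : ℕ} {l : Filter X} {T : X → ℤ → Fin k ⊕ Fin ℓ → ℝ}
    {t : ℤ → Fin k ⊕ Fin ℓ → ℝ} (hT : ∀ j, Filter.Tendsto (fun x => T x j) l (nhds (t j))) (j : ℤ) :
    Filter.Tendsto (fun x => botSeq (T x) j) l (nhds (botSeq t j)) :=
  tendsto_pi_nhds.2 fun p => (tendsto_pi_nhds.1 (hT j)) (Sum.inr p)

/-- The parameter `b ∈ [0, a]` joins `(v, w)` to its flowed pair through admissible data with `v`
totally positive. Consecutive minors of both halves of the twist stay nonzero along this path, so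
positivity is carried from `b = a` back to `b = 0`. -/
theorem twistPos_of_flow {k ℓ m n : ℕ} {v : ℤ → Fin k → ℝ} {z : ℤ → Fin (k + m) → ℝ}
    {w : ℤ → Fin ℓ → ℝ} (h : Admissible k ℓ m n v z w) (hv : CycPos n v) (hn : k + ℓ + m = n)
    (hm : Even m) [NeZero n] {d : ℤ} (hd : d = 1 ∨ d = -1) {a : ℝ} (ha : 0 ≤ a) (ha1 : a < 1)
    (hT : TwistPos n (flowSeq a d v) (neumannSeq n a d w)) : TwistPos n v w := by
  have had : ∀ b : Set.Icc (0 : ℝ) a, Admissible k ℓ m n (flowSeq b.1 d v) (flowSeq b.1 d z)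
      (neumannSeq n b.1 d w) := fun b => h.flow hn hd b.2.1 (b.2.2.trans_lt ha1)
  have hu := fun b => (had b).windowsIndep_stackSeq hn
  have ht := fun b => isDualSeq_twistSeq (hu b)
  have hcont : ∀ b₀ j, Filter.Tendsto (fun b : Set.Icc (0 : ℝ) a =>
      twistSeq (stackSeq (flowSeq b.1 d v) (neumannSeq n b.1 d w)) j) (nhds b₀)
      (nhds (twistSeq (stackSeq (flowSeq b₀.1 d v) (neumannSeq n b₀.1 d w)) j)) := fun b₀ =>
    tendsto_twistSeq (hu b₀) fun j => tendsto_stackSeq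
      (fun j => ((continuous_flowSeq d v j).comp continuous_subtype_val).tendsto b₀)
      (fun j => ((continuous_neumannSeq n d w j).comp continuous_subtype_val).tendsto b₀) j
  have : PreconnectedSpace (Set.Icc (0 : ℝ) a) :=
    Subtype.preconnectedSpace isPreconnected_Icc
  have hend := hT _ (ht ⟨a, ha, le_rfl⟩)
  have h1 := cycPos_of_preconnected
    (x := fun b : Set.Icc (0 : ℝ) a =>
      altSeq (topSeq (twistSeq (stackSeq (flowSeq b.1 d v) (neumannSeq n b.1 d w)))))
    (fun j => continuous_iff_continuousAt.2 fun b => tendsto_topSeq (hcont b) j)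
    (fun b => (sign_altSeq_topSeq (had b) hn hm (ht b)).1)
    (fun b s => seqMinor_altSeq_ne_zero.2
      (seqMinor_topSeq_ne_zero (ht b) (hu b) ((had b).windowsIndep_w hn) s)) hend.1 ⟨0, le_rfl, ha⟩
  have h2 := cycPos_of_preconnected
    (x := fun b : Set.Icc (0 : ℝ) a =>
      botSeq (twistSeq (stackSeq (flowSeq b.1 d v) (neumannSeq n b.1 d w))))
    (fun j => continuous_iff_continuousAt.2 fun b => tendsto_botSeq (hcont b) j)
    (fun b => (sign_altSeq_topSeq (had b) hn hm (ht b)).2)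
    (fun b s => seqMinor_botSeq_ne_zero (ht b) (hu b)
      ((CycPos.flowSeq h.hv (NeZero.pos n) hv hd b.2.1).windowsIndep (by omega)) s)
      hend.2 ⟨0, le_rfl, ha⟩
  have e1 : flowSeq 0 d v = v := by funext j; simp [flowSeq]
  have e2 : neumannSeq n 0 d w = w := by
    funext j
    rw [neumannSeq, Finset.sum_eq_single 0]
    · simp
    · intro i _ hi; simp [hi]
    · intro h0; exact absurd (Finset.mem_range.2 (NeZero.pos n)) h0
  simp only [e1, e2] at h1 h2
  intro t ht'
  have hu0 := h.windowsIndep_stackSeq hn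
  rw [ht'.unique (isDualSeq_twistSeq hu0) hu0]
  exact ⟨h1, h2⟩

/-- Acting by `g` and `g'` on the two blocks changes the twisted blocks by the inverse transposes,
which scale all minors of a block by one factor. Thus row bases may be changed freely. -/
theorem twistPos_of_mulVec {k ℓ n : ℕ} {v : ℤ → Fin k → ℝ} {w : ℤ → Fin ℓ → ℝ}
    {g : Matrix (Fin k) (Fin k) ℝ} {g' : Matrix (Fin ℓ) (Fin ℓ) ℝ} (hg : g.det ≠ 0) (hg' : g'.det ≠ 0)
    (h : TwistPos n (fun j => g *ᵥ v j) (fun j => g' *ᵥ w j)) : TwistPos n v w := by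
  intro t ht
  have hgg : (g⁻¹)ᵀ.det ≠ 0 := by
    rw [Matrix.det_transpose, Matrix.det_nonsing_inv]; simpa using hg
  have hgg' : (g'⁻¹)ᵀ.det ≠ 0 := by
    rw [Matrix.det_transpose, Matrix.det_nonsing_inv]; simpa using hg'
  have ht' : IsDualSeq (k + ℓ) ℓ (stackSeq (fun j => g *ᵥ v j) (fun j => g' *ᵥ w j))
      (fun j => Sum.elim ((g⁻¹)ᵀ *ᵥ topSeq t j) ((g'⁻¹)ᵀ *ᵥ botSeq t j)) := by
    intro j i hi
    rw [← ht j i hi]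
    have e1 : ∀ {K : ℕ} {A : Matrix (Fin K) (Fin K) ℝ} (_ : A.det ≠ 0) (x y : Fin K → ℝ),
        ((A⁻¹)ᵀ *ᵥ x) ⬝ᵥ (A *ᵥ y) = x ⬝ᵥ y := by
      intro K A hA x y
      rw [Matrix.mulVec_transpose, ← Matrix.dotProduct_mulVec, Matrix.mulVec_mulVec,
        Matrix.nonsing_inv_mul _ (isUnit_iff_ne_zero.2 hA), Matrix.one_mulVec]
    have e2 : ∀ (x x' : Fin k → ℝ) (y y' : Fin ℓ → ℝ),
        (Sum.elim x y : Fin k ⊕ Fin ℓ → ℝ) ⬝ᵥ Sum.elim x' y' = x ⬝ᵥ x' + y ⬝ᵥ y' := by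
      intro x x' y y'
      simp [dotProduct]
    have h4 : t j = Sum.elim (topSeq t j) (botSeq t j) := by
      funext p; rcases p with p | p <;> rfl
    rw [h4, stackSeq, stackSeq, e2, e2, e1 hg, e1 hg']
  obtain ⟨h1, h2⟩ := h _ ht'
  have inv : ∀ {K : ℕ} {A : Matrix (Fin K) (Fin K) ℝ} (_ : A.det ≠ 0) (x : Fin K → ℝ),
      x = Aᵀ *ᵥ ((A⁻¹)ᵀ *ᵥ x) := by
    intro K A hA x
    rw [Matrix.mulVec_mulVec, ← Matrix.transpose_mul,
      Matrix.nonsing_inv_mul _ (isUnit_iff_ne_zero.2 hA), Matrix.transpose_one, Matrix.one_mulVec]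
  refine ⟨h1.of_linear (A := gᵀ) (by rwa [Matrix.det_transpose]) fun j => ?_,
    h2.of_linear (A := g'ᵀ) (by rwa [Matrix.det_transpose]) fun j => inv hg' _⟩
  have : altSeq (topSeq fun j => (Sum.elim ((g⁻¹)ᵀ *ᵥ topSeq t j) ((g'⁻¹)ᵀ *ᵥ botSeq t j) :
      Fin k ⊕ Fin ℓ → ℝ)) j = (-1 : ℝ) ^ j • ((g⁻¹)ᵀ *ᵥ topSeq t j) := rfl
  rw [this, altSeq, Matrix.mulVec_smul, ← inv hg]

theorem Admissible.mulVec {k ℓ m n : ℕ} {v : ℤ → Fin k → ℝ} {z : ℤ → Fin (k + m) → ℝ}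
    {w : ℤ → Fin ℓ → ℝ} (h : Admissible k ℓ m n v z w)
    {g : Matrix (Fin k) (Fin k) ℝ} {g' : Matrix (Fin ℓ) (Fin ℓ) ℝ} (hg : g.det ≠ 0)
    (hg' : g'.det ≠ 0) : Admissible k ℓ m n (fun j => g *ᵥ v j) z (fun j => g' *ᵥ w j) := by
  refine ⟨fun j => ?_, h.hz, fun j => ?_, h.zpos, fun s a b => ?_, fun y hy => ?_, fun c c' hc hc' => ?_,
    fun a => ?_⟩
  · rw [h.hv, Matrix.mulVec_smul]
  · rw [h.hw, Matrix.mulVec_smul]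
  · simp only [Matrix.mulVec, dotProduct, Finset.mul_sum]
    rw [Finset.sum_comm]
    refine Finset.sum_eq_zero fun b' _ => ?_
    rw [Finset.sum_congr rfl fun (i : ℕ) _ => show z (s + i) a * (g' b b' * w (s + i) b') =
      g' b b' * (z (s + i) a * w (s + i) b') by ring, ← Finset.mul_sum, h.orth, mul_zero]
  · have h1 := h.wfull (y ᵥ* g') fun j => by rw [← Matrix.dotProduct_mulVec]; exact hy j
    exact Matrix.eq_zero_of_vecMul_eq_zero hg' h1
  · rw [seqMinor_mulVec, seqMinor_mulVec, mul_mul_mul_comm]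
    exact mul_nonneg (mul_self_nonneg _) (h.vnonneg c c' hc hc')
  · obtain ⟨c, h1, h2, h3⟩ := h.vwin a
    exact ⟨c, h1, h2, by rw [seqMinor_mulVec]; exact mul_ne_zero hg h3⟩

/-! ### Convergence of the flow to the trigonometric point -/

/-- The factor by which the averaging operator `x ↦ 5/4 x + (x(· + 1) + x(· - 1)) / 2` scales the
elements of the Hartley basis. -/
def hartleyEig (r n q : ℕ) : ℝ := 5 / 4 + Real.cos ((2 * q - (r - 1)) * Real.pi / n)

theorem hartleyEig_pos (r n q : ℕ) : 0 < hartleyEig r n q := by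
  have := Real.neg_one_le_cos ((2 * (q : ℝ) - (r - 1)) * Real.pi / n)
  rw [hartleyEig]; linarith

theorem cos_lt_cos_of_abs_lt {n : ℕ} (hn : 0 < n) {s t : ℤ} (h : |s| < |t|) (h2 : |s| + |t| < 2 * n) :
    Real.cos (t * Real.pi / n) < Real.cos (s * Real.pi / n) := by
  have hn' : (0 : ℝ) < n := by positivity
  have hpi := Real.pi_pos
  have e : ∀ u : ℤ, Real.cos (u * Real.pi / n) = Real.cos (|u| * Real.pi / n) := by
    intro u
    rw [← Real.cos_abs, abs_div, abs_mul, abs_of_pos hpi, abs_of_pos hn', Int.cast_abs]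
  rw [e t, e s, ← sub_pos, Real.cos_sub_cos]
  have h' : |(s : ℝ)| < |(t : ℝ)| := by exact_mod_cast h
  have h2' : |(s : ℝ)| + |(t : ℝ)| < 2 * n := by exact_mod_cast h2
  have h0 : (0 : ℝ) ≤ |(s : ℝ)| := abs_nonneg _
  have h1 : 0 < Real.sin ((((|s| : ℤ) : ℝ) * Real.pi / n + ((|t| : ℤ) : ℝ) * Real.pi / n) / 2) := by
    push_cast
    refine Real.sin_pos_of_pos_of_lt_pi (by have : 0 < |(t : ℝ)| := by linarith
                                            positivity) ?_
    rw [← add_div, ← add_mul, div_div, div_lt_iff₀ (by positivity)]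
    nlinarith
  have h3 : Real.sin ((((|s| : ℤ) : ℝ) * Real.pi / n - ((|t| : ℤ) : ℝ) * Real.pi / n) / 2) < 0 := by
    push_cast
    refine Real.sin_neg_of_neg_of_neg_pi_lt ?_ ?_
    · rw [← sub_div, ← sub_mul, div_div]
      exact div_neg_of_neg_of_pos (mul_neg_of_neg_of_pos (by linarith) hpi) (by positivity)
    · rw [← sub_div, ← sub_mul, div_div, lt_div_iff₀ (by positivity)]
      nlinarith
  nlinarith [mul_pos h1 (neg_pos.2 h3)]

/-- The eigenvalue decreases as the frequency moves away from zero. Frequencies are measured in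
units of `π / n`: that of `q` is at most `a - 1` in absolute value, that of `q'` at least `a + 1`
modulo the period `2n`. -/
theorem hartleyEig_lt {r n q q' : ℕ} (hn : 0 < n) (a : ℤ) (h1 : r - a ≤ 2 * q) (h2 : 2 * q ≤ r + a - 2)
    (h3 : 2 * (q' : ℤ) ≤ r - a - 2 ∨ r + a ≤ 2 * (q' : ℤ)) (h4 : 2 * (q' : ℤ) ≤ 2 * n + r - a - 2)
    (h5 : r + a ≤ 2 * (n : ℤ) + 2 * q') : hartleyEig r n q' < hartleyEig r n q := by
  have e1 : |2 * (q : ℤ) - (r - 1)| ≤ a - 1 := abs_le.2 ⟨by omega, by omega⟩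
  have e2 : a + 1 ≤ |2 * (q' : ℤ) - (r - 1)| := le_abs'.2 (by omega)
  have e3 : |2 * (q' : ℤ) - (r - 1)| ≤ 2 * n - a - 1 := abs_le.2 ⟨by omega, by omega⟩
  have := cos_lt_cos_of_abs_lt hn (s := 2 * (q : ℤ) - (r - 1)) (t := 2 * (q' : ℤ) - (r - 1))
    (by omega) (by omega)
  push_cast at this
  rw [hartleyEig, hartleyEig]
  linarith

/-- The sequence with given coefficients in the Hartley basis. -/
def coeffSeq (r n : ℕ) {K : ℕ} (C : Fin K → ℕ → ℝ) (j : ℤ) (p : Fin K) : ℝ :=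
  ∑ q ∈ Finset.range n, C p q * hartleyBasis r n q j

theorem quasi_coeffSeq (r : ℕ) {n : ℕ} (hn : 0 < n) {K : ℕ} (C : Fin K → ℕ → ℝ) :
    Quasi n ((-1) ^ (r + 1)) (coeffSeq r n C) := by
  intro j
  funext p
  rw [Pi.smul_apply, smul_eq_mul, coeffSeq, coeffSeq, Finset.mul_sum]
  refine Finset.sum_congr rfl fun q _ => ?_
  rw [hartleyBasis_quasi r hn q j, smul_eq_mul]
  ring

theorem mulVec_coeffSeq (r n : ℕ) {K : ℕ} (g : Matrix (Fin K) (Fin K) ℝ) (C : Fin K → ℕ → ℝ) (j : ℤ) :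
    g *ᵥ coeffSeq r n C j = coeffSeq r n (fun p q => ∑ p', g p p' * C p' q) j := by
  funext p
  simp only [Matrix.mulVec, dotProduct, coeffSeq, Finset.mul_sum, Finset.sum_mul]
  rw [Finset.sum_comm]
  exact Finset.sum_congr rfl fun q _ => Finset.sum_congr rfl fun p' _ => by ring

theorem hartleyBasis_flow (r n q : ℕ) (j : ℤ) : flowSeq (1 / 2) (-1) (flowSeq (1 / 2) 1
    (hartleyBasis r n q)) j = hartleyEig r n q * hartleyBasis r n q j := by
  simp only [flowSeq, smul_eq_mul, hartleyBasis, hartleyEig]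
  rw [show j + -1 + 1 = j by ring]
  set φ : ℝ := (2 * q - (r - 1)) * Real.pi / n
  rw [show φ * ((j + 1 : ℤ) : ℝ) = φ * j + φ by push_cast; ring,
    show φ * ((j + -1 : ℤ) : ℝ) = φ * j - φ by push_cast; ring]
  simp only [cas, Real.cos_add, Real.sin_add, Real.cos_sub, Real.sin_sub]
  ring

theorem coeffSeq_flow (r n : ℕ) {K : ℕ} (C : Fin K → ℕ → ℝ) :
    flowSeq (1 / 2) (-1) (flowSeq (1 / 2) 1 (coeffSeq r n C)) =
      coeffSeq r n fun p q => hartleyEig r n q * C p q := by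
  funext j p
  have := fun q => hartleyBasis_flow r n q j
  simp only [flowSeq, smul_eq_mul] at this
  simp only [flowSeq, coeffSeq, Pi.add_apply, Pi.smul_apply, smul_eq_mul]
  simp only [Finset.mul_sum, ← Finset.sum_add_distrib]
  refine Finset.sum_congr rfl fun q _ => ?_
  rw [mul_right_comm, ← this]
  ring

section

variable {E : Type*} [AddCommGroup E] [Module ℝ E]

/-- The series in direction `d` undoes the flow in direction `-d`, up to a scalar. Applying both
directions thus inverts the averaging operator, which is diagonal in the Hartley basis. -/
theorem neumannSeq_flowSeq {n : ℕ} {e : ℝ} {w : ℤ → E} (h : Quasi n e w) (he : e * e = 1) (a : ℝ)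
    {d : ℤ} (hd : d = 1 ∨ d = -1) :
    neumannSeq n a d (flowSeq a (-d) w) = (1 - (-a) ^ n * e) • w := by
  funext j
  rw [Pi.smul_apply, ← neumannSeq_add h he a hd, neumannSeq, neumannSeq, neumannSeq, Finset.smul_sum,
    ← Finset.sum_add_distrib]
  refine Finset.sum_congr rfl fun i _ => ?_
  rw [flowSeq, smul_add, smul_comm, show j - d * (i : ℤ) + -d = j - d - d * i by ring]

theorem neumannSeq_smul (n : ℕ) (a : ℝ) (d : ℤ) (c : ℝ) (w : ℤ → E) :
    neumannSeq n a d (c • w) = c • neumannSeq n a d w := by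
  funext j
  rw [Pi.smul_apply, neumannSeq, neumannSeq, Finset.smul_sum]
  exact Finset.sum_congr rfl fun i _ => by rw [Pi.smul_apply, smul_comm]

end

theorem coeffSeq_neumann (r : ℕ) {n : ℕ} (hn : 0 < n) {K : ℕ} (C : Fin K → ℕ → ℝ) :
    neumannSeq n (1 / 2) (-1) (neumannSeq n (1 / 2) 1 (coeffSeq r n C)) =
      coeffSeq r n fun p q =>
        (1 - (-(1 / 2)) ^ n * (-1) ^ (r + 1)) ^ 2 * (hartleyEig r n q)⁻¹ * C p q := by
  have he := neg_one_pow_mul_self (r + 1)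
  have h1 : coeffSeq r n C = flowSeq (1 / 2) (-1) (flowSeq (1 / 2) 1
      (coeffSeq r n fun p q => (hartleyEig r n q)⁻¹ * C p q)) := by
    rw [coeffSeq_flow]
    congr 1
    funext p q
    rw [mul_inv_cancel_left₀ (hartleyEig_pos r n q).ne']
  have hq := quasi_coeffSeq r hn fun (p : Fin K) q => (hartleyEig r n q)⁻¹ * C p q
  rw [h1, neumannSeq_flowSeq (hq.flowSeq _ _) he _ (Or.inl rfl), neumannSeq_smul]
  have h2 := neumannSeq_flowSeq hq he (1 / 2) (d := -1) (Or.inr rfl)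
  rw [neg_neg] at h2
  rw [h2, smul_smul]
  funext j p
  rw [Pi.smul_apply, Pi.smul_apply, smul_eq_mul, coeffSeq, coeffSeq, Finset.mul_sum]
  exact Finset.sum_congr rfl fun q _ => by ring

/-- By Cauchy–Binet this determinant is the sum over `c` of the product of the `c`-minors of `x` and
`y`, and all terms have the same sign. -/
theorem det_pairing_ne_zero {K n : ℕ} (hK : K ≤ n) {x y : ℤ → Fin K → ℝ} (hx : CycPos n x)
    (hy : CycPos n y) :
    (Matrix.of fun p p' : Fin K => ∑ i ∈ Finset.range n, x i p * y i p').det ≠ 0 := by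
  have h := AlternatingMap.cauchyBinet (detRowAlternating : (Fin K → ℝ) [⋀^Fin K]→ₗ[ℝ] ℝ)
    (fun p (i : Fin n) => x (i : ℕ) p) (fun i => y (i : ℕ))
  have e1 : (Matrix.of fun p p' : Fin K => ∑ i ∈ Finset.range n, x i p * y i p').det =
      (detRowAlternating : (Fin K → ℝ) [⋀^Fin K]→ₗ[ℝ] ℝ)
        (fun p => ∑ i : Fin n, x (i : ℕ) p • y (i : ℕ)) := by
    refine congrArg Matrix.det ?_
    ext p p'
    rw [Finset.sum_apply, Matrix.of_apply,
      ← Fin.sum_univ_eq_sum_range (fun i => x i p * y i p')]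
    rfl
  rw [e1, h]
  have hmono : ∀ c : {c : Fin K → Fin n // StrictMono c}, CycMono n fun p => ((c.1 p : ℕ) : ℤ) :=
    fun c => cycMono_of_mem (fun p q hpq => by
      have : ((c.1 p : ℕ)) < c.1 q := c.2 hpq
      simpa using this) 0 fun p => ⟨by omega, by have := (c.1 p).2; omega⟩
  have e2 : ∀ c : {c : Fin K → Fin n // StrictMono c},
      Matrix.det (Matrix.of fun p q => x ((c.1 q : ℕ) : ℤ) p) *
        (detRowAlternating : (Fin K → ℝ) [⋀^Fin K]→ₗ[ℝ] ℝ) (fun p => y ((c.1 p : ℕ) : ℤ)) =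
      seqMinor x (fun p => ((c.1 p : ℕ) : ℤ)) * seqMinor y (fun p => ((c.1 p : ℕ) : ℤ)) := by
    intro c
    congr 1
    rw [← Matrix.det_transpose]
    rfl
  rw [Finset.sum_congr rfl fun c _ => e2 c]
  refine sum_ne_zero_of_pairwise (fun c _ c' _ => ?_)
    (Finset.mem_univ ⟨Fin.castLE hK, Fin.strictMono_castLE hK⟩)
    (mul_ne_zero (hx.ne_zero (hmono _)) (hy.ne_zero (hmono _)))
  rw [mul_mul_mul_comm]
  exact mul_nonneg (hx _ _ (hmono _) (hmono _)).le (hy _ _ (hmono _) (hmono _)).le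

theorem exists_coeffSeq (r : ℕ) {n : ℕ} (hn : 0 < n) {K : ℕ} {x : ℤ → Fin K → ℝ}
    (hx : Quasi n ((-1) ^ (r + 1)) x) : x = coeffSeq r n fun p q =>
      (∑ i ∈ Finset.range n, x i p * hartleyBasis r n q i) / n := by
  funext j p
  exact hartleyBasis_expand r hn (x := fun j => x j p) (fun j => congrFun (hx j) p) j

/-- One round is the flow with `a = 1/2` in both directions. It multiplies the coefficients of `v`
by the eigenvalues and those of `w` by their inverses, up to a constant, so repeated rounds let
different frequencies dominate in `v` and in `w`. -/
theorem Admissible.flow_iterate {k ℓ m n : ℕ} {v : ℤ → Fin k → ℝ} {z : ℤ → Fin (k + m) → ℝ}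
    {w : ℤ → Fin ℓ → ℝ} (h : Admissible k ℓ m n v z w) (hv : CycPos n v) (hn : k + ℓ + m = n)
    (hm : Even m) [NeZero n] {C : Fin k → ℕ → ℝ} {D : Fin ℓ → ℕ → ℝ}
    (hC : v = coeffSeq (k + m) n C) (hD : w = coeffSeq (k + m) n D) (M : ℕ) :
    ∃ v' z' w', Admissible k ℓ m n v' z' w' ∧ CycPos n v' ∧
      v' = (coeffSeq (k + m) n fun p q => hartleyEig (k + m) n q ^ M * C p q) ∧
      w' = (coeffSeq (k + m) n fun b q => ((1 - (-(1 / 2)) ^ n * (-1) ^ (k + m + 1)) ^ 2) ^ M *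
        (hartleyEig (k + m) n q ^ M)⁻¹ * D b q) ∧
      (TwistPos n v' w' → TwistPos n v w) := by
  induction M with
  | zero => exact ⟨v, z, w, h, hv, by simpa using hC, by simpa using hD, id⟩
  | succ M ih =>
    obtain ⟨v', z', w', h1, h2, h3, h4, h5⟩ := ih
    have a1 := h1.flow hn (d := 1) (Or.inl rfl) (a := 1 / 2) (by norm_num) (by norm_num)
    have p1 := CycPos.flowSeq h1.hv (NeZero.pos n) h2 (d := 1) (Or.inl rfl) (a := 1 / 2) (by norm_num)
    have a2 := a1.flow hn (d := -1) (Or.inr rfl) (a := 1 / 2) (by norm_num) (by norm_num)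
    have p2 := CycPos.flowSeq a1.hv (NeZero.pos n) p1 (d := -1) (Or.inr rfl) (a := 1 / 2) (by norm_num)
    refine ⟨_, _, _, a2, p2, ?_, ?_, fun hT => h5 ?_⟩
    · rw [h3, coeffSeq_flow]
      congr 1
      funext p q
      ring
    · rw [h4, coeffSeq_neumann _ (NeZero.pos n)]
      congr 1
      funext p q
      rw [pow_succ (hartleyEig (k + m) n q), mul_inv]
      ring
    · exact twistPos_of_flow h1 h2 hn hm (Or.inl rfl) (by norm_num) (by norm_num)
        (twistPos_of_flow a1 p1 hn hm (Or.inr rfl) (by norm_num) (by norm_num) hT)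

/-- Convergence of normalized coefficient sequences with dominated ratios. -/
theorem tendsto_coeffSeq {r n K : ℕ} {C : Fin K → ℕ → ℝ} {σ : Fin K → ℕ} {μ : ℕ → ℝ}
    (hσ : ∀ p, σ p < n) (hC : ∀ p q, q < n → C p q ≠ 0 → q ≠ σ p → |μ q * (μ (σ p))⁻¹| < 1)
    (hμ : ∀ q, μ q ≠ 0) (h1 : ∀ p, C p (σ p) = 1) (j : ℤ) :
    Filter.Tendsto (fun M : ℕ => coeffSeq r n (fun p q => (μ q * (μ (σ p))⁻¹) ^ M * C p q) j)
      Filter.atTop (nhds fun p => hartleyBasis r n (σ p) j) := by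
  refine tendsto_pi_nhds.2 fun p => ?_
  have e : hartleyBasis r n (σ p) j =
      ∑ q ∈ Finset.range n, (if q = σ p then 1 else 0) * hartleyBasis r n q j := by
    simp [hσ p]
  rw [e]
  refine tendsto_finsetSum _ fun q hq => Filter.Tendsto.mul_const _ ?_
  split_ifs with h
  · subst h
    simp [hμ, h1]
  · by_cases h0 : C p q = 0
    · simp [h0]
    · have := (tendsto_pow_atTop_nhds_zero_of_abs_lt_one
        (hC p q (Finset.mem_range.1 hq) h0 h)).mul_const (C p q)
      rwa [zero_mul] at this

/-- After many rounds, with rows rescaled by `g` and `g'`, the largest eigenvalues dominate in `v`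
and the smallest in `w`. The pair converges to the trigonometric point, where the twist is totally
positive. Positivity is open, so it holds after finitely many rounds and can be transported back
along the flow. -/
theorem twistPos_of_normalized {k ℓ m n : ℕ} {v : ℤ → Fin k → ℝ} {z : ℤ → Fin (k + m) → ℝ}
    {w : ℤ → Fin ℓ → ℝ} (h : Admissible k ℓ m n v z w) (hv : CycPos n v) (hn : k + ℓ + m = n)
    (hm : Even m) [NeZero n] {C : Fin k → ℕ → ℝ} {D : Fin ℓ → ℕ → ℝ}
    (hC : v = coeffSeq (k + m) n C) (hD : w = coeffSeq (k + m) n D)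
    (hC1 : ∀ p p' : Fin k, C p (p' + m / 2) = if p = p' then 1 else 0)
    (hD1 : ∀ b b' : Fin ℓ, D b (k + m + b') = if b = b' then 1 else 0) : TwistPos n v w := by
  have hpos := NeZero.pos n
  set κ : ℝ := (1 - (-(1 / 2)) ^ n * (-1) ^ (k + m + 1)) ^ 2 with hκdef
  have hκ : κ ≠ 0 := pow_ne_zero _
    (neumann_scalar_pos hpos (by norm_num) (by norm_num) (neg_one_pow_mul_self _)).ne'
  set lam := hartleyEig (k + m) n with hlam
  have hlp : ∀ q, 0 < lam q := hartleyEig_pos _ _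
  choose v' z' w' had hvp hv' hw' hT using fun M => h.flow_iterate hv hn hm hC hD M
  let g : ℕ → Matrix (Fin k) (Fin k) ℝ := fun M => Matrix.diagonal fun p => ((lam (p + m / 2)) ^ M)⁻¹
  let g' : ℕ → Matrix (Fin ℓ) (Fin ℓ) ℝ := fun M =>
    Matrix.diagonal fun b => (κ ^ M)⁻¹ * (lam (k + m + b)) ^ M
  have hg : ∀ M, (g M).det ≠ 0 := fun M => by
    rw [Matrix.det_diagonal]
    exact Finset.prod_ne_zero_iff.2 fun p _ => inv_ne_zero (pow_ne_zero _ (hlp _).ne')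
  have hg' : ∀ M, (g' M).det ≠ 0 := fun M => by
    rw [Matrix.det_diagonal]
    exact Finset.prod_ne_zero_iff.2 fun p _ =>
      mul_ne_zero (inv_ne_zero (pow_ne_zero _ hκ)) (pow_ne_zero _ (hlp _).ne')
  have hadm := fun M => (had M).mulVec (hg M) (hg' M)
  have hx : ∀ M, (fun j => g M *ᵥ v' M j) = coeffSeq (k + m) n fun p q =>
      (lam q * (lam (p + m / 2))⁻¹) ^ M * C p q := by
    intro M
    funext j
    rw [hv', mulVec_coeffSeq]
    congr 1
    funext p q
    rw [Finset.sum_eq_single p (fun p' _ hp' => by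
      simp [g, Matrix.diagonal_apply_ne' _ hp']) (by simp)]
    simp only [g, Matrix.diagonal_apply_eq, mul_pow, inv_pow]
    ring
  have hy : ∀ M, (fun j => g' M *ᵥ w' M j) = coeffSeq (k + m) n fun b q =>
      ((lam q)⁻¹ * ((lam (k + m + b))⁻¹)⁻¹) ^ M * D b q := by
    intro M
    funext j
    rw [hw', mulVec_coeffSeq]
    congr 1
    funext b q
    rw [Finset.sum_eq_single b (fun p' _ hp' => by
      simp [g', Matrix.diagonal_apply_ne' _ hp']) (by simp)]
    simp only [g', Matrix.diagonal_apply_eq, mul_pow, inv_pow, inv_inv]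
    have : κ ^ M ≠ 0 := pow_ne_zero _ hκ
    rw [← hκdef, ← hlam]
    have : lam q ≠ 0 := (hlp q).ne'
    field_simp
  have hratio : ∀ {a b : ℝ}, 0 < a → a < b → |a * b⁻¹| < 1 := by
    intro a b ha hab
    have hb := ha.trans hab
    rw [abs_of_pos (mul_pos ha (inv_pos.2 hb)), ← div_eq_mul_inv, div_lt_one hb]
    exact hab
  have limv : ∀ j, Filter.Tendsto (fun M => (fun j => g M *ᵥ v' M j) j) Filter.atTop
      (nhds (hartley k n j)) := by
    intro j
    have := tendsto_coeffSeq (r := k + m) (n := n) (C := C) (σ := fun p => p + m / 2) (μ := lam)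
      (fun p => by omega) (fun p q hq h0 hne => hratio (hlp q) ?_) (fun q => (hlp q).ne')
      (fun p => by simp [hC1]) j
    · simp only [fun M => congrFun (hx M) j]
      rwa [show hartley k n j = fun p : Fin k => hartleyBasis (k + m) n (p + m / 2) j from
        funext fun p => (hartleyBasis_eq_hartley hm j p).symm]
    -- By the normalization, every other nonzero coefficient of `v` lies outside the central band of
    -- `k` frequencies and has a strictly smaller eigenvalue.
    · have hout : q < m / 2 ∨ k + m / 2 ≤ q := by
        by_contra! hcon
        have := hC1 p ⟨q - m / 2, by omega⟩
        rw [if_neg (fun e => hne (by rw [e]; exact (Nat.sub_add_cancel hcon.1).symm))] at this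
        apply h0
        rw [← this]
        congr 1
        simp only
        omega
      have := p.2
      have := Nat.two_mul_div_two_of_even hm
      refine hartleyEig_lt hpos k ?_ ?_ ?_ ?_ ?_ <;> push_cast <;> omega
  have limw : ∀ j, Filter.Tendsto (fun M => (fun j => g' M *ᵥ w' M j) j) Filter.atTop
      (nhds (altSeq (hartley ℓ n) j)) := by
    intro j
    have := tendsto_coeffSeq (r := k + m) (n := n) (C := D) (σ := fun b => k + m + b)
      (μ := fun q => (lam q)⁻¹)
      (fun p => by omega) (fun b q hq h0 hne => ?_) (fun q => (inv_pos.2 (hlp q)).ne')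
      (fun p => by simp [hD1]) j
    · simp only [fun M => congrFun (hy M) j]
      rwa [show altSeq (hartley ℓ n) j = fun b : Fin ℓ => hartleyBasis (k + m) n (k + m + b) j from
        funext fun b => (hartleyBasis_eq_altSeq hpos (by omega) j b).symm]
    -- For `w` the other nonzero coefficients belong to the first `k + m` frequencies; their
    -- eigenvalues are larger, so the inverse eigenvalues are smaller.
    · have hout : q < k + m := by
        by_contra! hcon
        have := hD1 b ⟨q - (k + m), by omega⟩
        rw [if_neg (fun e => hne (by rw [e]; exact (Nat.add_sub_cancel' hcon).symm))] at this
        apply h0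
        rw [← this]
        congr 1
        simp only
        omega
      rw [inv_inv, mul_comm]
      have := b.2
      refine hratio (hlp _) (hartleyEig_lt hpos (k + m : ℕ) ?_ ?_ ?_ ?_ ?_) <;> push_cast <;> omega
  have hbase := admissible_hartley hn hm hpos
  have hub := hbase.windowsIndep_stackSeq hn
  have htb := twistPos_hartley hn hm _ (isDualSeq_twistSeq hub)
  have hu := fun M => (hadm M).windowsIndep_stackSeq hn
  have ht := fun M => isDualSeq_twistSeq (hu M)
  have hlim := tendsto_twistSeq hub (tendsto_stackSeq limv limw)
  have ev1 := eventually_cycPos hpos (tendsto_topSeq hlim)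
    (fun M => (sign_altSeq_topSeq (hadm M) hn hm (ht M)).1) htb.1
  have ev2 := eventually_cycPos hpos (tendsto_botSeq hlim)
    (fun M => (sign_altSeq_topSeq (hadm M) hn hm (ht M)).2) htb.2
  obtain ⟨M, hM1, hM2⟩ := (ev1.and ev2).exists
  refine hT M (twistPos_of_mulVec (hg M) (hg' M) fun t hdual => ?_)
  rw [hdual.unique (ht M) (hu M)]
  exact ⟨hM1, hM2⟩

/-- The twist preserves total positivity. -/
theorem Admissible.twistPos {k ℓ m n : ℕ} {v : ℤ → Fin k → ℝ} {z : ℤ → Fin (k + m) → ℝ}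
    {w : ℤ → Fin ℓ → ℝ} (h : Admissible k ℓ m n v z w) (hv : CycPos n v) (hn : k + ℓ + m = n)
    (hm : Even m) [NeZero n] : TwistPos n v w := by
  have hpos := NeZero.pos n
  have hn' : (n : ℝ) ≠ 0 := by positivity
  have hsign : ((-1 : ℝ) ^ (k + 1)) = (-1) ^ (k + m + 1) := by
    rw [show k + m + 1 = k + 1 + m by ring, pow_add (-1 : ℝ) (k + 1) m, hm.neg_one_pow, mul_one]
  have hvc := exists_coeffSeq (k + m) hpos (hsign ▸ h.hv)
  have hwc := exists_coeffSeq (k + m) hpos (hsign ▸ h.hw)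
  set C : Fin k → ℕ → ℝ := fun p q => (∑ i ∈ Finset.range n, v i p * hartleyBasis (k + m) n q i) / n
  set D : Fin ℓ → ℕ → ℝ := fun p q => (∑ i ∈ Finset.range n, w i p * hartleyBasis (k + m) n q i) / n
  let P : Matrix (Fin k) (Fin k) ℝ := Matrix.of fun p p' => C p (p' + m / 2)
  let Q : Matrix (Fin ℓ) (Fin ℓ) ℝ := Matrix.of fun b b' => D b (k + m + b')
  -- Up to a scalar `P` is the pairing of `v` with the moment sequence in `ℝᵏ`, both totally
  -- positive.
  have hP : P.det ≠ 0 := by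
    have h1 := det_pairing_ne_zero (by omega) hv (hartley_cycPos k n hpos)
    have h2 : P = (n : ℝ)⁻¹ •
        (Matrix.of fun p p' : Fin k => ∑ i ∈ Finset.range n, v i p * hartley k n i p') := by
      ext p p'
      simp only [P, C, Matrix.of_apply, Matrix.smul_apply, smul_eq_mul]
      rw [div_eq_inv_mul]
      congr 1
      exact Finset.sum_congr rfl fun i _ => by rw [hartleyBasis_eq_hartley hm]
    rw [h2, Matrix.det_smul]
    exact mul_ne_zero (pow_ne_zero _ (inv_ne_zero hn')) h1
  -- A vector `y` in the left kernel of `Q` makes `y · w` a combination of the first `k + m` basis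
  -- elements. It is orthogonal to `z`, and `z` pairs nondegenerately with the span of those
  -- elements, so `y · w = 0`.
  have hQ : Q.det ≠ 0 := by
    intro h0
    obtain ⟨y, hy0, hy⟩ := Matrix.exists_vecMul_eq_zero_iff.2 h0
    apply hy0
    apply h.wfull
    have hN := det_pairing_ne_zero (by omega) (hartley_cycPos (k + m) n hpos) h.zpos
    let δ : ℕ → ℝ := fun q => ∑ b, y b * D b q
    have hδ : ∀ q, k + m ≤ q → q < n → δ q = 0 := by
      intro q hq hq'
      have := congrFun hy ⟨q - (k + m), by omega⟩
      simp only [Matrix.vecMul, dotProduct, Q, Matrix.of_apply, Pi.zero_apply] at this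
      rwa [Nat.add_sub_cancel' hq] at this
    have hγ : ∀ j, y ⬝ᵥ w j = ∑ q ∈ Finset.range (k + m), δ q * hartleyBasis (k + m) n q j := by
      intro j
      have h1 : y ⬝ᵥ w j = ∑ q ∈ Finset.range n, δ q * hartleyBasis (k + m) n q j := by
        conv_lhs => rw [hwc]
        simp only [dotProduct, coeffSeq, δ, Finset.mul_sum, Finset.sum_mul]
        rw [Finset.sum_comm]
        exact Finset.sum_congr rfl fun q _ => Finset.sum_congr rfl fun b _ => by ring
      rw [h1]
      symm
      refine Finset.sum_subset (Finset.range_subset_range.2 (by omega)) fun q hq hq' => ?_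
      rw [Finset.mem_range] at hq hq'
      rw [hδ q (by omega) hq, zero_mul]
    have hδ0 : (fun q : Fin (k + m) => δ q) = 0 := by
      refine Matrix.eq_zero_of_vecMul_eq_zero hN ?_
      funext a
      simp only [Matrix.vecMul, dotProduct, Matrix.of_apply, Pi.zero_apply, Finset.mul_sum]
      rw [Finset.sum_comm]
      calc ∑ j ∈ Finset.range n, ∑ q : Fin (k + m), δ q * (hartley (k + m) n j q * z j a)
          = ∑ j ∈ Finset.range n, (y ⬝ᵥ w j) * z j a := by
            refine Finset.sum_congr rfl fun j _ => ?_
            rw [hγ, Finset.sum_mul,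
              ← Fin.sum_univ_eq_sum_range (fun q => δ q * hartleyBasis (k + m) n q j * z j a)]
            exact Finset.sum_congr rfl fun q _ => by rw [mul_assoc]; rfl
        _ = 0 := by
            simp only [dotProduct, Finset.sum_mul]
            rw [Finset.sum_comm]
            refine Finset.sum_eq_zero fun b _ => ?_
            have := h.orth 0 a b
            simp only [zero_add] at this
            rw [Finset.sum_congr rfl fun (j : ℕ) _ => show y b * w j b * z j a =
              y b * (z j a * w j b) by ring, ← Finset.mul_sum, this, mul_zero]
    intro j
    rw [hγ]
    refine Finset.sum_eq_zero fun q hq => ?_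
    rw [show δ q = 0 from congrFun hδ0 ⟨q, Finset.mem_range.1 hq⟩, zero_mul]
  have hPi : P⁻¹.det ≠ 0 := by rw [Matrix.det_nonsing_inv]; simpa using hP
  have hQi : Q⁻¹.det ≠ 0 := by rw [Matrix.det_nonsing_inv]; simpa using hQ
  have hnorm : ∀ {K : ℕ} {A : Matrix (Fin K) (Fin K) ℝ} (_ : A.det ≠ 0) (p p' : Fin K),
      ∑ p'', A⁻¹ p p'' * A p'' p' = if p = p' then 1 else 0 := by
    intro K A hA p p'
    rw [← Matrix.mul_apply, Matrix.nonsing_inv_mul _ (isUnit_iff_ne_zero.2 hA), Matrix.one_apply]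
  refine twistPos_of_mulVec hPi hQi (twistPos_of_normalized (h.mulVec hPi hQi)
    (hv.of_linear hPi fun _ => rfl) hn hm
    (C := fun p q => ∑ p', P⁻¹ p p' * C p' q) (D := fun p q => ∑ p', Q⁻¹ p p' * D p' q)
    ?_ ?_ (hnorm hP) (hnorm hQ))
  · funext j
    rw [← mulVec_coeffSeq, ← hvc]
  · funext j
    rw [← mulVec_coeffSeq, ← hwc]

/-! ### The twist of a totally nonnegative sequence -/

theorem continuous_flow_iterate {k : ℕ} (d : ℤ) (x : ℤ → Fin k → ℝ) (L : ℕ) (j : ℤ) :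
    Continuous fun a : ℝ => (flowSeq a d)^[L] x j := by
  induction L generalizing j with
  | zero => exact continuous_const
  | succ L ih =>
    simp only [Function.iterate_succ_apply', flowSeq]
    exact (ih j).add (continuous_id.smul (ih (j + d)))

theorem flow_zero_iterate {k : ℕ} (d : ℤ) (x : ℤ → Fin k → ℝ) (L : ℕ) :
    (flowSeq 0 d)^[L] x = x := by
  have : flowSeq (0 : ℝ) d x = x := by funext j; simp [flowSeq]
  exact Function.iterate_fixed this L

/-- For `a > 0` the flow applied `2 * n` times to `v` alone is totally positive, with `z` and `w`
unchanged, and it tends to `v` as `a → 0⁺`. In the limit both halves are weakly positive. The top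
half is strictly positive because the nonvanishing of its consecutive minors depends only on `w` and
on the independence of the stacked windows. -/
theorem Admissible.twist {k ℓ m n : ℕ} {v : ℤ → Fin k → ℝ} {z : ℤ → Fin (k + m) → ℝ}
    {w : ℤ → Fin ℓ → ℝ} (h : Admissible k ℓ m n v z w) (hn : k + ℓ + m = n) (hm : Even m) [NeZero n]
    {t : ℤ → Fin k ⊕ Fin ℓ → ℝ} (ht : IsDualSeq (k + ℓ) ℓ (stackSeq v w) t) :
    CycPos n (altSeq (topSeq t)) ∧ CycNonneg n (botSeq t) := by
  have hu := h.windowsIndep_stackSeq hn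
  obtain ⟨c₀, hc1, hc2, hc3⟩ := h.vwin 0
  have hc₀ : CycMono n c₀ := cycMono_of_mem hc1 0 fun p => by
    have := hc2 p
    push_cast at this
    omega
  let V : ℝ → ℤ → Fin k → ℝ := fun a => (flowSeq a 1)^[2 * n] v
  have hpos : ∀ a : ℝ, 0 < a → CycPos n (V a) := fun a ha =>
    cycPos_flow_iterate (by omega) h.hv h.vnonneg hc₀ hc3 ha
  have hadm : ∀ a : ℝ, 0 < a → Admissible k ℓ m n (V a) z w := fun a ha =>
    ⟨quasi_flow_iterate h.hv _ _ _, h.hz, h.hw, h.zpos, h.orth, h.wfull, (hpos a ha).cycNonneg,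
      fun s => ⟨fun p => s + (p : ℕ), fun p q hpq => by
        have : (p : ℕ) < q := hpq
        simpa using this, fun p => ⟨by simp, by have := p.2; simp only; push_cast; omega⟩,
        (hpos a ha).ne_zero (cycMono_consec (by omega) s)⟩⟩
  have hlimV : ∀ j, Filter.Tendsto (fun a => V a j) (nhdsWithin 0 (Set.Ioi 0)) (nhds (v j)) := by
    intro j
    have := (continuous_flow_iterate 1 v (2 * n) j).tendsto 0
    rw [flow_zero_iterate] at this
    exact this.mono_left nhdsWithin_le_nhds
  have hlim := tendsto_twistSeq hu (tendsto_stackSeq hlimV fun j => tendsto_const_nhds)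
  have htw : ∀ a : ℝ, 0 < a → _ := fun a ha => (hadm a ha).twistPos (hpos a ha) hn hm _
    (isDualSeq_twistSeq ((hadm a ha).windowsIndep_stackSeq hn))
  have e := ht.unique (isDualSeq_twistSeq hu) hu
  obtain ⟨q1, -⟩ := sign_altSeq_topSeq h hn hm ht
  constructor
  · refine CycNonneg.cycPos q1 ?_ fun s => seqMinor_altSeq_ne_zero.2
      (seqMinor_topSeq_ne_zero ht hu (h.windowsIndep_w hn) s)
    rw [e]
    refine cycNonneg_of_tendsto (tendsto_topSeq hlim) ?_
    filter_upwards [self_mem_nhdsWithin] with a ha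
    exact (htw a ha).1.cycNonneg
  · rw [e]
    refine cycNonneg_of_tendsto (tendsto_botSeq hlim) ?_
    filter_upwards [self_mem_nhdsWithin] with a ha
    exact (htw a ha).2.cycNonneg

/-! ### The Gale order in terms of counting -/

theorem exists_cyclicEnum {n k : ℕ} [NeZero n] (a : ℤ) {S : Finset (Fin n)} (hS : S.card = k) :
    ∃ s : Fin k → Fin n, StrictMono (fun p => cyclicPos n a (s p)) ∧ Set.range s = S := by
  have hinj := cyclicPos_injective (n := n) a
  have hcard : (S.image (cyclicPos n a)).card = k := by
    rw [Finset.card_image_of_injective _ hinj, hS]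
  have hmem : ∀ p, ∃ e ∈ S, cyclicPos n a e = (S.image (cyclicPos n a)).orderEmbOfFin hcard p :=
    fun p => Finset.mem_image.1 (Finset.orderEmbOfFin_mem _ hcard p)
  choose s hsS hs using hmem
  refine ⟨s, ?_, ?_⟩
  · simp only [hs]
    exact OrderEmbedding.strictMono _
  · ext e
    constructor
    · rintro ⟨p, rfl⟩
      exact hsS p
    · intro he
      have : cyclicPos n a e ∈ Set.range ((S.image (cyclicPos n a)).orderEmbOfFin hcard) := by
        rw [Finset.range_orderEmbOfFin]
        exact Finset.mem_coe.2 (Finset.mem_image_of_mem _ he)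
      obtain ⟨p, hp⟩ := this
      exact ⟨p, hinj ((hs p).trans hp)⟩

theorem card_filter_eq_card_enum {n k : ℕ} [NeZero n] {a : ℤ} {S : Finset (Fin n)} {s : Fin k → Fin n}
    (hs : StrictMono (fun p => cyclicPos n a (s p))) (hS : Set.range s = S) (σ : ℤ) :
    (S.filter (cyclicPos n a · < σ)).card =
      (Finset.univ.filter fun p => cyclicPos n a (s p) < σ).card := by
  have hinj : Function.Injective s := fun p q h => hs.injective (by simp [h])
  have : S.filter (cyclicPos n a · < σ) =
      (Finset.univ.filter fun p => cyclicPos n a (s p) < σ).image s := by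
    ext e
    have h1 : e ∈ S ↔ e ∈ Set.range s := by rw [hS]; exact Iff.rfl
    simp only [Finset.mem_filter, h1, Finset.mem_image, Finset.mem_univ, true_and]
    constructor
    · rintro ⟨⟨p, rfl⟩, h⟩
      exact ⟨p, h, rfl⟩
    · rintro ⟨p, h, rfl⟩
      exact ⟨⟨p, rfl⟩, h⟩
  rw [this, Finset.card_image_of_injective _ hinj]

/-- One sorted list is termwise below another exactly when it has at least as many elements below
every threshold. Counts are the form in which ranks can be compared. -/
theorem galeLE_iff {n k : ℕ} [NeZero n] (a : ℤ) {S T : Finset (Fin n)} (hS : S.card = k)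
    (hT : T.card = k) : galeLE k n a (S : Set (Fin n)) (T : Set (Fin n)) ↔
      ∀ s : ℕ, s ≤ n → (T.filter (cyclicPos n a · < s)).card ≤ (S.filter (cyclicPos n a · < s)).card := by
  constructor
  · rintro ⟨s, t, hs, ht, hsS, htT, hle⟩ σ -
    rw [card_filter_eq_card_enum hs hsS, card_filter_eq_card_enum ht htT]
    exact Finset.card_le_card fun p hp => by
      simp only [Finset.mem_filter, Finset.mem_univ, true_and] at hp ⊢
      exact (hle p).trans_lt hp
  · intro h
    obtain ⟨s, hs, hsS⟩ := exists_cyclicEnum a hS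
    obtain ⟨t, ht, htT⟩ := exists_cyclicEnum a hT
    refine ⟨s, t, hs, ht, hsS, htT, fun p => ?_⟩
    by_contra! hlt
    have h0 := cyclicPos_nonneg a (t p)
    have h0' := cyclicPos_lt a (t p)
    have h1 := h (cyclicPos n a (t p) + 1).toNat (by omega)
    rw [Int.toNat_of_nonneg (by omega), card_filter_eq_card_enum hs hsS,
      card_filter_eq_card_enum ht htT] at h1
    have h2 : (p : ℕ) + 1 ≤
        (Finset.univ.filter fun q => cyclicPos n a (t q) < cyclicPos n a (t p) + 1).card := by
      rw [← Fin.card_Iic p]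
      exact Finset.card_le_card fun q hq => by
        simp only [Finset.mem_filter, Finset.mem_univ, true_and]
        have := ht.monotone (Finset.mem_Iic.1 hq)
        omega
    have h3 : (Finset.univ.filter fun q => cyclicPos n a (s q) < cyclicPos n a (t p) + 1).card ≤ p := by
      rw [← Fin.card_Iio p]
      exact Finset.card_le_card fun q hq => by
        simp only [Finset.mem_filter, Finset.mem_univ, true_and] at hq
        rw [Finset.mem_Iio]
        have h4 : cyclicPos n a (s q) < cyclicPos n a (s p) := by omega
        exact hs.lt_iff_lt.1 h4
    omega

/-! ### Necklaces -/

/-- The number of elements of `{f j + k | j < a, f j + k ≥ a}` that are less than `a + s`. -/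
def necklaceCount (k : ℕ) (f : Equiv.Perm ℤ) (a : ℤ) (s : ℕ) : ℕ :=
  ((Finset.Ico a (a + s)).filter fun b => f.symm (b - k) < a).card

/-- The necklace as a finite set. -/
def necklaceFinset (k n : ℕ) [NeZero n] (f : Equiv.Perm ℤ) (a : ℤ) : Finset (Fin n) :=
  ((Finset.Ico a (a + n)).filter fun b => f.symm (b - k) < a).image (residue n)

theorem affinePerms_symm_add {n : ℕ} {f : Equiv.Perm ℤ} (hf : f ∈ affinePerms n) (b : ℤ) :
    f.symm (b + n) = f.symm b + n := by
  rw [Equiv.symm_apply_eq, hf.1, Equiv.apply_symm_apply]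

theorem symm_bounds {n a b : ℕ} {f : Equiv.Perm ℤ} (hf : f ∈ boundedAffinePerms n a b) (i : ℤ) :
    i - b ≤ f.symm i ∧ f.symm i ≤ i + a := by
  have := hf.2 (f.symm i)
  rw [Equiv.apply_symm_apply] at this
  omega

theorem residue_injOn {n : ℕ} [NeZero n] (a : ℤ) : Set.InjOn (residue n) (Set.Ico a (a + n)) := by
  intro i hi j hj h
  have h1 := cyclicPos_residue (n := n) a i
  have h2 := cyclicPos_residue (n := n) a j
  rw [h, h2] at h1
  rw [Set.mem_Ico] at hi hj
  rw [Int.emod_eq_of_lt (by omega) (by omega), Int.emod_eq_of_lt (by omega) (by omega)] at h1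
  omega

theorem coe_necklaceFinset {n k : ℕ} [NeZero n] {f : Equiv.Perm ℤ} (hk : k ≤ n)
    (hf : f ∈ boundedAffinePerms n k (n - k)) (a : ℤ) :
    (necklaceFinset k n f a : Set (Fin n)) = necklace k n f a := by
  ext e
  simp only [necklaceFinset, necklace, Finset.coe_image, Set.mem_image, Finset.coe_filter,
    Set.mem_ofPred_eq, Finset.mem_Ico]
  constructor
  · rintro ⟨b, ⟨⟨h1, h2⟩, h3⟩, rfl⟩
    exact ⟨f.symm (b - k), h3, by simpa using h1, by simp⟩
  · rintro ⟨j, h1, h2, rfl⟩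
    have := (hf.2 j).2
    refine ⟨f j + k, ⟨⟨h2, by omega⟩, by simpa using h1⟩, rfl⟩

theorem card_filter_necklaceFinset {n k : ℕ} [NeZero n] (f : Equiv.Perm ℤ) (a : ℤ) {s : ℕ}
    (hs : s ≤ n) : ((necklaceFinset k n f a).filter (cyclicPos n a · < s)).card =
      necklaceCount k f a s := by
  have hpos : ∀ b ∈ Finset.Ico a (a + n), cyclicPos n a (residue n b) = b - a := by
    intro b hb
    rw [Finset.mem_Ico] at hb
    rw [cyclicPos_residue, Int.emod_eq_of_lt (by omega) (by omega)]
  rw [necklaceFinset, Finset.filter_image, Finset.card_image_of_injOn, necklaceCount]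
  · congr 1
    ext b
    simp only [Finset.mem_filter, Finset.mem_Ico]
    constructor
    · rintro ⟨⟨⟨h1, h2⟩, h3⟩, h4⟩
      rw [hpos b (Finset.mem_Ico.2 ⟨h1, h2⟩)] at h4
      exact ⟨⟨h1, by omega⟩, h3⟩
    · rintro ⟨⟨h1, h2⟩, h3⟩
      have hb : b ∈ Finset.Ico a (a + n) := Finset.mem_Ico.2 ⟨h1, by omega⟩
      exact ⟨⟨⟨h1, (Finset.mem_Ico.1 hb).2⟩, h3⟩, by rw [hpos b hb]; omega⟩
  · refine (residue_injOn a).mono fun b hb => ?_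
    simp only [Finset.coe_filter, Finset.mem_filter, Finset.mem_Ico, Set.mem_ofPred_eq] at hb
    exact hb.1.1

theorem card_necklaceFinset {n k : ℕ} [NeZero n] (f : Equiv.Perm ℤ) (a : ℤ) :
    (necklaceFinset k n f a).card = necklaceCount k f a n := by
  rw [← card_filter_necklaceFinset f a le_rfl, Finset.filter_true_of_mem]
  exact fun e _ => cyclicPos_lt a e

theorem necklaceCount_add {n k : ℕ} {f : Equiv.Perm ℤ} (hf : f ∈ affinePerms n) (a : ℤ) (s : ℕ) :
    necklaceCount k f (a + n) s = necklaceCount k f a s := by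
  symm
  refine Finset.card_bij (fun b _ => b + n) (fun b hb => ?_) (fun _ _ _ _ h => by simpa using h)
    fun b hb => ?_
  · simp only [Finset.mem_filter, Finset.mem_Ico] at hb ⊢
    rw [show b + (n : ℤ) - k = b - k + n by ring, affinePerms_symm_add hf]
    omega
  · simp only [Finset.mem_filter, Finset.mem_Ico] at hb
    refine ⟨b - n, ?_, by ring⟩
    simp only [Finset.mem_filter, Finset.mem_Ico]
    have := affinePerms_symm_add hf (b - n - k)
    rw [show b - (n : ℤ) - k + n = b - k by ring] at this
    omega

theorem periodic_reduce {α : Type*} {n : ℕ} [NeZero n] {F : ℤ → α} (hF : ∀ a, F (a + n) = F a) (a : ℤ) :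
    ∃ i : ℤ, 1 ≤ i ∧ i ≤ n ∧ F i = F a ∧ ∃ t, a = i + n * t := by
  have hn : (0 : ℤ) < n := by exact_mod_cast NeZero.pos n
  have h : ∀ t i : ℤ, F (i + n * t) = F i := by
    intro t
    induction t using Int.induction_on with
    | zero => simp
    | succ t ih => intro i; rw [mul_add, mul_one, ← add_assoc, hF, ih]
    | pred t ih => intro i; rw [← ih i, ← hF]; congr 1; ring
  have h1 := Int.emod_add_mul_ediv (a - 1) n
  have h2 := Int.emod_nonneg (a - 1) hn.ne'
  have h3 := Int.emod_lt_of_pos (a - 1) hn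
  refine ⟨(a - 1) % n + 1, by omega, by omega, ?_, (a - 1) / n, by linarith⟩
  rw [← h ((a - 1) / n)]
  congr 1
  linarith

theorem cyclicPos_add {n : ℕ} (a : ℤ) : cyclicPos n (a + n) = cyclicPos n a := by
  funext e
  rw [cyclicPos, cyclicPos, show (e : ℤ) + 1 - (a + n) = e + 1 - a + n * (-1) by ring,
    Int.add_mul_emod_self_left]

theorem mem_positroid_iff {n k : ℕ} [NeZero n] {f : Equiv.Perm ℤ} (hk : k ≤ n)
    (hf : f ∈ boundedAffinePerms n k (n - k)) (hfull : ∀ a, necklaceCount k f a n = k)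
    {J : Finset (Fin n)} (hJ : J.card = k) : J ∈ positroid k n f ↔
      ∀ (a : ℤ) (s : ℕ), s ≤ n → (J.filter (cyclicPos n a · < s)).card ≤ necklaceCount k f a s := by
  have key : ∀ a, galeLE k n a (necklace k n f a) (J : Set (Fin n)) ↔
      ∀ s : ℕ, s ≤ n → (J.filter (cyclicPos n a · < s)).card ≤ necklaceCount k f a s := by
    intro a
    rw [← coe_necklaceFinset hk hf, galeLE_iff a ((card_necklaceFinset f a).trans (hfull a)) hJ]
    exact forall₂_congr fun s hs => by rw [card_filter_necklaceFinset f a hs]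
  constructor
  · rintro ⟨-, h⟩ a s hs
    obtain ⟨i, h1, h2, h3, -⟩ := periodic_reduce (n := n)
      (F := fun a => (cyclicPos n a, necklaceCount k f a s))
      (fun a => by rw [cyclicPos_add, necklaceCount_add hf.1]) a
    have h4 := (key i).1 (h i h1 h2) s hs
    rw [Prod.mk.injEq] at h3
    rwa [h3.1, h3.2] at h4
  · exact fun h => ⟨hJ, fun i _ _ => (key i).2 (h i)⟩

/-- Take `a ≤ a' ≤ a + n`. If the interval `[a', a' + s)` stays below `a + n`, the elements of `I_a`
in it already belong to `I_{a'}`. Otherwise the complements are compared: an element of `I_{a'}`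
past the interval, lowered by `n`, lies in `I_a`. Both sets have `k` elements, so the count inside
follows. -/
theorem necklaceFinset_mem_positroid {n k : ℕ} [NeZero n] {f : Equiv.Perm ℤ} (hk : k ≤ n)
    (hf : f ∈ boundedAffinePerms n k (n - k)) (hfull : ∀ a, necklaceCount k f a n = k) (a : ℤ) :
    necklaceFinset k n f a ∈ positroid k n f := by
  have hn : (0 : ℤ) < n := by exact_mod_cast NeZero.pos n
  rw [mem_positroid_iff hk hf hfull ((card_necklaceFinset f a).trans (hfull a))]
  suffices h : ∀ (a' : ℤ), a ≤ a' → a' ≤ a + n → ∀ s : ℕ, s ≤ n →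
      ((necklaceFinset k n f a).filter (cyclicPos n a' · < s)).card ≤ necklaceCount k f a' s by
    intro a' s hs
    obtain ⟨i, h1, h2, h3, -⟩ := periodic_reduce (n := n)
      (F := fun b => (cyclicPos n (a + b), necklaceCount k f (a + b) s))
      (fun b => by rw [← add_assoc, cyclicPos_add, necklaceCount_add hf.1]) (a' - a)
    rw [Prod.mk.injEq, add_sub_cancel] at h3
    have := h (a + i) (by omega) (by omega) s hs
    rwa [h3.1, h3.2] at this
  intro a' h1 h2 s hs
  have hposI : ∀ b, a ≤ b → b < a + n → cyclicPos n a' (residue n b) =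
      if a' ≤ b then b - a' else b + n - a' := by
    intro b hb1 hb2
    rw [cyclicPos_residue]
    split_ifs with h
    · rw [Int.emod_eq_of_lt (by omega) (by omega)]
    · rw [← Int.add_mul_emod_self_left (b - a') n 1, Int.emod_eq_of_lt (by omega) (by omega)]
      ring
  have hinj := residue_injOn (n := n) a
  by_cases hcase : a' + s ≤ a + n
  · rw [← card_filter_necklaceFinset f a' hs]
    refine Finset.card_le_card fun e he => ?_
    simp only [necklaceFinset, Finset.mem_filter, Finset.mem_image, Finset.mem_Ico] at he ⊢
    obtain ⟨⟨b, ⟨⟨hb1, hb2⟩, hb3⟩, rfl⟩, hb4⟩ := he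
    have hb5 := hb4
    rw [hposI b hb1 hb2] at hb5
    refine ⟨⟨b, ⟨⟨?_, ?_⟩, ?_⟩, rfl⟩, hb4⟩
    · split_ifs at hb5 with h <;> omega
    · omega
    · omega
  · have c1 : (necklaceFinset k n f a).card = k := (card_necklaceFinset f a).trans (hfull a)
    have c2 : (necklaceFinset k n f a').card = k := (card_necklaceFinset f a').trans (hfull a')
    rw [← card_filter_necklaceFinset f a' hs]
    have d1 := Finset.card_filter_add_card_filter_not (s := necklaceFinset k n f a)
      (cyclicPos n a' · < s)
    have d2 := Finset.card_filter_add_card_filter_not (s := necklaceFinset k n f a')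
      (cyclicPos n a' · < s)
    suffices h : ((necklaceFinset k n f a').filter fun e => ¬ cyclicPos n a' e < s).card ≤
        ((necklaceFinset k n f a).filter fun e => ¬ cyclicPos n a' e < s).card by omega
    refine Finset.card_le_card fun e he => ?_
    simp only [necklaceFinset, Finset.mem_filter, Finset.mem_image, Finset.mem_Ico] at he ⊢
    obtain ⟨⟨b, ⟨⟨hb1, hb2⟩, hb3⟩, rfl⟩, hb4⟩ := he
    refine ⟨⟨b - n, ⟨⟨?_, ?_⟩, ?_⟩, ?_⟩, hb4⟩
    · rw [cyclicPos_residue, Int.emod_eq_of_lt (by omega) (by omega)] at hb4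
      omega
    · omega
    · have := affinePerms_symm_add hf.1 (b - n - k)
      rw [show b - (n : ℤ) - k + n = b - k by ring] at this
      omega
    · rw [residue_eq_iff]
      exact ⟨-1, by ring⟩

/-! ### Ranks and positroids -/

theorem card_le_intervalRank {n k : ℕ} [NeZero n] {e : ℝ} {x : ℤ → Fin k → ℝ} (h : Quasi n e x)
    (he : e * e = 1) {J : Finset (Fin n)} (hJ : LinearIndepOn ℝ (onPeriod n x) (J : Set (Fin n)))
    (a : ℤ) {s : ℕ} (hs : s ≤ n) : (J.filter (cyclicPos n a · < s)).card ≤ intervalRank x a s := by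
  rw [intervalRank_eq h he a hs]
  have h1 : LinearIndepOn ℝ (onPeriod n x) ((J.filter (cyclicPos n a · < s) : Finset (Fin n)) :
      Set (Fin n)) := hJ.mono (Finset.coe_subset.2 (Finset.filter_subset _ _))
  have h2 := finrank_span_eq_card h1
  replace h2 := h2.trans (Fintype.card_coe _)
  rw [← h2]
  refine Submodule.finrank_mono (Submodule.span_mono ?_)
  rintro _ ⟨⟨i, hi⟩, rfl⟩
  exact ⟨i, (Finset.mem_filter.1 hi).2, rfl⟩

theorem exists_basis_intervalRank {n k : ℕ} [NeZero n] {e : ℝ} {x : ℤ → Fin k → ℝ} (h : Quasi n e x)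
    (he : e * e = 1) (hspan : Submodule.span ℝ (Set.range (onPeriod n x)) = ⊤)
    (a : ℤ) {s : ℕ} (hs : s ≤ n) : ∃ J : Finset (Fin n), J.card = k ∧
      LinearIndepOn ℝ (onPeriod n x) (J : Set (Fin n)) ∧
      intervalRank x a s ≤ (J.filter (cyclicPos n a · < s)).card := by
  classical
  obtain ⟨b₁, hb1, -, hb3, hb4⟩ := exists_linearIndepOn_extension (K := ℝ) (v := onPeriod n x)
    (linearIndepOn_empty _ _) (Set.empty_subset {e | cyclicPos n a e < s})
  obtain ⟨b, -, hb6, hb7, hb8⟩ := exists_linearIndepOn_extension hb4 (Set.subset_univ b₁)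
  have hfin : ∀ (c : Set (Fin n)), LinearIndepOn ℝ (onPeriod n x) c →
      Module.finrank ℝ (Submodule.span ℝ (onPeriod n x '' c)) = c.toFinset.card := by
    intro c hc
    have := finrank_span_eq_card hc
    rw [Set.toFinset_card, ← this, Set.image_eq_range]
  refine ⟨b.toFinset, ?_, by simpa using hb8, ?_⟩
  · rw [← hfin b hb8]
    have : Submodule.span ℝ (onPeriod n x '' b) = ⊤ := by
      rw [eq_top_iff, ← hspan, Submodule.span_le, ← Set.image_univ]
      exact hb7
    rw [this]
    simp
  · rw [intervalRank_eq h he a hs]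
    refine (Submodule.finrank_mono (Submodule.span_le.2 hb3)).trans ?_
    rw [hfin b₁ hb4]
    refine Finset.card_le_card fun i hi => ?_
    rw [Set.mem_toFinset] at hi
    exact Finset.mem_filter.2 ⟨Set.mem_toFinset.2 (hb6 hi), hb1 hi⟩

/-- If the bases of a sequence form the positroid of `f`, its interval ranks are given by `f`. -/
theorem intervalRank_eq_necklaceCount {n k : ℕ} [NeZero n] {e : ℝ} {x : ℤ → Fin k → ℝ}
    (h : Quasi n e x) (he : e * e = 1) (hspan : Submodule.span ℝ (Set.range (onPeriod n x)) = ⊤)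
    {f : Equiv.Perm ℤ} (hk : k ≤ n) (hf : f ∈ boundedAffinePerms n k (n - k))
    (hfull : ∀ a, necklaceCount k f a n = k)
    (hJ : ∀ J : Finset (Fin n), J.card = k →
      (LinearIndepOn ℝ (onPeriod n x) (J : Set (Fin n)) ↔ J ∈ positroid k n f))
    (a : ℤ) {s : ℕ} (hs : s ≤ n) : intervalRank x a s = necklaceCount k f a s := by
  -- A basis meeting the interval in as many elements as its rank gives the upper bound. The
  -- necklace term `I_a`, itself a basis, gives the lower bound.
  apply le_antisymm
  · obtain ⟨J, h1, h2, h3⟩ := exists_basis_intervalRank h he hspan a hs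
    exact h3.trans ((mem_positroid_iff hk hf hfull h1).1 ((hJ J h1).1 h2) a s hs)
  · have h1 : (necklaceFinset k n f a).card = k := (card_necklaceFinset f a).trans (hfull a)
    rw [← card_filter_necklaceFinset f a hs]
    exact card_le_intervalRank h he
      ((hJ _ h1).2 (necklaceFinset_mem_positroid hk hf hfull a)) a hs

/-- If the interval ranks of a totally nonnegative sequence are given by `f`, its bases form the
positroid of `f`. -/
theorem linearIndepOn_iff_mem_positroid {n k : ℕ} [NeZero n] {e : ℝ} {x : ℤ → Fin k → ℝ}
    (h : Quasi n e x) (he : e * e = 1) (hNN : CycNonneg n x)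
    (hspan : Submodule.span ℝ (Set.range x) = ⊤)
    {f : Equiv.Perm ℤ} (hk : k ≤ n) (hf : f ∈ boundedAffinePerms n k (n - k))
    (hfull : ∀ a, necklaceCount k f a n = k)
    (hr : ∀ (a : ℤ) (s : ℕ), s ≤ n → intervalRank x a s = necklaceCount k f a s)
    {J : Finset (Fin n)} (hJ : J.card = k) :
    LinearIndepOn ℝ (onPeriod n x) (J : Set (Fin n)) ↔ J ∈ positroid k n f := by
  rw [mem_positroid_iff hk hf hfull hJ]
  constructor
  · intro hi a s hs
    rw [← hr a s hs]
    exact card_le_intervalRank h he hi a hs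
  · intro hle
    by_contra hdep
    obtain ⟨a, s, hs, hlt⟩ := exists_intervalRank_lt h he hNN hspan hJ hdep
    have := hle a s hs
    rw [← hr a s hs] at this
    omega

/-- The increment from `s` to `s + 1` tells whether `f⁻¹(b - k) < a` for `b = a + s`. For `b`
outside `[a, a + n)` the bounds on `f` decide this, and knowing it for all `a` determines `f⁻¹`. -/
theorem eq_of_necklaceCount_eq {n k : ℕ} {f g : Equiv.Perm ℤ} (hk : k ≤ n)
    (hf : f ∈ boundedAffinePerms n k (n - k)) (hg : g ∈ boundedAffinePerms n k (n - k))
    (h : ∀ (a : ℤ) (s : ℕ), s ≤ n → necklaceCount k f a s = necklaceCount k g a s) : f = g := by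
  have hsucc : ∀ (f : Equiv.Perm ℤ) (a : ℤ) (s : ℕ), necklaceCount k f a (s + 1) =
      necklaceCount k f a s + if f.symm (a + s - k) < a then 1 else 0 := by
    intro f a s
    rw [necklaceCount, necklaceCount, show a + ((s + 1 : ℕ) : ℤ) = a + s + 1 by push_cast; ring,
      ← Finset.insert_Ico_right_eq_Ico_add_one (by omega : a ≤ a + s), Finset.filter_insert]
    split_ifs with hlt
    · rw [Finset.card_insert_of_notMem (by simp)]
    · rw [add_zero]
  have hlt : ∀ b a, f.symm (b - k) < a ↔ g.symm (b - k) < a := by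
    intro b a
    have h1 := symm_bounds hf (b - k)
    have h2 := symm_bounds hg (b - k)
    by_cases hb1 : b < a
    · exact iff_of_true (by omega) (by omega)
    · by_cases hb2 : a + n ≤ b
      · exact iff_of_false (by omega) (by omega)
      · have h3 := h a (b - a).toNat (by omega)
        have h4 := h a ((b - a).toNat + 1) (by omega)
        rw [hsucc, hsucc, h3, show a + ((b - a).toNat : ℤ) - k = b - k by omega] at h4
        split_ifs at h4 <;> omega
  have heq : f.symm = g.symm := by
    ext b
    have h1 := hlt (b + k)
    rw [add_sub_cancel_right] at h1
    have h2 := (h1 (f.symm b + 1)).1 (by omega)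
    have h3 := (h1 (g.symm b + 1)).2 (by omega)
    omega
  exact Equiv.symm_bijective.injective heq

theorem card_filter_window {n k ℓ : ℕ} {f : Equiv.Perm ℤ} (hf : f ∈ boundedAffinePerms n k ℓ)
    {N : ℕ} (hN : k + ℓ ≤ N) (a : ℤ) : necklaceCount k f a N = necklaceCount k f a (k + ℓ) := by
  rw [necklaceCount, necklaceCount]
  congr 1
  ext b
  simp only [Finset.mem_filter, Finset.mem_Ico]
  have := symm_bounds hf (b - k)
  omega

/-- The counting functions of `f` and `f⁻¹`. -/
theorem necklaceCount_inv {n k ℓ : ℕ} {f : Equiv.Perm ℤ} (hf : f ∈ boundedAffinePerms n k ℓ)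
    (hfull : ∀ a, necklaceCount k f a (k + ℓ) = k) (a : ℤ) {s : ℕ} (hs : s ≤ k + ℓ) :
    necklaceCount ℓ f⁻¹ a s + k = s + necklaceCount k f (a + s - ℓ) (k + ℓ - s) := by
  set A : ℤ := a + s - ℓ with hA
  -- the elements of the necklace at `A` that are at least `a + k`
  set X := (Finset.Ico (a + k) (A + (k + ℓ : ℕ))).filter fun b => f.symm (b - k) < A with hX
  have h1 : necklaceCount k f A (k + ℓ) = necklaceCount k f A (k + ℓ - s) + X.card := by
    rw [necklaceCount, necklaceCount, ← Finset.card_union_of_disjoint]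
    · congr 1
      ext b
      simp only [X, Finset.mem_filter, Finset.mem_Ico, Finset.mem_union]
      omega
    · refine Finset.disjoint_left.2 fun b hb hb' => ?_
      simp only [X, Finset.mem_filter, Finset.mem_Ico] at hb hb'
      omega
  have h2 : necklaceCount ℓ f⁻¹ a s + X.card = s := by
    have e1 := Finset.card_filter_add_card_filter_not (s := Finset.Ico a (a + s))
      (fun b => f (b - ℓ) < a)
    rw [Int.card_Ico, add_sub_cancel_left, Int.toNat_natCast] at e1
    have e2 : necklaceCount ℓ f⁻¹ a s = ((Finset.Ico a (a + s)).filter fun b => f (b - ℓ) < a).card := rfl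
    -- The map `b ↦ f(b - ℓ) + k` matches the elements not counted for `f⁻¹` with the necklace
    -- elements of `f` at `A` beyond `a + k`; the bounds on `f` ensure that both intervals capture
    -- all of them.
    have e3 : X.card = ((Finset.Ico a (a + s)).filter fun b => ¬ f (b - ℓ) < a).card := by
      symm
      refine Finset.card_bij (fun b _ => f (b - ℓ) + k) (fun b hb => ?_) (fun b _ b' _ hbb => ?_)
        fun b hb => ?_
      · simp only [X, Finset.mem_filter, Finset.mem_Ico] at hb ⊢
        have := hf.2 (b - ℓ)
        rw [add_sub_cancel_right, Equiv.symm_apply_apply]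
        omega
      · have := f.injective (add_right_cancel hbb)
        linarith
      · simp only [X, Finset.mem_filter, Finset.mem_Ico] at hb
        have := symm_bounds hf (b - k)
        refine ⟨f.symm (b - k) + ℓ, ?_, by simp⟩
        simp only [Finset.mem_filter, Finset.mem_Ico, add_sub_cancel_right, Equiv.apply_symm_apply]
        omega
    omega
  have := hfull A
  omega

theorem sum_Icc_eq {n : ℕ} (F : ℤ → ℤ) : ∑ i ∈ Finset.Icc (1 : ℤ) n, F i = ∑ e : Fin n, F ((e : ℕ) + 1) := by
  symm
  refine Finset.sum_bij (fun e _ => ((e : ℕ) : ℤ) + 1) (fun e _ => ?_) (fun e _ e' _ h => ?_)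
    (fun b hb => ?_) fun e _ => rfl
  · have := e.2
    rw [Finset.mem_Icc]; omega
  · exact Fin.ext (by omega)
  · rw [Finset.mem_Icc] at hb
    exact ⟨⟨(b - 1).toNat, by omega⟩, Finset.mem_univ _, by simp only; omega⟩

/-- The displacement `f j - j` depends only on `j` modulo `n`, and `f⁻¹` permutes the residues. So
the displacements of `f⁻¹` over a period are the negatives of those of `f`, reordered. -/
theorem inv_mem_boundedAffinePerms {n a b : ℕ} [NeZero n] {f : Equiv.Perm ℤ}
    (hf : f ∈ boundedAffinePerms n a b) : f⁻¹ ∈ boundedAffinePerms n b a := by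
  refine ⟨⟨fun i => affinePerms_symm_add hf.1 i, ?_⟩, fun i => symm_bounds hf i⟩
  have hper : ∀ j t : ℤ, f (j + n * t) - (j + n * t) = f j - j := by
    intro j t
    induction t using Int.induction_on with
    | zero => simp
    | succ t ih =>
      rw [← ih, mul_add, mul_one, ← add_assoc, hf.1.1]; ring
    | pred t ih =>
      rw [← ih]
      have := hf.1.1 (j + n * (-t - 1))
      rw [show j + (n : ℤ) * (-t - 1) + n = j + n * -t by ring] at this
      rw [this]; ring
  let σ : Fin n → Fin n := fun e => residue n (f.symm ((e : ℕ) + 1))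
  have hσ : Function.Injective σ := by
    intro e e' h
    obtain ⟨t, ht⟩ := (residue_eq_iff _ _).1 h
    have h1 := hper (f.symm ((e' : ℕ) + 1)) t
    rw [← ht, Equiv.apply_symm_apply, Equiv.apply_symm_apply, ht] at h1
    have h2 : ((e : ℕ) : ℤ) = (e' : ℕ) + n * t := by linarith
    have h3 : residue n (((e : ℕ) : ℤ) + 1) = residue n ((e' : ℕ) + 1) :=
      (residue_eq_iff _ _).2 ⟨t, by linarith⟩
    rwa [residue_add_one, residue_add_one] at h3
  have hσb := Finite.injective_iff_bijective.1 hσ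
  have h0 := hf.1.2
  rw [sum_Icc_eq (fun i => f i - i)] at h0
  rw [sum_Icc_eq (fun i => f⁻¹ i - i), ← neg_eq_zero, ← Finset.sum_neg_distrib, ← h0,
    ← hσb.sum_comp (fun e : Fin n => f ((e : ℕ) + 1) - ((e : ℕ) + 1))]
  refine Finset.sum_congr rfl fun e _ => ?_
  obtain ⟨t, ht⟩ := (residue_eq_iff (n := n) (f.symm ((e : ℕ) + 1)) ((σ e : ℕ) + 1)).1
    (residue_add_one _).symm
  have h1 := hper ((σ e : ℕ) + 1) t
  rw [← ht, Equiv.apply_symm_apply] at h1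
  change -(f.symm ((e : ℕ) + 1) - ((e : ℕ) + 1)) = _
  linarith

/-! ### Complementary minors -/

/-- By Cauchy–Binet the Gram determinant is the sum of the squares of the maximal minors. Were all
of them zero, some `v ≠ 0` would satisfy `∑ (v · yᵢ)² = 0`. -/
theorem exists_seqMinor_ne_zero {n q : ℕ} {y : Fin n → Fin q → ℝ}
    (hy : ∀ v : Fin q → ℝ, (∀ e, v ⬝ᵥ y e = 0) → v = 0) :
    ∃ c : Fin q → Fin n, StrictMono c ∧ seqMinor y c ≠ 0 := by
  by_contra! hcon
  have h := AlternatingMap.cauchyBinet (detRowAlternating : (Fin q → ℝ) [⋀^Fin q]→ₗ[ℝ] ℝ)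
    (fun p (i : Fin n) => y i p) y
  rw [Finset.sum_eq_zero fun c _ => by
    rw [← seqMinor_def y, hcon c.1 c.2, mul_zero]] at h
  have hdet : (Matrix.of fun p p' : Fin q => ∑ i, y i p * y i p').det = 0 := by
    refine Eq.trans (congrArg Matrix.det ?_) h
    ext p p'
    exact (Finset.sum_apply p' Finset.univ fun i => y i p • y i).symm
  obtain ⟨v, hv0, hv⟩ := Matrix.exists_vecMul_eq_zero_iff.2 hdet
  refine hv0 (hy v ?_)
  have h1 : ∑ i, (v ⬝ᵥ y i) * (v ⬝ᵥ y i) = 0 := by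
    calc ∑ i, (v ⬝ᵥ y i) * (v ⬝ᵥ y i)
        = ∑ p', (∑ p, v p * ∑ i, y i p * y i p') * v p' := by
          simp only [dotProduct, Finset.mul_sum, Finset.sum_mul]
          rw [Finset.sum_comm]
          refine Finset.sum_congr rfl fun p' _ => ?_
          rw [Finset.sum_comm]
          exact Finset.sum_congr rfl fun p _ => Finset.sum_congr rfl fun i _ => by ring
      _ = 0 := Finset.sum_eq_zero fun p' _ => by
          have := congrFun hv p'
          simp only [Matrix.vecMul, dotProduct, Matrix.of_apply, Pi.zero_apply] at this
          rw [this, zero_mul]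
  intro e
  have h2 := (Finset.sum_eq_zero_iff_of_nonneg fun i _ => mul_self_nonneg (v ⬝ᵥ y i)).1 h1 e
    (Finset.mem_univ e)
  exact mul_self_eq_zero.1 h2

section Complement

variable {n k q : ℕ} {α : Fin n → Fin k → ℝ} {y : Fin n → Fin q → ℝ}

theorem seqMinor_update_self {ι : Type*} (x : ι → Fin k → ℝ) (d : Fin k → ι) (r : Fin k) (e : ι) :
    seqMinor x (Function.update d r e) =
      (detRowAlternating : (Fin k → ℝ) [⋀^Fin k]→ₗ[ℝ] ℝ)
        (Function.update (fun p => x (d p)) r (x e)) := by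
  rw [seqMinor_def]
  congr 1
  funext p
  by_cases h : p = r
  · subst h; simp
  · simp [h]

theorem seqMinor_eq_zero_of_not_injective {ι : Type*} (x : ι → Fin k → ℝ) {d : Fin k → ι}
    (hd : ¬ Function.Injective d) : seqMinor x d = 0 := by
  rw [seqMinor_def]
  exact AlternatingMap.map_eq_zero_of_not_injective _ _ fun h => hd fun a b hab =>
    h (show x (d a) = x (d b) by rw [hab])

/-- With the other rows fixed, the minor is a linear functional of `α e`. As a function of `e` it
therefore lies in the row span of `α`, which is orthogonal to `y`. -/
theorem sum_seqMinor_update_smul (horth : ∀ a b, ∑ e, α e a * y e b = 0) (d : Fin k → Fin n)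
    (r : Fin k) : ∑ e, seqMinor α (Function.update d r e) • y e = 0 := by
  let L : (Fin k → ℝ) →ₗ[ℝ] ℝ :=
    (detRowAlternating : (Fin k → ℝ) [⋀^Fin k]→ₗ[ℝ] ℝ).toMultilinearMap.toLinearMap
      (fun p => α (d p)) r
  have hL : ∀ e, seqMinor α (Function.update d r e) = ∑ p, α e p * L (Pi.single p 1) := by
    intro e
    rw [seqMinor_update_self]
    change L (α e) = _
    conv_lhs => rw [← Finset.univ_sum_single (α e)]
    rw [map_sum]
    refine Finset.sum_congr rfl fun p _ => ?_
    rw [← smul_eq_mul, ← map_smul]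
    congr 1
    ext i
    by_cases hi : i = p
    · subst hi; simp
    · simp [hi]
  funext b
  rw [Finset.sum_apply]
  simp only [Pi.smul_apply, smul_eq_mul, hL, Pi.zero_apply, Finset.sum_mul]
  rw [Finset.sum_comm]
  refine Finset.sum_eq_zero fun p _ => ?_
  rw [Finset.sum_congr rfl fun e _ => show α e p * L (Pi.single p 1) * y e b =
    L (Pi.single p 1) * (α e p * y e b) by ring, ← Finset.mul_sum, horth, mul_zero]

/-- Moving one column to the left by one step preserves the sign of a minor of the complement. -/
theorem exists_pos_seqMinor_update (hkq : k + q = n) (horth : ∀ a b, ∑ e, α e a * y e b = 0)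
    (hα : ∀ d d' : Fin k → Fin n, StrictMono d → StrictMono d' →
      0 < seqMinor (fun e : Fin n => (-1 : ℝ) ^ (e : ℕ) • α e) d *
        seqMinor (fun e : Fin n => (-1 : ℝ) ^ (e : ℕ) • α e) d')
    {c : Fin q → Fin n} (hc : StrictMono c) (p : Fin q) {x' : Fin n} (hx' : (x' : ℕ) + 1 = c p)
    (hx'c : ∀ p', c p' ≠ x') :
    ∃ ρ : ℝ, 0 < ρ ∧ seqMinor y c = ρ * seqMinor y (Function.update c p x') := by
  classical
  have hcard : (Finset.univ \ Finset.univ.image c).card = k := by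
    rw [Finset.card_sdiff_of_subset (Finset.subset_univ _), Finset.card_image_of_injective _ hc.injective,
      Finset.card_fin, Finset.card_fin]
    omega
  set d := (Finset.univ \ Finset.univ.image c).orderEmbOfFin hcard with hd
  have hdmono : StrictMono d := OrderEmbedding.strictMono _
  have hrange : ∀ e, (∃ r, d r = e) ↔ ∀ p', c p' ≠ e := by
    intro e
    have h1 := Finset.range_orderEmbOfFin (Finset.univ \ Finset.univ.image c) hcard
    have h2 : e ∈ Set.range d ↔ e ∈ Finset.univ \ Finset.univ.image c := by
      rw [hd, h1]; exact Iff.rfl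
    simpa using h2
  obtain ⟨r, hr⟩ := (hrange x').2 hx'c
  set x := c p with hx
  have hd' : StrictMono (Function.update d r x) := by
    intro i j hij
    by_cases hj : j = r
    · subst hj
      rw [Function.update_self, Function.update_of_ne hij.ne]
      have h1 : d i < d j := hdmono hij
      rw [hr, Fin.lt_def] at h1
      rw [Fin.lt_def]; omega
    · rw [Function.update_of_ne hj]
      by_cases hi : i = r
      · subst hi
        rw [Function.update_self]
        have h1 : d i < d j := hdmono hij
        have h2 : x ≠ d j := (hrange (d j)).1 ⟨j, rfl⟩ p
        rw [hr, Fin.lt_def] at h1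
        rw [Fin.lt_def]
        have h3 : (x : ℕ) ≠ d j := fun h => h2 (Fin.ext h)
        omega
      · rw [Function.update_of_ne hi]
        exact hdmono hij
  -- the signs of the two minors of `α`
  have hsign : seqMinor α d * seqMinor α (Function.update d r x) < 0 := by
    have h1 := hα d _ hdmono hd'
    rw [seqMinor_smul (fun e : Fin n => (-1 : ℝ) ^ (e : ℕ)) α,
      seqMinor_smul (fun e : Fin n => (-1 : ℝ) ^ (e : ℕ)) α] at h1
    have h2 : (∏ i, (-1 : ℝ) ^ ((d i : Fin n) : ℕ)) * ∏ i, (-1 : ℝ) ^ (Function.update d r x i : ℕ) = -1 := by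
      rw [← Finset.prod_mul_distrib, Finset.prod_eq_single r]
      · rw [Function.update_self, hr, ← hx', pow_succ]
        linear_combination -neg_one_pow_mul_self (x' : ℕ)
      · intro i _ hi
        rw [Function.update_of_ne hi, neg_one_pow_mul_self]
      · simp
    have h3 : (∏ i, (-1 : ℝ) ^ ((d i : Fin n) : ℕ)) * seqMinor α d *
        ((∏ i, (-1 : ℝ) ^ (Function.update d r x i : ℕ)) * seqMinor α (Function.update d r x)) =
        -(seqMinor α d * seqMinor α (Function.update d r x)) := by
      linear_combination seqMinor α d * seqMinor α (Function.update d r x) * h2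
    rw [h3] at h1
    linarith
  -- the relation between the two minors of `y`
  have hrel : seqMinor α (Function.update d r x) * seqMinor y c +
      seqMinor α d * seqMinor y (Function.update c p x') = 0 := by
    let L : (Fin q → ℝ) →ₗ[ℝ] ℝ :=
      (detRowAlternating : (Fin q → ℝ) [⋀^Fin q]→ₗ[ℝ] ℝ).toMultilinearMap.toLinearMap
        (fun p' => y (c p')) p
    have hL : ∀ e, L (y e) = seqMinor y (Function.update c p e) := fun e =>
      (seqMinor_update_self y c p e).symm
    have h0 := congrArg L (sum_seqMinor_update_smul horth d r)
    rw [map_zero, map_sum] at h0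
    simp only [map_smul, hL, smul_eq_mul] at h0
    have hne : x ≠ x' := hx'c p
    -- Every label lies in `c` or in its complement `d`. A label of `c` other than `x` repeats in
    -- the minor of `y`, and a label of `d` other than `x'` repeats in the minor of `α`, so two
    -- terms remain.
    rw [Finset.sum_eq_add x x' hne] at h0
    · rw [show Function.update c p x = c from Function.update_eq_self p c,
        show Function.update d r x' = d by rw [← hr]; exact Function.update_eq_self r d] at h0
      exact h0
    · intro e _ he
      by_cases hec : ∃ p', c p' = e
      · obtain ⟨p', rfl⟩ := hec
        rw [seqMinor_eq_zero_of_not_injective y, mul_zero]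
        intro hinj
        have hpp : p' ≠ p := fun h => he.1 (by rw [h])
        exact hpp (hinj (by simp [hpp]))
      · have hed : ∀ p', c p' ≠ e := fun p' h => hec ⟨p', h⟩
        obtain ⟨r', rfl⟩ := (hrange e).2 hed
        rw [seqMinor_eq_zero_of_not_injective α, zero_mul]
        intro hinj
        have hrr : r' ≠ r := fun h => he.2 (by rw [h, hr])
        exact hrr (hinj (by simp [hrr]))
    · simp
    · simp
  have hne : seqMinor α (Function.update d r x) ≠ 0 := fun h => by simp [h] at hsign
  refine ⟨-(seqMinor α d * seqMinor α (Function.update d r x)) /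
    (seqMinor α (Function.update d r x) * seqMinor α (Function.update d r x)),
    div_pos (by linarith) (mul_self_pos.2 hne), ?_⟩
  field_simp
  linarith

/-- The maximal minors of a matrix whose rows annihilate a matrix with minors of alternating signs
all have the same sign. -/
theorem seqMinor_mul_pos_of_annihilator (hkq : k + q = n) (horth : ∀ a b, ∑ e, α e a * y e b = 0)
    (hα : ∀ d d' : Fin k → Fin n, StrictMono d → StrictMono d' →
      0 < seqMinor (fun e : Fin n => (-1 : ℝ) ^ (e : ℕ) • α e) d *
        seqMinor (fun e : Fin n => (-1 : ℝ) ^ (e : ℕ) • α e) d')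
    (hy : ∀ v : Fin q → ℝ, (∀ e, v ⬝ᵥ y e = 0) → v = 0)
    {c c' : Fin q → Fin n} (hc : StrictMono c) (hc' : StrictMono c') :
    0 < seqMinor y c * seqMinor y c' := by
  have hq : q ≤ n := by omega
  -- Every minor is compared with the one on the initial segment. The first index not in its lowest
  -- position moves left by one, which decreases the sum of the indices and preserves the sign.
  have main : ∀ (N : ℕ) (c : Fin q → Fin n), StrictMono c → ∑ p, (c p : ℕ) = N →
      ∃ ρ : ℝ, 0 < ρ ∧ seqMinor y c = ρ * seqMinor y (Fin.castLE hq) := by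
    intro N
    induction N using Nat.strong_induction_on with
    | _ N ih =>
      intro c hc hN
      by_cases hmin : ∀ p, (c p : ℕ) = p
      · refine ⟨1, one_pos, ?_⟩
        rw [one_mul]
        congr 1
        funext p
        exact Fin.ext (hmin p)
      · push Not at hmin
        have hex : ∃ i : ℕ, ∃ h : i < q, (c ⟨i, h⟩ : ℕ) ≠ i := by
          obtain ⟨p, hp⟩ := hmin
          exact ⟨p, p.2, hp⟩
        classical
        obtain ⟨hi, hne⟩ := Nat.find_spec hex
        have hlow : ∀ i' (h : i' < q), i' < Nat.find hex → (c ⟨i', h⟩ : ℕ) = i' := by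
          intro i' h hlt
          by_contra h1
          exact Nat.find_min hex hlt ⟨h, h1⟩
        set i := Nat.find hex
        have hge : ∀ j (h : j < q), j ≤ c ⟨j, h⟩ := by
          intro j
          induction j with
          | zero => intro _; exact Nat.zero_le _
          | succ j ihj =>
            intro h
            have h1 := ihj (by omega)
            have h2 : c ⟨j, by omega⟩ < c ⟨j + 1, h⟩ := hc (by simp)
            rw [Fin.lt_def] at h2
            omega
        have hgt : i < c ⟨i, hi⟩ := lt_of_le_of_ne (hge i hi) (Ne.symm hne)
        set p : Fin q := ⟨i, hi⟩ with hp
        have hlt := (c p).2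
        let x' : Fin n := ⟨c p - 1, by omega⟩
        have hx' : (x' : ℕ) + 1 = c p := by simp only [x']; omega
        have hless : ∀ p', p' < p → (c p' : ℕ) < x' := by
          intro p' hp'
          have h1 := hlow p' p'.2 hp'
          rw [Fin.lt_def] at hp'
          have h2 : (p' : ℕ) < i := hp'
          simp only [x']
          rw [show c p' = c ⟨p', p'.2⟩ from rfl, h1]
          omega
        have hmore : ∀ p', p < p' → (x' : ℕ) + 1 < c p' := by
          intro p' hp'
          have := hc hp'
          rw [Fin.lt_def] at this
          omega
        have hx'c : ∀ p', c p' ≠ x' := by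
          intro p' h
          rcases lt_trichotomy p' p with h1 | h1 | h1
          · exact (hless p' h1).ne (by rw [h])
          · rw [h1] at h
            rw [h] at hx'
            omega
          · have := hmore p' h1
            rw [h] at this
            omega
        have hmono : StrictMono (Function.update c p x') := by
          intro a b hab
          by_cases hb : b = p
          · subst hb
            rw [Function.update_self, Function.update_of_ne hab.ne]
            exact hless a hab
          · rw [Function.update_of_ne hb]
            by_cases ha : a = p
            · subst ha
              rw [Function.update_self, Fin.lt_def]
              have := hmore b hab
              omega
            · rw [Function.update_of_ne ha]
              exact hc hab
        obtain ⟨ρ, hρ, h1⟩ := exists_pos_seqMinor_update hkq horth hα hc p hx' hx'c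
        have hsum : ∑ p', (Function.update c p x' p' : ℕ) < N := by
          rw [← hN]
          refine Finset.sum_lt_sum (fun p' _ => ?_) ⟨p, Finset.mem_univ _, ?_⟩
          · by_cases h2 : p' = p
            · subst h2; rw [Function.update_self]; omega
            · rw [Function.update_of_ne h2]
          · rw [Function.update_self]; omega
        obtain ⟨ρ', hρ', h2⟩ := ih _ hsum _ hmono rfl
        exact ⟨ρ * ρ', mul_pos hρ hρ', by rw [h1, h2, mul_assoc]⟩
  obtain ⟨c₁, hc₁, hne⟩ := exists_seqMinor_ne_zero hy
  obtain ⟨ρ₁, -, h1⟩ := main _ c₁ hc₁ rfl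
  have hmin : seqMinor y (Fin.castLE hq) ≠ 0 := fun h => hne (by rw [h1, h, mul_zero])
  obtain ⟨ρ, hρ, h2⟩ := main _ c hc rfl
  obtain ⟨ρ', hρ', h3⟩ := main _ c' hc' rfl
  rw [h2, h3, mul_mul_mul_comm]
  exact mul_pos (mul_pos hρ hρ') (mul_self_pos.2 hmin)

end Complement

/-! ### Matrices and their row spans -/

section RowSpan

variable {r k n : ℕ}

theorem mem_perp_rowSpan {M : Matrix (Fin r) (Fin n) ℝ} {x : Fin n → ℝ} :
    x ∈ perp (rowSpan M) ↔ ∀ i, M i ⬝ᵥ x = 0 := by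
  rw [perp, Submodule.mem_orthogonalBilin_iff]
  constructor
  · exact fun h i => h (M i) (Submodule.subset_span ⟨i, rfl⟩)
  · intro h y hy
    induction hy using Submodule.span_induction with
    | mem y hy =>
      obtain ⟨i, rfl⟩ := hy
      exact h i
    | zero => simp
    | add y y' _ _ h1 h2 => rw [map_add, LinearMap.add_apply, h1, h2, add_zero]
    | smul a y _ h1 => rw [map_smul, LinearMap.smul_apply, h1, smul_zero]

theorem finrank_perp_rowSpan (M : Matrix (Fin r) (Fin n) ℝ) :
    Module.finrank ℝ (rowSpan M) + Module.finrank ℝ (perp (rowSpan M)) = n := by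
  have h1 : perp (rowSpan M) = LinearMap.ker (Matrix.mulVecLin M) := by
    ext x
    rw [mem_perp_rowSpan, LinearMap.mem_ker, Matrix.mulVecLin_apply]
    exact ⟨fun h => funext h, fun h i => congrFun h i⟩
  have h2 := LinearMap.finrank_range_add_finrank_ker (Matrix.mulVecLin M)
  rw [Module.finrank_fin_fun] at h2
  have h3 : Module.finrank ℝ (rowSpan M) = Module.finrank ℝ (LinearMap.range (Matrix.mulVecLin M)) :=
    (Matrix.rank_eq_finrank_span_row M).symm
  rw [h1, h3, h2]

theorem eq_zero_of_dot_col {M : Matrix (Fin k) (Fin n) ℝ} (hM : Module.finrank ℝ (rowSpan M) = k)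
    {y : Fin k → ℝ} (hy : ∀ e, y ⬝ᵥ M.col e = 0) : y = 0 := by
  have hli : LinearIndependent ℝ M.row := by
    rw [linearIndependent_iff_card_eq_finrank_span, Fintype.card_fin]
    exact hM.symm
  have h1 : Function.Injective M.vecMul := Matrix.vecMul_injective_iff.2 hli
  refine h1 ?_
  simp only [Matrix.zero_vecMul]
  exact funext hy

theorem finrank_rowSpan_of_seqMinor {M : Matrix (Fin k) (Fin n) ℝ} {c : Fin k → Fin n}
    (hc : seqMinor M.col c ≠ 0) : Module.finrank ℝ (rowSpan M) = k := by
  have h1 : Submodule.span ℝ (Set.range M.col) = ⊤ := span_range_eq_top_of_seqMinor_ne_zero hc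
  have h2 := Matrix.rank_eq_finrank_span_row M
  rw [Matrix.rank_eq_finrank_span_cols, h1, finrank_top, Module.finrank_fin_fun] at h2
  exact h2.symm

theorem rowSpan_mul_le (g : Matrix (Fin k) (Fin k) ℝ) (M : Matrix (Fin k) (Fin n) ℝ) :
    rowSpan (g * M) ≤ rowSpan M := by
  rw [rowSpan, Submodule.span_le]
  rintro _ ⟨i, rfl⟩
  have : (g * M).row i = ∑ p, g i p • M.row p := by
    funext e
    rw [Finset.sum_apply]
    rfl
  rw [this]
  exact Submodule.sum_mem _ fun p _ => Submodule.smul_mem _ _ (Submodule.subset_span ⟨p, rfl⟩)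

theorem rowSpan_mul {g : Matrix (Fin k) (Fin k) ℝ} (hg : g.det ≠ 0) (M : Matrix (Fin k) (Fin n) ℝ) :
    rowSpan (g * M) = rowSpan M := by
  refine le_antisymm (rowSpan_mul_le g M) ?_
  have := rowSpan_mul_le g⁻¹ (g * M)
  rwa [← Matrix.mul_assoc, Matrix.nonsing_inv_mul _ (isUnit_iff_ne_zero.2 hg), Matrix.one_mul] at this

theorem exists_mul_eq_of_rowSpan_le {M N : Matrix (Fin k) (Fin n) ℝ} (h : rowSpan N ≤ rowSpan M) :
    ∃ g : Matrix (Fin k) (Fin k) ℝ, N = g * M := by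
  have : ∀ i, ∃ c : Fin k → ℝ, ∑ p, c p • M.row p = N i := fun i =>
    (Submodule.mem_span_range_iff_exists_fun ℝ).1 (h (Submodule.subset_span ⟨i, rfl⟩))
  choose g hg using this
  refine ⟨Matrix.of g, ?_⟩
  ext i e
  have := congrFun (hg i) e
  rw [Finset.sum_apply] at this
  exact this.symm

theorem exists_det_ne_zero_mul_eq {M N : Matrix (Fin k) (Fin n) ℝ} (h : rowSpan N = rowSpan M)
    (hN : Module.finrank ℝ (rowSpan N) = k) :
    ∃ g : Matrix (Fin k) (Fin k) ℝ, g.det ≠ 0 ∧ N = g * M := by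
  obtain ⟨g, hg⟩ := exists_mul_eq_of_rowSpan_le h.le
  obtain ⟨g', hg'⟩ := exists_mul_eq_of_rowSpan_le h.ge
  refine ⟨g, fun h0 => ?_, hg⟩
  obtain ⟨y, hy0, hy⟩ := Matrix.exists_vecMul_eq_zero_iff.2 h0
  refine hy0 (eq_zero_of_dot_col hN fun e => ?_)
  have : y ᵥ* N = 0 := by rw [hg, ← Matrix.vecMul_vecMul, hy, Matrix.zero_vecMul]
  exact congrFun this e

theorem minor_eq_seqMinor (M : Matrix (Fin k) (Fin n) ℝ) (J : Finset (Fin n)) (hJ : J.card = k) :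
    minor M J hJ = seqMinor M.col (J.orderEmbOfFin hJ) := by
  rw [minor, ← Matrix.det_transpose]
  rfl

theorem seqMinor_col_mul (g : Matrix (Fin k) (Fin k) ℝ) (M : Matrix (Fin k) (Fin n) ℝ)
    (c : Fin k → Fin n) : seqMinor (g * M).col c = g.det * seqMinor M.col c :=
  seqMinor_mulVec g M.col c

theorem linearIndepOn_iff_seqMinor {x : Fin n → Fin k → ℝ} {J : Finset (Fin n)} (hJ : J.card = k) :
    LinearIndepOn ℝ x (J : Set (Fin n)) ↔ seqMinor x (J.orderEmbOfFin hJ) ≠ 0 := by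
  have h1 := linearIndepOn_range_iff (R := ℝ) (J.orderEmbOfFin hJ).injective x
  rw [Finset.range_orderEmbOfFin] at h1
  rw [seqMinor_ne_zero_iff, h1]
  rfl

theorem exists_det_mul_pos {x : Fin n → Fin k → ℝ} {c : Fin k → Fin n} (hc : seqMinor x c ≠ 0) :
    ∃ g : Matrix (Fin k) (Fin k) ℝ, 0 < g.det * seqMinor x c := by
  rcases lt_or_gt_of_ne hc with h | h
  · rcases k with _ | k
    · have : seqMinor x c = 1 := Matrix.det_isEmpty
      rw [this] at h
      linarith
    · refine ⟨Matrix.diagonal (Function.update 1 0 (-1)), ?_⟩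
      rw [Matrix.det_diagonal, Finset.prod_update_of_mem (Finset.mem_univ _)]
      simpa using h
  · exact ⟨1, by simpa using h⟩

/-- When all minors have a common sign, a row operation whose determinant has that sign makes them
all positive. -/
theorem rowSpan_mem_GrPos {M : Matrix (Fin k) (Fin n) ℝ} (hk : k ≤ n)
    (h : ∀ c c' : Fin k → Fin n, StrictMono c → StrictMono c' →
      0 < seqMinor M.col c * seqMinor M.col c') : rowSpan M ∈ GrPos k n := by
  have h0 := h _ _ (Fin.strictMono_castLE hk) (Fin.strictMono_castLE hk)
  have hne : seqMinor M.col (Fin.castLE hk) ≠ 0 := fun e => by simp [e] at h0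
  obtain ⟨g, hg⟩ := exists_det_mul_pos hne
  have hg0 : g.det ≠ 0 := fun e => by simp [e] at hg
  refine ⟨finrank_rowSpan_of_seqMinor hne, g * M, rowSpan_mul hg0 M, fun J hJ => ?_⟩
  rw [minor_eq_seqMinor, seqMinor_col_mul]
  have h1 := mul_pos hg (h _ _ (Fin.strictMono_castLE hk) (J.orderEmbOfFin hJ).strictMono)
  have h2 : (g.det * seqMinor M.col (J.orderEmbOfFin hJ)) *
      (seqMinor M.col (Fin.castLE hk) * seqMinor M.col (Fin.castLE hk)) =
      g.det * seqMinor M.col (Fin.castLE hk) *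
      (seqMinor M.col (Fin.castLE hk) * seqMinor M.col (J.orderEmbOfFin hJ)) := by ring
  rw [← h2] at h1
  exact pos_of_mul_pos_left h1 (mul_self_nonneg _)

theorem rowSpan_mem_positroidCell [NeZero n] {M : Matrix (Fin k) (Fin n) ℝ} {f : Equiv.Perm ℤ}
    (hNN : ∀ c c' : Fin k → Fin n, StrictMono c → StrictMono c' →
      0 ≤ seqMinor M.col c * seqMinor M.col c')
    (hJ : ∀ J : Finset (Fin n), J.card = k →
      (LinearIndepOn ℝ M.col (J : Set (Fin n)) ↔ J ∈ positroid k n f))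
    {c₀ : Fin k → Fin n} (hc₀ : StrictMono c₀) (hne : seqMinor M.col c₀ ≠ 0) :
    rowSpan M ∈ positroidCell k n f := by
  obtain ⟨g, hg⟩ := exists_det_mul_pos hne
  have hg0 : g.det ≠ 0 := fun e => by simp [e] at hg
  have hnn : ∀ (J : Finset (Fin n)) (hJ : J.card = k), 0 ≤ minor (g * M) J hJ := by
    intro J hJ
    rw [minor_eq_seqMinor, seqMinor_col_mul]
    have h1 := mul_nonneg hg.le (hNN _ _ hc₀ (J.orderEmbOfFin hJ).strictMono)
    have h2 : (g.det * seqMinor M.col (J.orderEmbOfFin hJ)) *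
        (seqMinor M.col c₀ * seqMinor M.col c₀) =
        g.det * seqMinor M.col c₀ *
        (seqMinor M.col c₀ * seqMinor M.col (J.orderEmbOfFin hJ)) := by ring
    rw [← h2] at h1
    exact nonneg_of_mul_nonneg_left h1 (mul_self_pos.2 hne)
  refine ⟨⟨finrank_rowSpan_of_seqMinor hne, g * M, rowSpan_mul hg0 M, hnn⟩, g * M,
    rowSpan_mul hg0 M, fun J hJc => ?_⟩
  have h3 : minor (g * M) J hJc ≠ 0 ↔ J ∈ positroid k n f := by
    rw [← hJ J hJc, linearIndepOn_iff_seqMinor hJc, minor_eq_seqMinor, seqMinor_col_mul,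
      mul_ne_zero_iff, and_iff_right hg0]
  exact ⟨fun h => lt_of_le_of_ne (hnn J hJc) (h3.2 h).symm, fun h => by
    by_contra h4; exact h (h3.1 h4)⟩

theorem perp_perp_rowSpan {M : Matrix (Fin k) (Fin n) ℝ} {Y : Matrix (Fin r) (Fin n) ℝ}
    (hY : rowSpan Y = perp (rowSpan M)) : rowSpan M = perp (rowSpan Y) := by
  have h1 := finrank_perp_rowSpan M
  have h2 := finrank_perp_rowSpan Y
  rw [hY] at h2 ⊢
  refine Submodule.eq_of_le_of_finrank_eq (fun x hx y hy => ?_) (by omega)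
  have h3 := hy x hx
  simp only [dotProductBilin_apply_apply] at h3 ⊢
  rw [dotProduct_comm, h3]

end RowSpan

theorem orderEmbOfFin_image {n K : ℕ} {c : Fin K → Fin n} (hc : StrictMono c)
    (hJ : (Finset.univ.image c).card = K) : ((Finset.univ.image c).orderEmbOfFin hJ : Fin K → Fin n) = c :=
  (Finset.orderEmbOfFin_unique hJ (fun p => by simp) hc).symm

theorem card_image_strictMono {n K : ℕ} {c : Fin K → Fin n} (hc : StrictMono c) :
    (Finset.univ.image c).card = K := by
  rw [Finset.card_image_of_injective _ hc.injective, Finset.card_fin]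

/-! ### The sequence of columns of a matrix -/

section ExtCol

variable {k n : ℕ} [NeZero n] {ι : Type*}

theorem extCol_quasi (M : Matrix ι (Fin n) ℝ) : Quasi n ((-1) ^ (k + 1)) (extCol k M) := by
  intro j
  have hn : (n : ℤ) ≠ 0 := by exact_mod_cast NeZero.ne n
  have h1 : residue n (j + n) = residue n j := (residue_eq_iff _ _).2 ⟨1, by ring⟩
  rw [extCol, extCol, h1, smul_smul, show j + (n : ℤ) - 1 = j - 1 + n by ring, show j - 1 + (n : ℤ) = j - 1 + 1 * n by ring, Int.add_mul_ediv_right _ _ hn,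
    mul_add, mul_one, zpow_add₀ (by norm_num), mul_comm]
  congr 2
  rw [show (k : ℤ) - 1 = ((k + 1 : ℕ) : ℤ) + (-2) by push_cast; ring, zpow_add₀ (by norm_num),
    zpow_natCast]
  norm_num

theorem extCol_add_one (M : Matrix ι (Fin n) ℝ) (e : Fin n) :
    extCol k M ((e : ℕ) + 1) = M.col e := by
  have hn : (0 : ℤ) < n := by exact_mod_cast NeZero.pos n
  rw [extCol, residue_add_one, add_sub_cancel_right,
    Int.ediv_eq_zero_of_lt (by omega) (by exact_mod_cast e.2), mul_zero, zpow_zero, one_smul]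

theorem onPeriod_extCol (M : Matrix ι (Fin n) ℝ) : onPeriod n (extCol k M) = M.col :=
  funext fun e => extCol_add_one M e

theorem stackSeq_extCol {ℓ : ℕ} (V : Matrix (Fin k) (Fin n) ℝ) (W : Matrix (Fin ℓ) (Fin n) ℝ) :
    extCol k (stack V W) = stackSeq (extCol k V) (extCol k W) := by
  funext j p
  rcases p with p | p <;> rfl

theorem cycNonneg_extCol {K : ℕ} {M : Matrix (Fin K) (Fin n) ℝ} {x : ℤ → Fin K → ℝ}
    (hq : Quasi n ((-1) ^ (K + 1)) x) (hx : onPeriod n x = M.col)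
    (h : ∀ c c' : Fin K → Fin n, StrictMono c → StrictMono c' →
      0 ≤ seqMinor M.col c * seqMinor M.col c') : CycNonneg n x := by
  rw [← hx] at h
  exact cycNonneg_of_linear (NeZero.pos n) hq h

theorem cycPos_extCol {K : ℕ} {M : Matrix (Fin K) (Fin n) ℝ} {x : ℤ → Fin K → ℝ}
    (hq : Quasi n ((-1) ^ (K + 1)) x) (hx : onPeriod n x = M.col)
    (h : ∀ c c' : Fin K → Fin n, StrictMono c → StrictMono c' →
      0 < seqMinor M.col c * seqMinor M.col c') : CycPos n x := by
  rw [← hx] at h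
  exact cycPos_of_linear (NeZero.pos n) hq h

/-- Membership in a positroid cell in terms of the minors of an arbitrary representative. -/
theorem minors_of_mem_positroidCell {V : Matrix (Fin k) (Fin n) ℝ} {f : Equiv.Perm ℤ}
    (hV : rowSpan V ∈ positroidCell k n f) :
    (∀ c c' : Fin k → Fin n, StrictMono c → StrictMono c' →
      0 ≤ seqMinor V.col c * seqMinor V.col c') ∧
    (∀ J : Finset (Fin n), J.card = k →
      (LinearIndepOn ℝ V.col (J : Set (Fin n)) ↔ J ∈ positroid k n f)) := by
  obtain ⟨⟨hrank, -⟩, M, hM, hmin⟩ := hV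
  obtain ⟨g, hg, rfl⟩ := exists_det_ne_zero_mul_eq hM.symm hrank
  have hnn : ∀ c : Fin k → Fin n, StrictMono c → 0 ≤ seqMinor M.col c := by
    intro c hc
    have hJ := card_image_strictMono hc
    have h1 := hmin _ hJ
    rw [minor_eq_seqMinor, orderEmbOfFin_image hc hJ] at h1
    by_cases h : Finset.univ.image c ∈ positroid k n f
    · exact (h1.1 h).le
    · exact (h1.2 h).ge
  constructor
  · intro c c' hc hc'
    rw [seqMinor_col_mul, seqMinor_col_mul, mul_mul_mul_comm]
    exact mul_nonneg (mul_self_nonneg _) (mul_nonneg (hnn c hc) (hnn c' hc'))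
  · intro J hJ
    rw [linearIndepOn_iff_seqMinor hJ, seqMinor_col_mul, mul_ne_zero_iff, and_iff_right hg,
      ← minor_eq_seqMinor]
    refine ⟨fun h => ?_, fun h => ((hmin J hJ).1 h).ne'⟩
    by_contra h'
    exact h ((hmin J hJ).2 h')

/-- Membership of any `J` in the positroid includes, through the Gale relation, an injective
enumeration of `I_i` by `Fin k`. So a nonempty positroid forces every necklace term to have `k`
elements. -/
theorem necklaceCount_eq_of_mem_positroid {f : Equiv.Perm ℤ} (hk : k ≤ n)
    (hf : f ∈ boundedAffinePerms n k (n - k)) {J : Finset (Fin n)} (hJ : J ∈ positroid k n f) (a : ℤ) :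
    necklaceCount k f a n = k := by
  obtain ⟨i, h1, h2, h3, -⟩ := periodic_reduce (n := n) (F := fun a => necklaceCount k f a n)
    (fun a => necklaceCount_add hf.1 a n) a
  rw [← h3]
  obtain ⟨s, t, hs, -, hs', -, -⟩ := hJ.2 i h1 h2
  rw [← coe_necklaceFinset hk hf] at hs'
  have hinj : Function.Injective s := fun p q h => hs.injective (by simp [h])
  rw [← card_necklaceFinset, ← Set.ncard_coe_finset, ← hs', Set.ncard_range_of_injective hinj]
  simp

end ExtCol

theorem intervalRank_mono {k : ℕ} (x : ℤ → Fin k → ℝ) (a : ℤ) {s s' : ℕ} (h : s ≤ s') :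
    intervalRank x a s ≤ intervalRank x a s' := by
  refine Submodule.finrank_mono (Submodule.span_mono (Set.image_mono (Set.Ico_subset_Ico_right ?_)))
  have : (s : ℤ) ≤ s' := by exact_mod_cast h
  linarith

theorem intervalRank_le {k : ℕ} (x : ℤ → Fin k → ℝ) (a : ℤ) (s : ℕ) : intervalRank x a s ≤ k :=
  (Submodule.finrank_le _).trans (by simp)

theorem exists_seqMinor_ne_zero_of_intervalRank {n k : ℕ} [NeZero n] {e : ℝ} {x : ℤ → Fin k → ℝ}
    (h : Quasi n e x) (he : e * e = 1) {a : ℤ} {s : ℕ} (hs : s ≤ n) (hr : intervalRank x a s = k)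
    (hspan : Submodule.span ℝ (Set.range (onPeriod n x)) = ⊤) :
    ∃ c : Fin k → ℤ, StrictMono c ∧ (∀ p, a ≤ c p ∧ c p < a + s) ∧ seqMinor x c ≠ 0 := by
  obtain ⟨J, hJ, hli, hle⟩ := exists_basis_intervalRank h he hspan a hs
  obtain ⟨c, hc, hcJ⟩ := exists_cyclicEnum a hJ
  have hall : ∀ j ∈ J, cyclicPos n a j < s := by
    have h1 : J.filter (cyclicPos n a · < s) = J :=
      Finset.eq_of_subset_of_card_le (Finset.filter_subset _ _) (by omega)
    intro j hj
    rw [← h1] at hj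
    exact (Finset.mem_filter.1 hj).2
  have hmem : ∀ p, c p ∈ J := fun p => by
    rw [← Finset.mem_coe, ← hcJ]; exact ⟨p, rfl⟩
  refine ⟨fun p => a + cyclicPos n a (c p), fun p q hpq => ?_, fun p => ?_, ?_⟩
  · have : cyclicPos n a (c p) < cyclicPos n a (c q) := hc hpq
    simpa using this
  · have h1 := cyclicPos_nonneg a (c p)
    have h2 := hall _ (hmem p)
    simp only
    omega
  · choose σ hσ hx using exists_sign_onPeriod (n := n) h he
    have h1 : seqMinor x (fun p => a + cyclicPos n a (c p)) =
        (∏ p, σ (a + cyclicPos n a (c p))) * seqMinor (onPeriod n x) c := by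
      rw [seqMinor_def, seqMinor_def, ← smul_eq_mul, ← AlternatingMap.map_smul_univ]
      congr 1
      funext p
      rw [hx, residue_cyclicPos]
    rw [h1]
    refine mul_ne_zero (Finset.prod_ne_zero_iff.2 fun p _ h0 => ?_)
      (seqMinor_ne_zero_of_linearIndepOn hli (fun p q hpq => hc.injective (by simp [hpq])) hmem)
    have := hσ (a + cyclicPos n a (c p))
    rw [h0, zero_mul] at this
    exact zero_ne_one this

/-! ### The stacked twist -/

theorem boundedAffinePerms_mono {n a b b' : ℕ} (h : b ≤ b') :
    boundedAffinePerms n a b ⊆ boundedAffinePerms n a b' := fun f hf =>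
  ⟨hf.1, fun i => by have := hf.2 i; omega⟩

section Final

variable {k ℓ m n : ℕ} [NeZero n]

theorem isCircular_of_windowsIndep {U : Matrix (Fin k ⊕ Fin ℓ) (Fin n) ℝ}
    (hu : WindowsIndep (k + ℓ) (extCol k U)) : IsCircular U := fun j =>
  ⟨hu (j - ℓ), (hu (j - ℓ)).span_eq_top_of_card_eq_finrank' (by simp)⟩

theorem twist_eq {U : Matrix (Fin k ⊕ Fin ℓ) (Fin n) ℝ} (hU : IsCircular U)
    {t : ℤ → Fin k ⊕ Fin ℓ → ℝ} (ht : IsDualSeq (k + ℓ) ℓ (extCol k U) t) (p : Fin k ⊕ Fin ℓ)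
    (e : Fin n) : twist U hU p e = t ((e : ℕ) + 1) p := by
  have h := (existsUnique_isTwistCol hU (((e : ℕ) : ℤ) + 1)).choose_spec.2 (t ((e : ℕ) + 1))
    fun i => ht _ i i.2
  rw [h]
  rfl

theorem admissible_extCol (hm : Even m) (hsum : k + ℓ + m = n) {V : Matrix (Fin k) (Fin n) ℝ}
    {W : Matrix (Fin ℓ) (Fin n) ℝ} (hW : rowSpan W ∈ GrPosPerp (k + m) n)
    (hvnonneg : CycNonneg n (extCol k V))
    (hvwin : ∀ a : ℤ, ∃ c : Fin k → ℤ, StrictMono c ∧ (∀ p, a ≤ c p ∧ c p < a + (k + ℓ : ℕ)) ∧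
      seqMinor (extCol k V) c ≠ 0) :
    ∃ z, Admissible k ℓ m n (extCol k V) z (extCol k W) := by
  obtain ⟨Z', ⟨hZr, Z, rfl, hZ⟩, hWZ⟩ := hW
  have hqz : Quasi n ((-1) ^ (k + m + 1)) (extCol k Z) := by
    have := extCol_quasi (k := k) Z
    rwa [show k + m + 1 = k + 1 + m by ring, pow_add, hm.neg_one_pow, mul_one]
  have hWr : Module.finrank ℝ (rowSpan W) = ℓ := by
    have := finrank_perp_rowSpan Z
    rw [← hWZ] at this
    have h2 : Module.finrank ℝ (rowSpan Z) = k + m := hZr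
    omega
  refine ⟨extCol k Z, extCol_quasi V, extCol_quasi Z, extCol_quasi W, ?_, fun s a b => ?_, fun y hy => ?_,
    hvnonneg, hvwin⟩
  · refine cycPos_extCol hqz (onPeriod_extCol Z) fun c c' hc hc' => ?_
    have h1 : ∀ c : Fin (k + m) → Fin n, StrictMono c → 0 < seqMinor Z.col c := by
      intro c hc
      have h2 := hZ _ (card_image_strictMono hc)
      rwa [minor_eq_seqMinor, orderEmbOfFin_image hc] at h2
    exact mul_pos (h1 c hc) (h1 c' hc')
  -- Both sequences carry the same sign over a period, so their product is periodic; its sum over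
  -- any period is the inner product of a row of `Z` with a row of `W`.
  · rw [sum_period (f := fun j => extCol k Z j a * extCol k W j b) (fun j => ?_) s,
      ← sum_period (f := fun j => extCol k Z j a * extCol k W j b) (fun j => ?_) 1,
      ← Fin.sum_univ_eq_sum_range (fun i : ℕ => extCol k Z (1 + i) a * extCol k W (1 + i) b)]
    · have h1 : W b ∈ perp (rowSpan Z) := by
        rw [← hWZ]; exact Submodule.subset_span ⟨b, rfl⟩
      have h2 := mem_perp_rowSpan.1 h1 a
      rw [← h2]
      refine Finset.sum_congr rfl fun i _ => ?_
      rw [add_comm (1 : ℤ), extCol_add_one, extCol_add_one]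
      rfl
    all_goals
      have h1 := congrFun (extCol_quasi (k := k) Z j) a
      have h2 := congrFun (extCol_quasi (k := k) W j) b
      simp only [Pi.smul_apply, smul_eq_mul] at h1 h2 ⊢
      rw [h1, h2]
      linear_combination (extCol k Z j a * extCol k W j b) * neg_one_pow_mul_self (k + 1)
  · exact eq_zero_of_dot_col hWr fun e => by rw [← extCol_add_one (k := k)]; exact hy _

/-- Minors that are positive after alternating the column signs become ordinary positive minors on
the orthogonal complement, so a basis of `perp (rowSpan A)` gives the required positive matrix.
Signs on `Fin n` start at `(-1)^0` and those of `altSeq` at `(-1)^1`; the global sign is absorbed by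
the matrix `-1`. -/
theorem rowSpan_mem_GrPosPerp (hsum : k + ℓ + m = n) {A : Matrix (Fin k) (Fin n) ℝ} {x : ℤ → Fin k → ℝ}
    (hx : ∀ e, A.col e = x ((e : ℕ) + 1)) (hpos : CycPos n (altSeq x)) :
    rowSpan A ∈ GrPosPerp (ℓ + m) n := by
  have halt : CycPos n fun j => -altSeq x j :=
    hpos.of_linear (A := -1) (by rw [Matrix.det_neg]; simp) fun j => by
      rw [Matrix.neg_mulVec, Matrix.one_mulVec]
  have hcm : ∀ d : Fin k → Fin n, StrictMono d → CycMono n fun p => ((d p : ℕ) : ℤ) + 1 := fun d hd =>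
    cycMono_of_mem (fun p q hpq => by
      have : ((d p : ℕ)) < d q := hd hpq
      simpa using this) 1 fun p => ⟨by omega, by have := (d p).2; omega⟩
  have hα : ∀ d d' : Fin k → Fin n, StrictMono d → StrictMono d' →
      0 < seqMinor (fun e : Fin n => (-1 : ℝ) ^ (e : ℕ) • A.col e) d *
        seqMinor (fun e : Fin n => (-1 : ℝ) ^ (e : ℕ) • A.col e) d' := by
    intro d d' hd hd'
    have h1 : (fun e : Fin n => (-1 : ℝ) ^ (e : ℕ) • A.col e) =
        fun e : Fin n => (fun j => -altSeq x j) ((e : ℕ) + 1) := by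
      funext e
      simp only
      rw [hx, altSeq, zpow_add_one₀ (by norm_num), zpow_natCast, mul_neg_one, neg_smul, neg_neg]
    rw [h1]
    exact halt _ _ (hcm d hd) (hcm d' hd')
  have hk : k ≤ n := by omega
  have hrank : Module.finrank ℝ (rowSpan A) = k := by
    have h0 := hα _ _ (Fin.strictMono_castLE hk) (Fin.strictMono_castLE hk)
    rw [seqMinor_smul (fun e : Fin n => (-1 : ℝ) ^ (e : ℕ))] at h0
    exact finrank_rowSpan_of_seqMinor (M := A) (c := Fin.castLE hk) fun h => by simp [h] at h0
  have hperp := finrank_perp_rowSpan A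
  let b := Module.finBasisOfFinrankEq ℝ (perp (rowSpan A)) (show _ = ℓ + m by omega)
  let Y : Matrix (Fin (ℓ + m)) (Fin n) ℝ := Matrix.of fun i => (b i : Fin n → ℝ)
  have hY : rowSpan Y = perp (rowSpan A) := by
    have h1 := congrArg (Submodule.map (perp (rowSpan A)).subtype) b.span_eq
    rw [Submodule.map_span, Submodule.map_subtype_top, ← Set.range_comp] at h1
    exact h1
  refine ⟨rowSpan Y, rowSpan_mem_GrPos (by omega) fun c c' hc hc' => ?_, perp_perp_rowSpan hY⟩
  refine seqMinor_mul_pos_of_annihilator (α := A.col) (by omega) (fun a i => ?_) hα (fun v hv => ?_) hc hc'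
  · exact mem_perp_rowSpan.1 (b i).2 a
  · refine eq_zero_of_dot_col (M := Y) ?_ hv
    rw [hY]
    omega

end Final

end StackedTwist

end

/-! ### Assembly of the theorem -/

open StackedTwist in
theorem theorem4p4 (k ℓ m n : ℕ) [NeZero n] (hn : 2 ≤ n) (hm : Even m) (hsum : k + ℓ + m = n)
    (V : Matrix (Fin k) (Fin n) ℝ) (W : Matrix (Fin ℓ) (Fin n) ℝ)
    (hV : rowSpan V ∈ GrGE m k n) (hW : rowSpan W ∈ GrPosPerp (k + m) n) :
    ∃ hU : IsCircular (stack V W),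
      rowSpan (stackedTwist V W hU).1 ∈ GrPosPerp (ℓ + m) n ∧
      rowSpan (stackedTwist V W hU).2 ∈ GrGE m ℓ n ∧
      ∃ f ∈ boundedAffinePerms n k ℓ,
        rowSpan V ∈ positroidCell k n f ∧
        (∀ g ∈ boundedAffinePerms n k (n - k), rowSpan V ∈ positroidCell k n g → g = f) ∧
        f⁻¹ ∈ boundedAffinePerms n ℓ k ∧
        rowSpan (stackedTwist V W hU).2 ∈ positroidCell ℓ n f⁻¹ := by
  obtain ⟨f, hf, hcell⟩ := hV
  rw [show n - k - m = ℓ by omega] at hf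
  have hk : k ≤ n := by omega
  have hf' : f ∈ boundedAffinePerms n k (n - k) := boundedAffinePerms_mono (by omega) hf
  set v := extCol k V with hv
  have hvq : Quasi n ((-1) ^ (k + 1)) v := extCol_quasi V
  have he := neg_one_pow_mul_self (k + 1)
  have hon : onPeriod n v = V.col := onPeriod_extCol V
  obtain ⟨hnn, hbases⟩ := minors_of_mem_positroidCell hcell
  have hvnn : CycNonneg n v := cycNonneg_extCol hvq hon hnn
  have hVr : Module.finrank ℝ (rowSpan V) = k := hcell.1.1
  obtain ⟨c₀, hc₀, hne₀⟩ := exists_seqMinor_ne_zero (y := V.col) fun y hy => eq_zero_of_dot_col hVr hy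
  have hspan : Submodule.span ℝ (Set.range (onPeriod n v)) = ⊤ := by
    rw [hon]; exact span_range_eq_top_of_seqMinor_ne_zero hne₀
  -- interval ranks of `v`
  have hrank : ∀ g ∈ boundedAffinePerms n k (n - k), rowSpan V ∈ positroidCell k n g →
      (∀ a, necklaceCount k g a n = k) ∧
      ∀ (a : ℤ) (s : ℕ), s ≤ n → intervalRank v a s = necklaceCount k g a s := by
    intro g hg hgcell
    have hb := (minors_of_mem_positroidCell hgcell).2
    have hJ := card_image_strictMono hc₀
    have hmem : Finset.univ.image c₀ ∈ positroid k n g := by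
      rw [← hb _ hJ, linearIndepOn_iff_seqMinor hJ, orderEmbOfFin_image hc₀]
      exact hne₀
    have hfull := necklaceCount_eq_of_mem_positroid hk hg hmem
    refine ⟨hfull, fun a s hs => intervalRank_eq_necklaceCount hvq he hspan hk hg hfull ?_ a hs⟩
    rw [hon]
    exact hb
  obtain ⟨hfull, hr⟩ := hrank f hf' hcell
  -- Since `f i ≤ i + ℓ`, each necklace term lies in a window of length `k + ℓ`. So `V` has full
  -- rank on every such window, which is how the condition defining `Gr_{≥m}` enters.
  have hfull' : ∀ a, necklaceCount k f a (k + ℓ) = k := fun a => by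
    rw [← card_filter_window hf (show k + ℓ ≤ n by omega), hfull]
  -- the twisted sequence
  obtain ⟨z, hadm⟩ := admissible_extCol hm hsum hW hvnn fun a =>
    exists_seqMinor_ne_zero_of_intervalRank hvq he (by omega) ((hr a _ (by omega)).trans (hfull' a)) hspan
  have hu := hadm.windowsIndep_stackSeq hsum
  have hu' : WindowsIndep (k + ℓ) (extCol k (stack V W)) := by rw [stackSeq_extCol]; exact hu
  have hU := isCircular_of_windowsIndep hu'
  set t := twistSeq (extCol k (stack V W)) with ht_def
  have ht' : IsDualSeq (k + ℓ) ℓ (extCol k (stack V W)) t := isDualSeq_twistSeq hu'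
  have ht : IsDualSeq (k + ℓ) ℓ (stackSeq v (extCol k W)) t := by rwa [← stackSeq_extCol]
  obtain ⟨htop, hbot⟩ := hadm.twist hsum hm ht
  have hbq := (sign_altSeq_topSeq hadm hsum hm ht).2
  have heℓ := neg_one_pow_mul_self (ℓ + 1)
  have hcol1 : ∀ e, (stackedTwist V W hU).1.col e = topSeq t ((e : ℕ) + 1) := fun e =>
    funext fun p => twist_eq hU ht' (Sum.inl p) e
  have hcol2 : onPeriod n (botSeq t) = (stackedTwist V W hU).2.col :=
    funext fun e => funext fun p => (twist_eq hU ht' (Sum.inr p) e).symm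
  -- the cell of the bottom part
  have hinv := inv_mem_boundedAffinePerms hf
  have hinv' : f⁻¹ ∈ boundedAffinePerms n ℓ (n - ℓ) := boundedAffinePerms_mono (by omega) hinv
  -- The interval ranks of the lower half of the twist and the necklace counts of `f⁻¹` satisfy the
  -- same identity in terms of `v` and `f`. Beyond length `k + ℓ` both have reached their maximum
  -- `ℓ`.
  have hsmall : ∀ (a : ℤ) (s : ℕ), s ≤ k + ℓ →
      intervalRank (botSeq t) a s = necklaceCount ℓ f⁻¹ a s := by
    intro a s hs
    have h1 := intervalRank_botSeq ht hu a hs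
    have h2 := necklaceCount_inv hf hfull' a hs
    rw [hr _ _ (by omega)] at h1
    omega
  have hlast : ∀ a, necklaceCount ℓ f⁻¹ a (k + ℓ) = ℓ := by
    intro a
    have h2 := necklaceCount_inv hf hfull' a le_rfl
    have h3 : ∀ a, necklaceCount k f a (k + ℓ - (k + ℓ)) = 0 := fun a => by
      simp [necklaceCount]
    rw [h3] at h2
    omega
  have hlong : ∀ (a : ℤ) (s : ℕ), k + ℓ ≤ s → necklaceCount ℓ f⁻¹ a s = ℓ := by
    intro a s hs
    rw [card_filter_window hinv (show ℓ + k ≤ s by omega), add_comm ℓ k]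
    exact hlast a
  have hrlast : ∀ a, intervalRank (botSeq t) a (k + ℓ) = ℓ := fun a =>
    (hsmall a _ le_rfl).trans (hlast a)
  have hrinv : ∀ (a : ℤ) (s : ℕ), s ≤ n → intervalRank (botSeq t) a s = necklaceCount ℓ f⁻¹ a s := by
    intro a s hs
    by_cases h : s ≤ k + ℓ
    · exact hsmall a s h
    · refine (le_antisymm (intervalRank_le _ _ _) ?_).trans (hlong a s (by omega)).symm
      exact (hrlast a).ge.trans (intervalRank_mono _ _ (by omega))
  have hfullinv : ∀ a, necklaceCount ℓ f⁻¹ a n = ℓ := fun a => hlong a n (by omega)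
  have hspanb : Submodule.span ℝ (Set.range (botSeq t)) = ⊤ := by
    have h1 : Submodule.span ℝ (botSeq t '' Set.Ico 0 (0 + (k + ℓ : ℕ))) = ⊤ :=
      Submodule.eq_top_of_finrank_eq ((hrlast 0).trans (by simp))
    rw [eq_top_iff, ← h1]
    exact Submodule.span_mono (Set.image_subset_range _ _)
  have hbases' : ∀ J : Finset (Fin n), J.card = ℓ →
      (LinearIndepOn ℝ (stackedTwist V W hU).2.col (J : Set (Fin n)) ↔ J ∈ positroid ℓ n f⁻¹) := by
    intro J hJ
    rw [← hcol2]
    exact linearIndepOn_iff_mem_positroid hbq heℓ hbot hspanb (by omega) hinv' hfullinv hrinv hJ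
  have hcell' : rowSpan (stackedTwist V W hU).2 ∈ positroidCell ℓ n f⁻¹ := by
    have hJ : (necklaceFinset ℓ n f⁻¹ 0).card = ℓ := (card_necklaceFinset _ _).trans (hfullinv 0)
    have h1 := (hbases' _ hJ).2 (necklaceFinset_mem_positroid (by omega) hinv' hfullinv 0)
    refine rowSpan_mem_positroidCell (fun c c' hc hc' => ?_) hbases' (OrderEmbedding.strictMono _)
      ((linearIndepOn_iff_seqMinor hJ).1 h1)
    rw [← hcol2]
    exact cycNonneg_linear hbot c c' hc hc'
  refine ⟨hU, rowSpan_mem_GrPosPerp hsum hcol1 htop, ⟨f⁻¹, ?_, hcell'⟩, f, hf, hcell,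
    fun g hg hgcell => ?_, hinv, hcell'⟩
  · rwa [show n - ℓ - m = k by omega]
  -- The interval ranks of `V` are the necklace counts of every `g` whose cell contains it, and
  -- these counts determine `g`.
  · exact eq_of_necklaceCount_eq hk hg hf' fun a s hs => by
      rw [← hr a s hs, ← (hrank g hg hgcell).2 a s hs]
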